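/- **Data.** Let $K\ge 2$, $P\ge 3$ and let $v_1,\dots,v_K,c_1,\dots,c_K\in\mathbb R^d$ be orthonormal. A labeled example $(x,y)\sim\mathcal D$, $x=(x^{(1)},\dots,x^{(P)})\in(\mathbb R^d)^P$, $y\in\{\pm1\}$, is generated as follows. Draw independently a pair $(k,k')$ uniformly among pairs in $[K]^2$ with $k\ne k'$, signs $y,\epsilon$ uniform on $\{\pm1\}$, and $\alpha,\beta,\gamma$ from distributions $\mathcal D_\alpha,\mathcal D_\beta,\mathcal D_\gamma$ supported in $[C_1,C_2]$ with $0<C_1\le C_2$. One patch of $x$ equals $y\alpha v_k$, one equals $\beta c_k$, one equals $\epsilon\gamma v_{k'}$ (their three distinct positions are arbitrary, possibly random and dependent on the variables above), and the other $P-3$ patches are independent $N(0,(\sigma_p^2/d)I_d)$ vectors, independent of everything above. Write $(x,y)\in\Omega_k$ if some patch of $x$ is a nonzero multiple of $c_k$. **Model.** There are $M$ experts $f_m(x;W)=\sum_{j=1}^J\sum_{p=1}^P\langle w_{m,j},x^{(p)}\rangle^3$, with weights $W_m=(w_{m,1},\dots,w_{m,J})\in\mathbb R^{d\times J}$, and a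 router $\Theta=(\theta_1,\dots,\theta_M)$ with $h_m(x;\Theta)=\sum_p\langle\theta_m,x^{(p)}\rangle$ and $\pi_m(x;\Theta)=e^{h_m(x;\Theta)}/\sum_{m'}e^{h_{m'}(x;\Theta)}$. **Training.** Let $(x_i,y_i)_{i\le n}$ be i.i.d. from $\mathcal D$. Initialize $\Theta^{(0)}=0$ and the entries of $W^{(0)}$ as i.i.d. $N(0,\sigma_0^2)$. At round $t=0,1,2,\dots$ draw fresh independent $r^{(t)}_{m,i}\sim\mathrm{Unif}[0,1]$, set $m_{i,t}=\arg\max_m\{h_m(x_i;\Theta^{(t)})+r^{(t)}_{m,i}\}$, and let $$\mathcal L^{(t)}(\Theta,W)=\frac1n\sum_{i=1}^n\ell\big(y_i\,\pi_{m_{i,t}}(x_i;\Theta)f_{m_{i,t}}(x_i;W)\big),\qquad \ell(z)=\log(1+e^{-z}),$$ with the routing $m_{i,t}$ held fixed when differentiating. With all gradients evaluated at $(\Theta^{(t)},W^{(t)})$, update for every $m\in[M]$ $$W_m^{(t+1)}=W_m^{(t)}-\eta\,\frac{\nabla_{W_m}\mathcal L^{(t)}}{\|\nabla_{W_m}\mathcal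 L^{(t)}\|_F},\qquad \theta_m^{(t+1)}=\theta_m^{(t)}-\eta_r\nabla_{\theta_m}\mathcal L^{(t)},$$ where $W_m$ is left unchanged if its gradient is zero. The sample, the initialization and the router noise are independent. Let $\mathcal M_k$ be the set of experts $m$ for which the maximum of $\langle v_{k'},w^{(0)}_{m,j}\rangle$ over $(k',j)\in[K]\times[J]$ is attained with $k'=k$. **Statement.** There is an absolute constant $c_0>0$, and for every $a\in\mathbb N$ there is $A\in\mathbb N$, such that the following holds. Consider the limit $d\to\infty$, with $C_1,C_2,\sigma_p>0$ and all constants hidden in $\Omega,\Theta$ below fixed, and suppose that $K,P\le(\log d)^a$, $n=\Omega(d)$, $M=\Theta(K\log K\log\log d)$, $J=\Theta(\log M\log\log d)$, $\sigma_0\in[d^{-1/3},d^{-0.01}]$, $0<\eta\le\sigma_0/(\log d)^A$ and $\eta_r=\Theta(M^2)\,\eta$. Let $T_1=\lfloor\eta^{-1}\sigma_0^{0.5}\rfloor$. Then, with probability at least $1-o(1)$ over the sample, the initialization and the router noise, for all $k\in[K]$ and all $m\in\mathcal M_k$, $$\mathbb P_{(x,y)\sim\mathcal D}\big(y f_m(x;W^{(T_1)})\le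 0\,\big|\,(x,y)\in\Omega_k\big)=o(1),$$ $$\mathbb P_{(x,y)\sim\mathcal D}\big(y f_m(x;W^{(T_1)})\le 0\,\big|\,(x,y)\in\Omega_{k'}\big)\ge \frac{c_0}{K}\qquad\text{for all }k'\ne k.$$ The $o(1)$ terms tend to $0$ as $d\to\infty$, uniformly over all choices of the remaining parameters, vectors and distributions satisfying these conditions. -/

import Mathlib

open MeasureTheory ProbabilityTheory

noncomputable section

namespace MoE

/-! ### Data model -/

/-- An input: `P` patches of dimension `d`. -/
abbrev Input (P d : ℕ) := Fin P → EuclideanSpace ℝ (Fin d)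

/-- A labeled example `(x, y)`; the label is a real number (equal to `±1` under the data law). -/
abbrev Sample (P d : ℕ) := Input P d × ℝ

/-- The latent signal variables `((k, k'), y, ε, α, β, γ)` of one example. -/
abbrev Signal (K : ℕ) := (Fin K × Fin K) × ℝ × ℝ × ℝ × ℝ × ℝ

/-- Joint law of `((k, k'), y, ε, α, β, γ)`: the pair `(k, k')` is uniform over pairs with
`k ≠ k'`, `y` and `ε` are uniform on `{±1}`, the strengths have laws `Dα`, `Dβ`, `Dγ`, and all
of these are independent. -/
def signalLaw (K : ℕ) (Dα Dβ Dγ : Measure ℝ) : Measure (Signal K) :=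
  (uniformOn {p : Fin K × Fin K | p.1 ≠ p.2}).prod
    ((uniformOn ({1, -1} : Set ℝ)).prod
      ((uniformOn ({1, -1} : Set ℝ)).prod
        (Dα.prod (Dβ.prod Dγ))))

/-- The Gaussian law with i.i.d. `N(0, s²)` entries. -/
def isoGaussian (ι : Type) [Fintype ι] (s : ℝ) : Measure (EuclideanSpace ℝ ι) :=
  (stdGaussian (EuclideanSpace ℝ ι)).map (fun g => s • g)

/-- The example built from signal vectors `v`, center vectors `c`, the positions
`q 0`, `q 1`, `q 2` of the feature signal, the cluster-center signal and the feature noise,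
the latent signal variables, and the noise vectors: the patch `q 0` is `y α v_k`, the patch `q 1`
is `β c_k`, the patch `q 2` is `ε γ v_{k'}`, and every other patch is random noise. -/
def assemble {K P d : ℕ} (v c : Fin K → EuclideanSpace ℝ (Fin d)) :
    ((Fin 3 → Fin P) × Signal K) × Input P d → Sample P d :=
  fun ⟨⟨q, ⟨⟨k, k'⟩, y, e, α, β, γ⟩⟩, ξ⟩ =>
    (fun p =>
      if p = q 0 then (y * α) • v k
      else if p = q 1 then β • c k
      else if p = q 2 then (e * γ) • v k'
      else ξ p, y)

/-- The data distribution. `place` is the joint law of the three positions and the latent signal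
variables; the noise vectors are i.i.d. `N(0, (σp² / d) I)` and independent of these. -/
def dataLaw {K P d : ℕ} (v c : Fin K → EuclideanSpace ℝ (Fin d)) (σp : ℝ)
    (place : Measure ((Fin 3 → Fin P) × Signal K)) : Measure (Sample P d) :=
  (place.prod (Measure.pi fun _ : Fin P => isoGaussian (Fin d) (σp / √(d : ℝ)))).map
    (assemble v c)

/-- Admissible joint laws of positions and signal variables: the signal variables have the
prescribed law and the three positions are distinct. How the positions are chosen is otherwise
unrestricted. -/
structure IsPlacement {K P : ℕ} (Dα Dβ Dγ : Measure ℝ)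
    (place : Measure ((Fin 3 → Fin P) × Signal K)) : Prop where
  law_signal : place.map Prod.snd = signalLaw K Dα Dβ Dγ
  distinct : ∀ᵐ z ∂place, Function.Injective z.1

/-- The cluster of the center vector `ck`: some patch of the input is a nonzero multiple of it. -/
def cluster {P d : ℕ} (ck : EuclideanSpace ℝ (Fin d)) : Set (Sample P d) :=
  {z | ∃ p, ∃ b : ℝ, b ≠ 0 ∧ z.1 p = b • ck}

/-! ### The mixture-of-experts layer -/

/-- Weights of one expert: a `J × d` matrix whose norm is the Frobenius norm. -/
abbrev ExpertWeights (J d : ℕ) := EuclideanSpace ℝ (Fin J × Fin d)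

/-- Weights of the `M` experts. -/
abbrev Experts (M J d : ℕ) := Fin M → ExpertWeights J d

/-- Router weights `θ_1, …, θ_M`. -/
abbrev Router (M d : ℕ) := Fin M → EuclideanSpace ℝ (Fin d)

/-- The `j`-th filter of an expert. -/
def filter {J d : ℕ} (w : ExpertWeights J d) (j : Fin J) : EuclideanSpace ℝ (Fin d) :=
  WithLp.toLp 2 fun a => w (j, a)

/-- Output of an expert: a two-layer CNN with cubic activation. -/
def expert {J P d : ℕ} (w : ExpertWeights J d) (x : Input P d) : ℝ :=
  ∑ j, ∑ p, (inner ℝ (filter w j) (x p)) ^ 3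

/-- Output of the gating network. -/
def gate {M P d : ℕ} (Θ : Router M d) (x : Input P d) (m : Fin M) : ℝ :=
  ∑ p, inner ℝ (Θ m) (x p)

/-- Route gate values (softmax of the gating output). -/
def routeValue {M P d : ℕ} (Θ : Router M d) (x : Input P d) (m : Fin M) : ℝ :=
  Real.exp (gate Θ x m) / ∑ m', Real.exp (gate Θ x m')

open Classical in
/-- The set of maximizers of a vector. -/
def argmaxSet {M : ℕ} (h : Fin M → ℝ) : Finset (Fin M) :=
  Finset.univ.filter fun m => ∀ m', h m' ≤ h m

/-! ### Training -/

/-- Logistic loss. -/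
def logistic (z : ℝ) : ℝ := Real.log (1 + Real.exp (-z))

/-- Empirical loss on the training set `S` when example `i` is dispatched to the experts
in `A i`. -/
def loss {M J P d n : ℕ} (S : Fin n → Sample P d) (A : Fin n → Finset (Fin M))
    (Θ : Router M d) (W : Experts M J d) : ℝ :=
  (1 / (n : ℝ)) * ∑ i, logistic
    ((S i).2 * ∑ m ∈ A i, routeValue Θ (S i).1 m * expert (W m) (S i).1)

/-- One round of training with expert learning rate `η`, router learning rate `ηr` and router
noise `r`. Example `i` is dispatched to `argmax_m (h_m(x_i; Θ) + r_{m,i})`; the experts follow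
normalized gradient descent and the router follows gradient descent on the resulting loss. -/
def step {M J P d n : ℕ} (η ηr : ℝ) (S : Fin n → Sample P d) (r : Fin n → Fin M → ℝ)
    (s : Router M d × Experts M J d) : Router M d × Experts M J d :=
  let A : Fin n → Finset (Fin M) := fun i => argmaxSet fun m => gate s.1 (S i).1 m + r i m
  let gW : Experts M J d := fun m =>
    gradient (fun w => loss S A s.1 (Function.update s.2 m w)) (s.2 m)
  let gΘ : Router M d := fun m =>
    gradient (fun θ => loss S A (Function.update s.1 m θ) s.2) (s.1 m)
  (fun m => s.1 m - ηr • gΘ m, fun m => s.2 m - (η / ‖gW m‖) • gW m)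

/-- The iterates of training: zero-initialized router, experts initialized at `W₀`, router
noise `r t` in round `t`. -/
def train {M J P d n : ℕ} (η ηr : ℝ) (S : Fin n → Sample P d) (W₀ : Experts M J d)
    (r : ℕ → Fin n → Fin M → unitInterval) : ℕ → Router M d × Experts M J d
  | 0 => (0, W₀)
  | t + 1 => step η ηr S (fun i m => (r t i m : ℝ)) (train η ηr S W₀ r t)

/-- All the randomness of training: the sample, the initialization and the router noise. -/
abbrev Outcome (M J P d n : ℕ) :=
  (Fin n → Sample P d) × Experts M J d × (ℕ → Fin n → Fin M → unitInterval)

/-- Law of the randomness: `n` i.i.d. examples from `D`, i.i.d. `N(0, σ₀²)` initial expert weights,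
i.i.d. `Unif[0,1]` router noise, all independent. -/
def trainingLaw {P d : ℕ} (M J n : ℕ) (D : Measure (Sample P d)) (σ₀ : ℝ) :
    Measure (Outcome M J P d n) :=
  (Measure.pi fun _ : Fin n => D).prod
    ((Measure.pi fun _ : Fin M => isoGaussian (Fin J × Fin d) σ₀).prod
      (Measure.infinitePi fun _ : ℕ =>
        Measure.pi fun _ : Fin n => Measure.pi fun _ : Fin M =>
          (volume : Measure unitInterval)))

/-- The experts of profession `k`: the maximum over all `(k', j)` of `⟨v_{k'}, w_{m,j}⟩` at
initialization is attained at cluster `k`. -/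
def expertSet {K M J d : ℕ} (v : Fin K → EuclideanSpace ℝ (Fin d)) (W₀ : Experts M J d)
    (k : Fin K) : Set (Fin M) :=
  {m | ∃ j, ∀ k' j', inner ℝ (v k') (filter (W₀ m) j') ≤ inner ℝ (v k) (filter (W₀ m) j)}

/-- Test error of an expert conditioned on a set of examples. -/
def condError {J P d : ℕ} (D : Measure (Sample P d)) (w : ExpertWeights J d)
    (Ω : Set (Sample P d)) : ℝ :=
  (cond D Ω).real {z | z.2 * expert w z.1 ≤ 0}

end MoE

end

/-!
# Specialization of experts in a mixture of experts trained by normalized gradient descent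

Normalized steps have length `η`, so within `T ≈ √σ₀ / η` rounds no expert moves by more than `√σ₀`.
The outputs of the experts are cubic in the weights and hence tiny, the router gradient is tiny as
well, and `Θ` stays so close to zero that routing is decided by the noise alone, up to rare ties
(`norm_router_le`, `abs_routed_sub_le`). In this regime the logistic derivative is about `1 / 2`,
each gate value about `1 / M`, and the gradient of an expert is a quadratic function of its filters,
given by the empirical third-order tensor of the examples. Its expectation is a multiple of
`∑ v_k ⊗ v_k ⊗ v_k`: center patches, feature noise and Gaussian patches cancel by symmetry
(`IsDataModel.integral_triple`). So every expert follows the normalized signal field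
`w ↦ ∑ ⟨w, v_k⟩² v_k`, separately in its filters, up to a relative error (`gradientError`,
`norm_gradient_expert_sub_le`).

The error bound does not involve the trajectory, although the weights depend on the sample. This is
achieved by expanding the displacement of a filter in the standard basis, augmented by the initial
filter itself: the entries of the deviation tensor in this frame have variance of order `1 / n`, and
all of them together enter with weight `σ₀² + ‖Δ‖²` for a displacement `Δ` (`norm_deviation_le`,
`IsDataModel.lintegral_deviationSq_le`). As `n = Ω(d)` and `d σ₀³ ≥ 1`, the expected relative error
is `σ₀^{3/2}` up to logarithms, and Markov's inequality bounds the error accumulated over all rounds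
(`IsDataModel.measure_totalError_le`).

The remaining problem is deterministic: the perturbed iteration `x ↦ x + η x² / ‖x²‖` of the
coordinates `x_{k,j} = ⟨w_j, v_k⟩`. For the flow `x' = x² / ‖x²‖` the difference
`1 / x_i - 1 / x_{i'}` of two coordinates is conserved. Hence a coordinate that starts ahead of all
others by a gap `g` grows linearly, to the order `√σ₀`, while all other coordinates, starting in
`[-L, L]`, remain `O(L² / g)` (`Dynamics.envelope`, `Dynamics.bounds`, `trained_expert`). A Gaussian
initialization has a positive leading coordinate, as `J` is of larger order than `log M`, and a gap
that is only logarithmically smaller than `σ₀` (`measure_not_isGenericInit_le`). Thus an expert in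
the set of cluster `k` ends with one response to `v_k` of order `√σ₀` and all other responses of
order `σ₀`, up to logarithms.

Such an expert takes the sign of the patch that contains `v_k`. In cluster `k` this is the label. In
another cluster, `v_k` is the feature noise with probability `1 / (K - 1)`, and its sign is
independent of the label, so the error probability is at least about `1 / (2 (K - 1))`
(`IsSpecialized.condError_le`, `IsSpecialized.le_condError`).

Logarithmic factors are counted as powers of a single quantity `R = (log d)^(2 a + 3)`, and
`σ₀ ≤ d^{-0.01}` makes `R^200 √σ₀ ≤ 1` for large `d` (`IsRegime`, `IsLarge.isRegime`).
-/

noncomputable section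

namespace MoE

/-! ### Normalized cubic tensor dynamics -/

/-- One step for the upper envelope `max (z + κ) F` of a coordinate `x` that is `κ`-close to `z`.
The floor `F` keeps the envelope positive, also for coordinates that start negative, and dominates
a single step. -/
lemma max_step {z κ F x h η : ℝ} (h0 : 0 ≤ h) (hx : |x - z| ≤ κ) (hF : 2 * κ ≤ F)
    (hη : h * x ^ 2 ≤ η) (hηF : η ≤ F) :
    max (z + h * x ^ 2 + κ) F ≤ max (z + κ) F + h * (max (z + κ) F) ^ 2 := by
  have hk : 0 ≤ κ := (abs_nonneg _).trans hx
  obtain ⟨h1, h2⟩ := abs_le.1 hx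
  have hq1 : z + κ ≤ max (z + κ) F := le_max_left _ _
  have hq2 : F ≤ max (z + κ) F := le_max_right _ _
  set q := max (z + κ) F
  have hsq : 0 ≤ h * q ^ 2 := by positivity
  refine max_le ?_ (by linarith)
  by_cases hz : 0 ≤ z + κ
  · have : x ^ 2 ≤ q ^ 2 := sq_le_sq' (by linarith) (by linarith)
    nlinarith [mul_le_mul_of_nonneg_left this h0]
  · push Not at hz
    linarith

/-- Under a step `q ↦ q + h q²`, `p ↦ p + h p²` with the same `h`, the difference `1 / q - 1 / p`
decreases by at most the second-order term `η² / p³`. -/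
lemma inv_sub_inv_step {p q p' q' h η : ℝ} (hq : 0 < q) (hqp : q ≤ p) (h0 : 0 ≤ h)
    (hη : h ≤ η / p ^ 2) (hq' : 0 < q') (hqs : q' ≤ q + h * q ^ 2) (hps : p + h * p ^ 2 ≤ p') :
    1 / q - 1 / p - η ^ 2 / p ^ 3 ≤ 1 / q' - 1 / p' := by
  have hp : 0 < p := hq.trans_le hqp
  have e1 : 1 / (q + h * q ^ 2) ≤ 1 / q' := one_div_le_one_div_of_le hq' hqs
  have e2 : 1 / p' ≤ 1 / (p + h * p ^ 2) := one_div_le_one_div_of_le (by positivity) hps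
  have e3 : 1 / q - h ≤ 1 / (q + h * q ^ 2) := by
    have : 1 / (q + h * q ^ 2) - (1 / q - h) = h ^ 2 * q / (1 + h * q) := by
      field_simp; ring
    have h2 : 0 ≤ h ^ 2 * q / (1 + h * q) := by positivity
    linarith
  have e4 : 1 / (p + h * p ^ 2) ≤ 1 / p - h + h ^ 2 * p := by
    have : 1 / p - h + h ^ 2 * p - 1 / (p + h * p ^ 2) = h ^ 3 * p ^ 2 / (1 + h * p) := by
      field_simp; ring
    have h2 : 0 ≤ h ^ 3 * p ^ 2 / (1 + h * p) := by positivity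
    linarith
  have e5 : h ^ 2 * p ≤ η ^ 2 / p ^ 3 := by
    have : h ^ 2 ≤ (η / p ^ 2) ^ 2 := pow_le_pow_left₀ h0 hη 2
    calc h ^ 2 * p ≤ (η / p ^ 2) ^ 2 * p := by gcongr
      _ = η ^ 2 / p ^ 3 := by field_simp
  linarith

/-- The second-order terms sum up to `O(η)` when `p` grows at least linearly: the terms are
compared with differences of `1 / (a + c η t)`. -/
lemma sum_div_cube_le {a c η : ℝ} (ha : 0 < a) (hc : 0 < c) (hη : 0 < η) (hca : c * η ≤ a)
    {p : ℕ → ℝ} {T : ℕ} (hp : ∀ t < T, a + c * η * t ≤ p t) :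
    ∑ t ∈ Finset.range T, η ^ 2 / p t ^ 3 ≤ 2 * η / (c * a ^ 2) := by
  have key : ∀ t < T, η ^ 2 / p t ^ 3 ≤
      2 * η / (c * a) * (1 / (a + c * η * t) - 1 / (a + c * η * (t + 1 : ℕ))) := by
    intro t ht
    have hu : a ≤ a + c * η * t := by
      have : 0 ≤ c * η * t := by positivity
      linarith
    have hpt := hp t ht
    set u := a + c * η * t with hu_def
    have hu0 : 0 < u := ha.trans_le hu
    have h2 : a + c * η * (t + 1 : ℕ) = u + c * η := by rw [hu_def]; push_cast; ring
    rw [h2]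
    have h3 : 1 / u - 1 / (u + c * η) = c * η / (u * (u + c * η)) := by field_simp; ring
    rw [h3]
    calc η ^ 2 / p t ^ 3 ≤ η ^ 2 / u ^ 3 := by gcongr
      _ ≤ η ^ 2 / (a * u ^ 2) := by
          apply div_le_div_of_nonneg_left (by positivity) (by positivity)
          nlinarith [sq_nonneg u, mul_le_mul_of_nonneg_right hu (sq_nonneg u)]
      _ = 2 * η / (c * a) * (c * η / (u * (2 * u))) := by field_simp
      _ ≤ 2 * η / (c * a) * (c * η / (u * (u + c * η))) := by
          have : u + c * η ≤ 2 * u := by linarith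
          gcongr
  calc ∑ t ∈ Finset.range T, η ^ 2 / p t ^ 3
      ≤ ∑ t ∈ Finset.range T,
        2 * η / (c * a) * (1 / (a + c * η * t) - 1 / (a + c * η * (t + 1 : ℕ))) :=
        Finset.sum_le_sum fun t ht => key t (Finset.mem_range.1 ht)
    _ = 2 * η / (c * a) * (1 / (a + c * η * (0 : ℕ)) - 1 / (a + c * η * T)) := by
        rw [← Finset.mul_sum, Finset.sum_range_sub' (fun t : ℕ => 1 / (a + c * η * t))]
    _ ≤ 2 * η / (c * a) * (1 / a) := by
        have : 0 ≤ 1 / (a + c * η * T) := by positivity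
        have h4 : 1 / (a + c * η * (0 : ℕ)) = 1 / a := by simp
        rw [h4]
        gcongr
        linarith
    _ = 2 * η / (c * a ^ 2) := by field_simp

/-- Parameters and initial conditions of the perturbed dynamics
`x ↦ x + η (x² / ‖x²‖₂ + e)`: coordinate `i₀` starts at least `g` above zero and above every
other coordinate, and all coordinates start in `[-L, L]`; `κ` is the budget for the accumulated
perturbation. -/
structure Dynamics {I : Type*} [Fintype I] (x e : ℕ → I → ℝ) (η g L κ : ℝ) (i₀ : I) (T : ℕ) :
    Prop where
  step : ∀ t < T, ∀ i, x (t + 1) i = x t i + η * (x t i ^ 2 / √(∑ j, x t j ^ 4) + e t i)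
  eta_pos : 0 < η
  gap_pos : 0 < g
  gap_le : g ≤ L
  start : g ≤ x 0 i₀
  gap : ∀ i, i ≠ i₀ → x 0 i + g ≤ x 0 i₀
  bound : ∀ i, |x 0 i| ≤ L
  budget_le : κ ≤ g / 16
  eta_le : η * (512 * L ^ 4 * Fintype.card I) ≤ g ^ 5

namespace Dynamics

variable {I : Type*} [Fintype I] {x e : ℕ → I → ℝ} {η g L κ : ℝ} {i₀ : I} {T : ℕ}

/-- Lower bound for the growth rate of the leading coordinate. -/
def rate (I : Type*) [Fintype I] (g L : ℝ) : ℝ := g ^ 2 / (16 * L ^ 2 * Fintype.card I)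

lemma card_pos (i₀ : I) : (1 : ℝ) ≤ Fintype.card I := by
  have : Nonempty I := ⟨i₀⟩
  exact_mod_cast Fintype.card_pos

lemma rate_pos (i₀ : I) (hg : 0 < g) (hL : 0 < L) : 0 < rate I g L := by
  have := card_pos i₀
  unfold rate
  positivity

lemma sq_le_norm (y : I → ℝ) (i : I) : y i ^ 2 ≤ √(∑ j, y j ^ 4) := by
  apply Real.le_sqrt_of_sq_le
  calc (y i ^ 2) ^ 2 = y i ^ 4 := by ring
    _ ≤ ∑ j, y j ^ 4 := Finset.single_le_sum (f := fun j => y j ^ 4)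
        (fun j _ => by positivity) (Finset.mem_univ i)

lemma norm_le (y : I → ℝ) {b : ℝ} (hb : ∀ i, |y i| ≤ b) :
    √(∑ j, y j ^ 4) ≤ Fintype.card I * b ^ 2 := by
  apply Real.sqrt_le_iff.2 ⟨by positivity, ?_⟩
  have h1 : ∑ j, y j ^ 4 ≤ ∑ _j : I, b ^ 4 := by
    refine Finset.sum_le_sum fun j _ => ?_
    rw [← Even.pow_abs (by decide : Even 4)]
    exact pow_le_pow_left₀ (abs_nonneg _) (hb j) 4
  rw [Finset.sum_const, Finset.card_univ, nsmul_eq_mul] at h1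
  refine h1.trans ?_
  rcases Nat.eq_zero_or_pos (Fintype.card I) with h | h
  · simp [h]
  · have h2 : (1 : ℝ) ≤ Fintype.card I := by exact_mod_cast h
    have : 0 ≤ b ^ 4 := by positivity
    nlinarith [mul_le_mul_of_nonneg_right h2 (by positivity : 0 ≤ (Fintype.card I : ℝ) * b ^ 4)]

/-- Conclusions for the trajectory up to time `t`, when the accumulated perturbations have
stayed below the budget `κ`. The quantity `1 / q - 1 / p`, for a lower envelope `p` of the leading
coordinate and an upper envelope `q` of another one, is conserved by the unperturbed
continuous-time flow. -/
lemma envelope (D : Dynamics x e η g L κ i₀ T) {z : ℕ → I → ℝ}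
    (hz : ∀ t i, z t i = x t i - ∑ s ∈ Finset.range t, η * e s i)
    {T' : ℕ} (hT' : T' ≤ T)
    (hE : ∀ t ≤ T', ∀ i, |∑ s ∈ Finset.range t, η * e s i| ≤ κ) {t : ℕ} (ht : t ≤ T') :
    g / 2 + rate I g L * η * t ≤ z t i₀ - κ ∧
    (∀ i, z 0 i ≤ z t i) ∧
    ∀ i, i ≠ i₀ → max (z t i + κ) (g / 4) ≤ z t i₀ - κ ∧
      g / (2 * L ^ 2) - ∑ s ∈ Finset.range t, η ^ 2 / (z s i₀ - κ) ^ 3 ≤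
        1 / max (z t i + κ) (g / 4) - 1 / (z t i₀ - κ) := by
  have hκ0 : 0 ≤ κ := (abs_nonneg _).trans (hE 0 (Nat.zero_le _) i₀)
  have hg := D.gap_pos
  have hη := D.eta_pos
  have hκ := D.budget_le
  have hgL := D.gap_le
  have hL : 0 < L := hg.trans_le hgL
  have hI := card_pos i₀
  have hxz : ∀ t ≤ T', ∀ i, |x t i - z t i| ≤ κ := fun t ht i => by
    have := hE t ht i
    rwa [hz, sub_sub_cancel]
  have hz0 : ∀ i, z 0 i = x 0 i := fun i => by simp [hz]
  have hηg : η ≤ g / 4 := by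
    have h1 := D.eta_le
    have h2 : g ^ 4 ≤ L ^ 4 := pow_le_pow_left₀ hg.le hgL 4
    have h3 : η * (512 * g ^ 4 * 1) ≤ g ^ 5 := le_trans (by gcongr) h1
    have h4 : η * 512 ≤ g := by
      have : (η * 512) * g ^ 4 ≤ g * g ^ 4 := by nlinarith
      exact le_of_mul_le_mul_right this (by positivity)
    linarith
  induction t with
  | zero =>
    have hs := D.start
    refine ⟨by rw [hz0]; simp; linarith, fun i => le_rfl, fun i hi => ?_⟩
    have hq : max (z 0 i + κ) (g / 4) ≤ z 0 i₀ - κ - g / 2 := by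
      rw [hz0, hz0]
      have := D.gap i hi
      exact max_le (by linarith) (by linarith)
    have hp : z 0 i₀ - κ ≤ L := by
      rw [hz0]
      have := (abs_le.1 (D.bound i₀)).2
      linarith
    have hF : g / 4 ≤ max (z 0 i + κ) (g / 4) := le_max_right _ _
    set q := max (z 0 i + κ) (g / 4)
    set p := z 0 i₀ - κ
    have hq0 : 0 < q := by linarith
    have hp0 : 0 < p := by linarith
    refine ⟨by linarith, ?_⟩
    simp only [Finset.range_zero, Finset.sum_empty, sub_zero]
    have : 1 / q - 1 / p = (p - q) / (q * p) := by field_simp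
    rw [this, div_le_div_iff₀ (by positivity) (by positivity)]
    have h1 : q * p ≤ L ^ 2 := by nlinarith
    calc g * (q * p) ≤ g * L ^ 2 := by gcongr
      _ ≤ (p - q) * (2 * L ^ 2) := by nlinarith [sq_nonneg L]
  | succ t ih =>
    obtain ⟨ih1, ih2, ih3⟩ := ih (by omega)
    have htT : t < T := by omega
    set N := √(∑ j, x t j ^ 4) with hN
    have hzs : ∀ i, z (t + 1) i = z t i + (η / N) * x t i ^ 2 := fun i => by
      rw [hz, hz, D.step t htT i, Finset.sum_range_succ]
      ring
    have hx := hxz t (by omega)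
    set p := z t i₀ - κ with hp
    have hrate := rate_pos (I := I) i₀ hg hL
    have hp2 : g / 2 ≤ p := by
      have : 0 ≤ rate I g L * η * t := by positivity
      linarith
    have hp0 : 0 < p := by linarith
    have hXp : p ≤ x t i₀ := by
      have := (abs_le.1 (hx i₀)).1
      linarith
    have hX0 : 0 < x t i₀ := by linarith
    have hNX : x t i₀ ^ 2 ≤ N := sq_le_norm _ _
    have hN0 : 0 < N := lt_of_lt_of_le (by positivity) hNX
    have hh0 : 0 ≤ η / N := by positivity
    have hhx : ∀ i, (η / N) * x t i ^ 2 ≤ η := fun i => by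
      rw [div_mul_eq_mul_div, div_le_iff₀ hN0]
      exact mul_le_mul_of_nonneg_left (sq_le_norm _ _) hη.le
    have hNle : N ≤ Fintype.card I * (4 * L / g * x t i₀) ^ 2 := by
      apply norm_le
      have hfac : 1 ≤ 4 * L / g := by rw [le_div_iff₀ hg]; linarith
      have hfacX : x t i₀ ≤ 4 * L / g * x t i₀ := by nlinarith
      have hfac2 : 2 * L ≤ 4 * L / g * x t i₀ := by
        have : 4 * L / g * (g / 2) ≤ 4 * L / g * x t i₀ := by gcongr; linarith
        have h2 : 4 * L / g * (g / 2) = 2 * L := by field_simp; ring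
        linarith
      intro i
      rw [abs_le]
      by_cases hi : i = i₀
      · subst hi; constructor <;> linarith
      · have h1 := (ih3 i hi).1
        have h2 : z t i + κ ≤ max (z t i + κ) (g / 4) := le_max_left _ _
        have h3 := abs_le.1 (hx i)
        have h4 := ih2 i
        rw [hz0] at h4
        have h5 := (abs_le.1 (D.bound i)).1
        constructor <;> linarith
    have hgrow : rate I g L * η ≤ (η / N) * x t i₀ ^ 2 := by
      rw [div_mul_eq_mul_div, le_div_iff₀ hN0]
      calc rate I g L * η * N ≤ rate I g L * η * (Fintype.card I * (4 * L / g * x t i₀) ^ 2) := by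
            gcongr
        _ = η * x t i₀ ^ 2 := by unfold rate; field_simp; ring
    have hps : p + (η / N) * p ^ 2 ≤ z (t + 1) i₀ - κ := by
      rw [hzs]
      have : (η / N) * p ^ 2 ≤ (η / N) * x t i₀ ^ 2 := by gcongr
      linarith
    refine ⟨?_, fun i => ?_, fun i hi => ?_⟩
    · rw [hzs]; push_cast; linarith
    · rw [hzs]
      have := ih2 i
      have h2 : 0 ≤ (η / N) * x t i ^ 2 := by positivity
      linarith
    · obtain ⟨hqp, hD⟩ := ih3 i hi
      have hq' : max (z (t + 1) i + κ) (g / 4) ≤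
          max (z t i + κ) (g / 4) + (η / N) * max (z t i + κ) (g / 4) ^ 2 := by
        rw [hzs]
        exact max_step hh0 (hx i) (by linarith) (hhx i) hηg
      have hq0 : 0 < max (z t i + κ) (g / 4) := lt_of_lt_of_le (by linarith) (le_max_right _ _)
      have hq0' : 0 < max (z (t + 1) i + κ) (g / 4) :=
        lt_of_lt_of_le (by linarith) (le_max_right _ _)
      set q := max (z t i + κ) (g / 4)
      set q' := max (z (t + 1) i + κ) (g / 4)
      refine ⟨?_, ?_⟩
      · have : (η / N) * q ^ 2 ≤ (η / N) * p ^ 2 := by gcongr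
        linarith
      · have hη2 : η / N ≤ η / p ^ 2 := by
          apply div_le_div_of_nonneg_left hη.le (by positivity)
          exact le_trans (by gcongr) hNX
        have := inv_sub_inv_step hq0 hqp hh0 hη2 hq0' hq' hps
        rw [Finset.sum_range_succ]
        linarith

/-- Bounds along the trajectory while the accumulated perturbations stay below the budget. -/
lemma bounds_of_budget (D : Dynamics x e η g L κ i₀ T) {T' : ℕ} (hT' : T' ≤ T)
    (hE : ∀ t ≤ T', ∀ i, |∑ s ∈ Finset.range t, η * e s i| ≤ κ) {t : ℕ} (ht : t ≤ T') :
    g / 2 + rate I g L * η * t ≤ x t i₀ ∧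
    ∀ i, i ≠ i₀ → |x t i| ≤ 4 * L ^ 2 / g := by
  have hκ0 : 0 ≤ κ := (abs_nonneg _).trans (hE 0 (Nat.zero_le _) i₀)
  have hg := D.gap_pos
  have hη := D.eta_pos
  have hκ := D.budget_le
  have hgL := D.gap_le
  have hL : 0 < L := hg.trans_le hgL
  have hI := card_pos i₀
  have hrate := rate_pos (I := I) i₀ hg hL
  set z : ℕ → I → ℝ := fun t i => x t i - ∑ s ∈ Finset.range t, η * e s i with hz
  obtain ⟨h1, h2, h3⟩ := D.envelope (z := z) (fun _ _ => rfl) hT' hE ht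
  have hxz : ∀ i, |x t i - z t i| ≤ κ := fun i => by
    have := hE t ht i
    simpa [hz] using this
  refine ⟨by have := abs_le.1 (hxz i₀); linarith, fun i hi => ?_⟩
  obtain ⟨-, h4⟩ := h3 i hi
  have hsum : ∑ s ∈ Finset.range t, η ^ 2 / (z s i₀ - κ) ^ 3 ≤
      2 * η / (rate I g L * (g / 2) ^ 2) := by
    apply sum_div_cube_le (by linarith) hrate hη
    · have h5 := D.eta_le
      have : rate I g L * η * (16 * L ^ 2 * Fintype.card I) = g ^ 2 * η := by
        unfold rate; field_simp
      have h6 : η * 512 ≤ g := by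
        have h2 : g ^ 4 ≤ L ^ 4 := pow_le_pow_left₀ hg.le hgL 4
        have h3 : η * (512 * g ^ 4 * 1) ≤ g ^ 5 := le_trans (by gcongr) h5
        have : (η * 512) * g ^ 4 ≤ g * g ^ 4 := by nlinarith
        exact le_of_mul_le_mul_right this (by positivity)
      have h7 : rate I g L ≤ 1 := by
        unfold rate
        rw [div_le_one (by positivity)]
        have : g ^ 2 ≤ L ^ 2 := pow_le_pow_left₀ hg.le hgL 2
        nlinarith [mul_le_mul_of_nonneg_left hI (sq_nonneg L)]
      nlinarith
    · intro s hs
      exact (D.envelope (z := z) (fun _ _ => rfl) hT' hE (by omega : s ≤ T')).1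
  have hsum2 : 2 * η / (rate I g L * (g / 2) ^ 2) ≤ g / (4 * L ^ 2) := by
    have : 2 * η / (rate I g L * (g / 2) ^ 2) = η * (128 * L ^ 2 * Fintype.card I) / g ^ 4 := by
      unfold rate; field_simp; norm_num
    rw [this, div_le_div_iff₀ (by positivity) (by positivity)]
    have h5 := D.eta_le
    have h0 : 0 ≤ η * L ^ 4 * Fintype.card I := by positivity
    nlinarith
  have hp0 : 0 < z t i₀ - κ := by
    have : 0 ≤ rate I g L * η * t := by positivity
    linarith
  have h5 : g / (4 * L ^ 2) ≤ 1 / max (z t i + κ) (g / 4) := by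
    have : 0 < 1 / (z t i₀ - κ) := by positivity
    have h6 : g / (2 * L ^ 2) = g / (4 * L ^ 2) + g / (4 * L ^ 2) := by field_simp; norm_num
    linarith
  have hq0 : 0 < max (z t i + κ) (g / 4) := lt_of_lt_of_le (by linarith) (le_max_right _ _)
  have h6 : max (z t i + κ) (g / 4) ≤ 4 * L ^ 2 / g := by
    rw [le_div_iff₀ hg]
    rw [div_le_div_iff₀ (by positivity) hq0] at h5
    linarith
  have h7 := abs_le.1 (hxz i)
  have h8 : z t i + κ ≤ max (z t i + κ) (g / 4) := le_max_left _ _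
  have h9 := h2 i
  have h10 := (abs_le.1 (D.bound i)).1
  have h11 : z 0 i = x 0 i := by simp [hz]
  have h12 : 2 * L ≤ 4 * L ^ 2 / g := by
    rw [le_div_iff₀ hg]; nlinarith
  rw [abs_le]
  constructor <;> linarith

/-- The bounds for the perturbed dynamics when the perturbation is at most `Q b_t (s₀ + η t)²`
relative to the norm `‖x²‖₂`. As long as the leading coordinate grows at a linear rate, this norm
is at least of the order of `(s₀ + η t)²`, so the accumulated perturbation is controlled by
`∑ η b_t` and stays within the budget, which in turn keeps the leading coordinate growing. -/
theorem bounds (D : Dynamics x e η g L κ i₀ T) {Q B s₀ : ℝ} {b : ℕ → ℝ} (hb : ∀ t, 0 ≤ b t)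
    (hs₀ : 0 < s₀) (hQ : 0 ≤ Q)
    (he : ∀ t < T, ∀ i, 0 < √(∑ j, x t j ^ 4) →
      |e t i| ≤ Q * (b t * (s₀ + η * t) ^ 2) / √(∑ j, x t j ^ 4))
    (hB : ∑ t ∈ Finset.range T, η * b t ≤ B)
    {c : ℝ} (hc : 0 < c) (hcg : c * s₀ ≤ g / 2) (hcr : c ≤ rate I g L)
    (hκ : Q * B / c ^ 2 ≤ κ) {t : ℕ} (ht : t ≤ T) :
    g / 2 + rate I g L * η * t ≤ x t i₀ ∧
    (∀ i, i ≠ i₀ → |x t i| ≤ 4 * L ^ 2 / g) ∧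
    ∑ s ∈ Finset.range t, η * (Q * (b s * (s₀ + η * s) ^ 2) / √(∑ j, x s j ^ 4)) ≤ κ := by
  have hη := D.eta_pos
  have hbig : ∀ s : ℕ, c * (s₀ + η * s) ≤ g / 2 + rate I g L * η * s := fun s => by
    have h1 : c * (η * s) ≤ rate I g L * (η * s) := by gcongr
    linarith
  have hN : ∀ s : ℕ, g / 2 + rate I g L * η * s ≤ x s i₀ →
      (c * (s₀ + η * s)) ^ 2 ≤ √(∑ j, x s j ^ 4) := fun s hs => by
    refine le_trans ?_ (sq_le_norm (x s) i₀)
    have : 0 ≤ c * (s₀ + η * s) := by positivity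
    exact pow_le_pow_left₀ this ((hbig s).trans hs) 2
  have herr : ∀ s : ℕ, g / 2 + rate I g L * η * s ≤ x s i₀ →
      Q * (b s * (s₀ + η * s) ^ 2) / √(∑ j, x s j ^ 4) ≤ Q * b s / c ^ 2 := fun s hs => by
    have h0 : 0 < s₀ + η * s := by positivity
    calc Q * (b s * (s₀ + η * s) ^ 2) / √(∑ j, x s j ^ 4)
        ≤ Q * (b s * (s₀ + η * s) ^ 2) / (c * (s₀ + η * s)) ^ 2 := by
          have := hb s
          exact div_le_div_of_nonneg_left (by positivity) (by positivity) (hN s hs)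
      _ = Q * b s / c ^ 2 := by field_simp
  have hsumle : ∀ t ≤ T, (∀ s < t, g / 2 + rate I g L * η * s ≤ x s i₀) →
      ∑ s ∈ Finset.range t, η * (Q * (b s * (s₀ + η * s) ^ 2) / √(∑ j, x s j ^ 4)) ≤ κ := by
    intro t ht hx
    calc _ ≤ ∑ s ∈ Finset.range t, Q / c ^ 2 * (η * b s) := by
          refine Finset.sum_le_sum fun s hs => ?_
          calc η * (Q * (b s * (s₀ + η * s) ^ 2) / √(∑ j, x s j ^ 4))
              ≤ η * (Q * b s / c ^ 2) :=
                mul_le_mul_of_nonneg_left (herr s (hx s (Finset.mem_range.1 hs))) hη.le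
            _ = Q / c ^ 2 * (η * b s) := by ring
      _ ≤ ∑ s ∈ Finset.range T, Q / c ^ 2 * (η * b s) := by
          refine Finset.sum_le_sum_of_subset_of_nonneg (by simpa using ht) fun s _ _ => ?_
          have := hb s
          positivity
      _ = Q / c ^ 2 * ∑ s ∈ Finset.range T, η * b s := by rw [Finset.mul_sum]
      _ ≤ Q / c ^ 2 * B := by gcongr
      _ = Q * B / c ^ 2 := by ring
      _ ≤ κ := hκ
  -- continuity argument: the budget up to time `t` only involves the growth before time `t`
  have hall : ∀ t ≤ T, (∀ i, |∑ s ∈ Finset.range t, η * e s i| ≤ κ) ∧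
      g / 2 + rate I g L * η * t ≤ x t i₀ := by
    intro t
    induction t using Nat.strong_induction_on with
    | _ t ih =>
      intro ht
      have hx : ∀ s < t, g / 2 + rate I g L * η * s ≤ x s i₀ :=
        fun s hs => (ih s hs (by omega)).2
      have h1 : ∀ i, |∑ s ∈ Finset.range t, η * e s i| ≤ κ := fun i => by
        refine (Finset.abs_sum_le_sum_abs _ _).trans (le_trans ?_ (hsumle t ht hx))
        refine Finset.sum_le_sum fun s hs => ?_
        have hs' := Finset.mem_range.1 hs
        rw [abs_mul, abs_of_pos hη]
        have h0 : 0 < s₀ + η * s := by positivity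
        have := he s (by omega) i (lt_of_lt_of_le (by positivity) (hN s (hx s hs')))
        gcongr
      refine ⟨h1, (D.bounds_of_budget ht (fun s hs i => ?_) le_rfl).1⟩
      rcases hs.lt_or_eq with h | h
      · exact (ih s h (by omega)).1 i
      · subst h; exact h1 i
  have h2 := D.bounds_of_budget ht (fun s hs => (hall s (hs.trans ht)).1) le_rfl
  exact ⟨h2.1, h2.2, hsumle t ht fun s hs => (hall s (by omega)).2⟩

end Dynamics

/-! ### Gradients of the empirical loss -/

/-- Reading off the `j`-th filter, as a linear map. -/
def filterₗ {J d : ℕ} (j : Fin J) : ExpertWeights J d →ₗ[ℝ] EuclideanSpace ℝ (Fin d) where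
  toFun w := filter w j
  map_add' _ _ := rfl
  map_smul' _ _ := rfl

/-- The expert whose `j`-th filter is the given vector and whose other filters vanish. -/
def embed {J d : ℕ} (j : Fin J) : EuclideanSpace ℝ (Fin d) →ₗ[ℝ] ExpertWeights J d where
  toFun x := WithLp.toLp 2 fun p => if p.1 = j then x p.2 else 0
  map_add' x y := by
    ext p
    by_cases h : p.1 = j <;> simp [h]
  map_smul' a x := by
    ext p
    by_cases h : p.1 = j <;> simp [h]

section Filter

variable {J d : ℕ}

lemma filter_eq (w : ExpertWeights J d) (j : Fin J) : filter w j = filterₗ j w := rfl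

lemma filter_sub (w w' : ExpertWeights J d) (j : Fin J) :
    filter (w - w') j = filter w j - filter w' j := rfl

lemma inner_filter (w : ExpertWeights J d) (j : Fin J) (x : EuclideanSpace ℝ (Fin d)) :
    inner ℝ (filter w j) x = inner ℝ w (embed j x) := by
  simp only [PiLp.inner_apply, filter, embed, LinearMap.coe_mk, AddHom.coe_mk,
    Fintype.sum_prod_type]
  rw [Finset.sum_comm]
  simp [apply_ite]

lemma filter_embed (j j' : Fin J) (x : EuclideanSpace ℝ (Fin d)) :
    filter (embed j x) j' = if j' = j then x else 0 := by
  ext a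
  by_cases h : j' = j <;> simp [filter, embed, h]

lemma inner_embed_embed (j j' : Fin J) (x y : EuclideanSpace ℝ (Fin d)) :
    inner ℝ (embed j x) (embed j' y) = if j = j' then inner ℝ x y else 0 := by
  rw [← inner_filter, filter_embed]
  by_cases h : j = j'
  · simp [h]
  · simp [h, Ne.symm h]

lemma norm_embed (j : Fin J) (x : EuclideanSpace ℝ (Fin d)) : ‖embed j x‖ = ‖x‖ := by
  have h := inner_embed_embed j j x x
  simp only [if_true, real_inner_self_eq_norm_sq] at h
  exact (sq_eq_sq₀ (norm_nonneg _) (norm_nonneg _)).1 h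

lemma sum_norm_filter_sq (w : ExpertWeights J d) : ∑ j, ‖filter w j‖ ^ 2 = ‖w‖ ^ 2 := by
  simp only [EuclideanSpace.real_norm_sq_eq, filter, Fintype.sum_prod_type]

lemma norm_filter_le (w : ExpertWeights J d) (j : Fin J) : ‖filter w j‖ ≤ ‖w‖ := by
  refine (sq_le_sq₀ (norm_nonneg _) (norm_nonneg _)).1 ?_
  rw [← sum_norm_filter_sq w]
  exact Finset.single_le_sum (f := fun j => ‖filter w j‖ ^ 2) (fun _ _ => by positivity)
    (Finset.mem_univ j)

end Filter

/-- Contribution of one example to the ascent direction of a filter, up to a scalar factor. -/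
def sampleField {P d : ℕ} (z : Sample P d) (w : EuclideanSpace ℝ (Fin d)) :
    EuclideanSpace ℝ (Fin d) :=
  z.2 • ∑ p, (inner ℝ w (z.1 p)) ^ 2 • z.1 p

/-- The same contribution for all filters of an expert. -/
def expertField {J P d : ℕ} (z : Sample P d) (w : ExpertWeights J d) : ExpertWeights J d :=
  ∑ j, embed j (sampleField z (filter w j))

/-- The negative derivative of the logistic loss. -/
def sig (z : ℝ) : ℝ := 1 / (1 + Real.exp z)

lemma hasDerivAt_logistic (z : ℝ) : HasDerivAt logistic (-sig z) z := by
  unfold logistic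
  have h1 : HasDerivAt (fun z : ℝ => 1 + Real.exp (-z)) (-Real.exp (-z)) z := by
    have := ((Real.hasDerivAt_exp (-z)).comp z (hasDerivAt_neg z)).const_add 1
    simpa using this
  have h2 := h1.log (by positivity)
  convert h2 using 1
  unfold sig
  rw [Real.exp_neg]
  field_simp
  ring

lemma sig_nonneg (z : ℝ) : 0 ≤ sig z := by unfold sig; positivity

lemma sig_le_one (z : ℝ) : sig z ≤ 1 := by
  unfold sig
  rw [div_le_one (by positivity)]
  linarith [Real.exp_pos z]

lemma hasDerivAt_sig (z : ℝ) : HasDerivAt sig (-(Real.exp z) / (1 + Real.exp z) ^ 2) z := by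
  unfold sig
  have h1 : HasDerivAt (fun z : ℝ => 1 + Real.exp z) (Real.exp z) z :=
    (Real.hasDerivAt_exp z).const_add 1
  simpa using h1.fun_inv (by positivity)

lemma abs_sig_sub_half_le (z : ℝ) : |sig z - 1 / 2| ≤ |z| := by
  have h := Convex.norm_image_sub_le_of_norm_hasDerivWithin_le (f := sig) (C := 1) (x := 0) (y := z)
    (fun x _ => (hasDerivAt_sig x).hasDerivWithinAt) (fun x _ => ?_) convex_univ
    (Set.mem_univ _) (Set.mem_univ _)
  · have h0 : sig 0 = 1 / 2 := by norm_num [sig]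
    simpa [h0] using h
  · rw [Real.norm_eq_abs, abs_div, abs_neg, abs_of_pos (Real.exp_pos x),
      abs_of_pos (by positivity), div_le_one (by positivity)]
    nlinarith [Real.exp_pos x]

lemma logistic_lipschitz (z z' : ℝ) : |logistic z - logistic z'| ≤ |z - z'| := by
  have h := Convex.norm_image_sub_le_of_norm_hasDerivWithin_le (f := logistic) (C := 1)
    (x := z') (y := z)
    (fun x _ => (hasDerivAt_logistic x).hasDerivWithinAt) (fun x _ => ?_) convex_univ
    (Set.mem_univ _) (Set.mem_univ _)
  · simpa using h
  · rw [norm_neg, Real.norm_eq_abs, abs_of_nonneg (sig_nonneg x)]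
    exact sig_le_one x

section Gradient

variable {M J P d n : ℕ}

lemma hasGradientAt_expert (w : ExpertWeights J d) (x : Input P d) (y : ℝ) :
    HasGradientAt (fun w => y * expert w x) ((3 : ℝ) • expertField (x, y) w) w := by
  have h1 : ∀ j p, HasFDerivAt (fun w : ExpertWeights J d => (inner ℝ (filter w j) (x p)) ^ 3)
      ((3 * (inner ℝ (filter w j) (x p)) ^ 2) • innerSL ℝ (embed j (x p))) w := fun j p => by
    have h2 : HasFDerivAt (fun w : ExpertWeights J d => inner ℝ (filter w j) (x p))
        (innerSL ℝ (embed j (x p))) w := by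
      have h3 : (fun w : ExpertWeights J d => inner ℝ (filter w j) (x p)) =
          innerSL ℝ (embed j (x p)) := by
        ext w; rw [inner_filter, real_inner_comm]; rfl
      rw [h3]; exact (innerSL ℝ (embed j (x p))).hasFDerivAt
    simpa using h2.pow 3
  have h2 := (HasFDerivAt.fun_sum (u := Finset.univ) fun j _ =>
    HasFDerivAt.fun_sum (u := Finset.univ) fun p _ => h1 j p).const_mul y
  rw [hasGradientAt_iff_hasFDerivAt]
  refine h2.congr_fderiv ?_
  ext v
  simp only [expertField, sampleField, map_smul, map_sum, Finset.smul_sum,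
    InnerProductSpace.toDual_apply_apply, smul_apply, sum_apply, smul_eq_mul,
    innerSL_apply_apply]
  refine Finset.sum_congr rfl fun j _ => Finset.sum_congr rfl fun p _ => by ring

open Classical in
/-- The expert gradient of the loss, with its explicit value. -/
lemma gradient_loss_expert (S : Fin n → Sample P d) (A : Fin n → Finset (Fin M))
    (Θ : Router M d) (W : Experts M J d) (m : Fin M) :
    gradient (fun w => loss S A Θ (Function.update W m w)) (W m) =
      -((3 / (n : ℝ)) • ∑ i, (if m ∈ A i then
        sig ((S i).2 * ∑ m' ∈ A i, routeValue Θ (S i).1 m' * expert (W m') (S i).1) *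
          routeValue Θ (S i).1 m else 0) • expertField (S i) (W m)) := by
  apply HasGradientAt.gradient
  have h1 : ∀ i, HasGradientAt (fun w => (S i).2 * ∑ m' ∈ A i, routeValue Θ (S i).1 m' *
      expert (Function.update W m w m') (S i).1)
      ((if m ∈ A i then routeValue Θ (S i).1 m else 0) • ((3 : ℝ) • expertField (S i) (W m)))
      (W m) := fun i => by
    by_cases hm : m ∈ A i
    · have h2 : (fun w => (S i).2 * ∑ m' ∈ A i, routeValue Θ (S i).1 m' *
          expert (Function.update W m w m') (S i).1) = fun w =>
          routeValue Θ (S i).1 m * ((S i).2 * expert w (S i).1) +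
          (S i).2 * ∑ m' ∈ (A i).erase m, routeValue Θ (S i).1 m' * expert (W m') (S i).1 := by
        ext w
        rw [← Finset.add_sum_erase _ _ hm, Function.update_self, mul_add]
        congr 1
        · ring
        · congr 1
          refine Finset.sum_congr rfl fun m' hm' => ?_
          rw [Function.update_of_ne (Finset.ne_of_mem_erase hm')]
      rw [h2, if_pos hm, hasGradientAt_iff_hasFDerivAt]
      have h3 := (hasGradientAt_iff_hasFDerivAt.1
        (hasGradientAt_expert (W m) (S i).1 (S i).2)).const_mul (routeValue Θ (S i).1 m)
      rw [map_smul]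
      exact h3.add_const _
    · have h2 : (fun w => (S i).2 * ∑ m' ∈ A i, routeValue Θ (S i).1 m' *
          expert (Function.update W m w m') (S i).1) = fun _ =>
          (S i).2 * ∑ m' ∈ A i, routeValue Θ (S i).1 m' * expert (W m') (S i).1 := by
        ext w
        congr 1
        refine Finset.sum_congr rfl fun m' hm' => ?_
        rw [Function.update_of_ne (fun h : m' = m => hm (h ▸ hm'))]
      rw [h2, if_neg hm, zero_smul, hasGradientAt_iff_hasFDerivAt, map_zero]
      exact hasFDerivAt_const _ _
  have h2 : ∀ i, HasFDerivAt (fun w => logistic ((S i).2 * ∑ m' ∈ A i, routeValue Θ (S i).1 m' *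
      expert (Function.update W m w m') (S i).1)) _ (W m) := fun i =>
    (hasDerivAt_logistic _).comp_hasFDerivAt (W m) (hasGradientAt_iff_hasFDerivAt.1 (h1 i))
  have h3 := (HasFDerivAt.fun_sum (u := Finset.univ) fun i _ => h2 i).const_mul (1 / (n : ℝ))
  rw [hasGradientAt_iff_hasFDerivAt]
  refine h3.congr_fderiv ?_
  simp only [Function.update_eq_self, Finset.smul_sum, map_neg, map_smul, map_sum]
  rw [← Finset.sum_neg_distrib]
  refine Finset.sum_congr rfl fun i _ => ?_
  by_cases hm : m ∈ A i
  · simp only [hm, if_true, smul_smul, ← neg_smul]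
    congr 1
    ring
  · simp [hm]

lemma routeValue_nonneg (Θ : Router M d) (x : Input P d) (m : Fin M) : 0 ≤ routeValue Θ x m := by
  unfold routeValue; positivity

lemma routeValue_le_one (Θ : Router M d) (x : Input P d) (m : Fin M) : routeValue Θ x m ≤ 1 := by
  unfold routeValue
  refine div_le_one_of_le₀ ?_ (by positivity)
  exact Finset.single_le_sum (f := fun m' => Real.exp (gate Θ x m')) (fun _ _ => by positivity)
    (Finset.mem_univ m)

/-- Route gate values are close to uniform when the gate is small. -/
lemma abs_routeValue_sub_le (Θ : Router M d) (x : Input P d) (m : Fin M) {H : ℝ}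
    (hH : ∀ m', |gate Θ x m'| ≤ H) : |routeValue Θ x m - 1 / M| ≤ 4 * H := by
  have hH0 : 0 ≤ H := (abs_nonneg _).trans (hH m)
  have hM : (1 : ℝ) ≤ M := by
    have : 0 < M := m.pos
    exact_mod_cast this
  have hM1 : 1 / (M : ℝ) ≤ 1 := by rw [div_le_one (by positivity)]; exact hM
  have hMp : 0 < 1 / (M : ℝ) := by positivity
  have h0 := routeValue_nonneg Θ x m
  have h1 := routeValue_le_one Θ x m
  by_cases hH4 : 1 / 4 ≤ H
  · rw [abs_le]; constructor <;> linarith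
  · push Not at hH4
    have hS1 : (M : ℝ) * Real.exp (-H) ≤ ∑ m', Real.exp (gate Θ x m') := by
      have : ∑ _m' : Fin M, Real.exp (-H) ≤ ∑ m', Real.exp (gate Θ x m') :=
        Finset.sum_le_sum fun m' _ => Real.exp_le_exp.2 (abs_le.1 (hH m')).1
      simpa using this
    have hS2 : ∑ m', Real.exp (gate Θ x m') ≤ (M : ℝ) * Real.exp H := by
      have : ∑ m', Real.exp (gate Θ x m') ≤ ∑ _m' : Fin M, Real.exp H :=
        Finset.sum_le_sum fun m' _ => Real.exp_le_exp.2 (abs_le.1 (hH m')).2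
      simpa using this
    have hS0 : 0 < ∑ m', Real.exp (gate Θ x m') := lt_of_lt_of_le (by positivity) hS1
    have hm := abs_le.1 (hH m)
    have hup : routeValue Θ x m ≤ 1 / M * Real.exp (2 * H) := by
      unfold routeValue
      calc _ ≤ Real.exp H / (M * Real.exp (-H)) :=
            div_le_div₀ (by positivity) (Real.exp_le_exp.2 hm.2) (by positivity) hS1
        _ = 1 / M * Real.exp (2 * H) := by
            rw [show 2 * H = H + H by ring, Real.exp_add, Real.exp_neg]; field_simp
    have hlo : 1 / M * Real.exp (-(2 * H)) ≤ routeValue Θ x m := by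
      unfold routeValue
      calc _ = Real.exp (-H) / (M * Real.exp H) := by
            rw [show -(2 * H) = -H + -H by ring, Real.exp_add, Real.exp_neg]; field_simp
        _ ≤ _ := div_le_div₀ (by positivity) (Real.exp_le_exp.2 hm.1) hS0 hS2
    have he1 : Real.exp (2 * H) ≤ 1 + 4 * H := by
      have := Real.abs_exp_sub_one_sub_id_le (x := 2 * H) (by rw [abs_of_nonneg] <;> linarith)
      have := (abs_le.1 this).2
      nlinarith
    have he2 : 1 - 2 * H ≤ Real.exp (-(2 * H)) := by
      have := Real.add_one_le_exp (-(2 * H)); linarith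
    have h3 : 1 / (M : ℝ) * (4 * H) ≤ 1 * (4 * H) := by gcongr
    have h4 : 1 / (M : ℝ) * Real.exp (2 * H) ≤ 1 / M * (1 + 4 * H) := by gcongr
    have h5 : 1 / (M : ℝ) * (1 - 2 * H) ≤ 1 / M * Real.exp (-(2 * H)) := by gcongr
    rw [abs_le]
    constructor <;> nlinarith

lemma abs_exp_div_sub_le {B : ℝ} (hB : 0 ≤ B) (u u' : ℝ) :
    |Real.exp u / (Real.exp u + B) - Real.exp u' / (Real.exp u' + B)| ≤ |u - u'| := by
  have h := Convex.norm_image_sub_le_of_norm_hasDerivWithin_le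
    (f := fun u => Real.exp u / (Real.exp u + B)) (C := 1) (x := u') (y := u)
    (f' := fun u => Real.exp u * B / (Real.exp u + B) ^ 2)
    (fun x _ => HasDerivAt.hasDerivWithinAt ?_) (fun x _ => ?_) convex_univ
    (Set.mem_univ _) (Set.mem_univ _)
  · simpa using h
  · have := (Real.hasDerivAt_exp x).fun_div ((Real.hasDerivAt_exp x).add_const B) (by positivity)
    exact this.congr_deriv (by ring)
  · rw [Real.norm_eq_abs, abs_of_nonneg (by positivity), div_le_one (by positivity)]
    nlinarith [Real.exp_pos x, sq_nonneg B, sq_nonneg (Real.exp x),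
      mul_nonneg (Real.exp_pos x).le hB]

lemma abs_div_exp_sub_le {B c : ℝ} (hc : 0 ≤ c) (hcB : c ≤ B) (u u' : ℝ) :
    |c / (Real.exp u + B) - c / (Real.exp u' + B)| ≤ |u - u'| := by
  have hB := hc.trans hcB
  have h := Convex.norm_image_sub_le_of_norm_hasDerivWithin_le
    (f := fun u => c / (Real.exp u + B)) (C := 1) (x := u') (y := u)
    (f' := fun u => -(c * Real.exp u) / (Real.exp u + B) ^ 2)
    (fun x _ => HasDerivAt.hasDerivWithinAt ?_) (fun x _ => ?_) convex_univ
    (Set.mem_univ _) (Set.mem_univ _)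
  · simpa using h
  · have := (hasDerivAt_const x c).fun_div ((Real.hasDerivAt_exp x).add_const B) (by positivity)
    exact this.congr_deriv (by ring)
  · rw [Real.norm_eq_abs, abs_div, abs_neg, abs_of_nonneg (by positivity),
      abs_of_nonneg (by positivity), div_le_one (by positivity)]
    nlinarith [Real.exp_pos x, sq_nonneg B, sq_nonneg (Real.exp x),
      mul_nonneg (Real.exp_pos x).le hB, mul_le_mul_of_nonneg_right hcB (Real.exp_pos x).le]

lemma abs_routeValue_update_sub_le (Θ : Router M d) (x : Input P d) (m m' : Fin M)
    (θ θ' : EuclideanSpace ℝ (Fin d)) :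
    |routeValue (Function.update Θ m θ) x m' - routeValue (Function.update Θ m θ') x m'| ≤
      (∑ p, ‖x p‖) * ‖θ - θ'‖ := by
  set B := ∑ m' ∈ Finset.univ.erase m, Real.exp (gate Θ x m') with hB
  have hB0 : 0 ≤ B := by positivity
  have hg : ∀ θ, ∀ k ≠ m, gate (Function.update Θ m θ) x k = gate Θ x k := fun θ k hk => by
    simp [gate, Function.update_of_ne hk]
  have hgm : ∀ θ, gate (Function.update Θ m θ) x m = ∑ p, inner ℝ θ (x p) := fun θ => by
    simp [gate]
  have hsum : ∀ θ, ∑ k, Real.exp (gate (Function.update Θ m θ) x k) =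
      Real.exp (∑ p, inner ℝ θ (x p)) + B := fun θ => by
    rw [← Finset.add_sum_erase _ _ (Finset.mem_univ m), hgm]
    congr 1
    exact Finset.sum_congr rfl fun k hk => by rw [hg θ k (Finset.ne_of_mem_erase hk)]
  have hu : |∑ p, inner ℝ θ (x p) - ∑ p, inner ℝ θ' (x p)| ≤ (∑ p, ‖x p‖) * ‖θ - θ'‖ := by
    rw [← Finset.sum_sub_distrib, Finset.sum_mul]
    refine (Finset.abs_sum_le_sum_abs _ _).trans (Finset.sum_le_sum fun p _ => ?_)
    rw [← inner_sub_left, mul_comm]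
    exact abs_real_inner_le_norm _ _
  refine le_trans ?_ hu
  unfold routeValue
  rw [hsum, hsum]
  by_cases hm : m' = m
  · subst hm
    rw [hgm, hgm]
    exact abs_exp_div_sub_le hB0 _ _
  · rw [hg _ _ hm, hg _ _ hm]
    refine abs_div_exp_sub_le (by positivity) ?_ _ _
    exact Finset.single_le_sum (f := fun m' => Real.exp (gate Θ x m')) (fun _ _ => by positivity)
      (Finset.mem_erase.2 ⟨hm, Finset.mem_univ _⟩)

/-- The router gradient is bounded by the Lipschitz constant of the loss. -/
lemma norm_gradient_router_le (S : Fin n → Sample P d) (hS : ∀ i, |(S i).2| ≤ 1)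
    (A : Fin n → Finset (Fin M)) (Θ : Router M d) (W : Experts M J d) (m : Fin M) :
    ‖gradient (fun θ => loss S A (Function.update Θ m θ) W) (Θ m)‖ ≤
      (1 / (n : ℝ)) * ∑ i, (∑ m', |expert (W m') (S i).1|) * ∑ p, ‖(S i).1 p‖ := by
  unfold gradient
  rw [LinearIsometryEquiv.norm_map]
  refine norm_fderiv_le_of_lip' ℝ (by positivity) (Filter.Eventually.of_forall fun θ => ?_)
  unfold loss
  rw [← mul_sub, ← Finset.sum_sub_distrib, norm_mul, Real.norm_of_nonneg (by positivity), mul_assoc,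
    Finset.sum_mul]
  gcongr
  refine (norm_sum_le _ _).trans (Finset.sum_le_sum fun i _ => ?_)
  refine (logistic_lipschitz _ _).trans ?_
  rw [← mul_sub, abs_mul, ← Finset.sum_sub_distrib]
  calc |(S i).2| * _ ≤ 1 * _ := by gcongr; exact hS i
    _ ≤ ∑ m' ∈ A i, |expert (W m') (S i).1| * ((∑ p, ‖(S i).1 p‖) * ‖θ - Θ m‖) := by
        rw [one_mul]
        refine (Finset.abs_sum_le_sum_abs _ _).trans (Finset.sum_le_sum fun m' _ => ?_)
        rw [← sub_mul, abs_mul, mul_comm]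
        gcongr
        exact abs_routeValue_update_sub_le Θ (S i).1 m m' θ (Θ m)
    _ ≤ ∑ m', |expert (W m') (S i).1| * ((∑ p, ‖(S i).1 p‖) * ‖θ - Θ m‖) :=
        Finset.sum_le_sum_of_subset_of_nonneg (Finset.subset_univ _) fun _ _ _ => by positivity
    _ = _ := by rw [← Finset.sum_mul, mul_assoc]

end Gradient

/-! ### Comparison of the expert gradient with the population signal -/

section Comparison

variable {K M J P d n : ℕ}

/-- Size of an input relative to the initialization: every patch norm, and every response
of an initial filter in units of the initialization scale, is bounded by it. -/
def size (σ₀ : ℝ) (W₀ : Experts M J d) (x : Input P d) : ℝ :=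
  1 + ∑ p, ‖x p‖ + σ₀⁻¹ * ∑ m, ∑ j, ∑ p, |inner ℝ (filter (W₀ m) j) (x p)|

lemma one_le_size {σ₀ : ℝ} (hσ : 0 < σ₀) (W₀ : Experts M J d) (x : Input P d) :
    1 ≤ size σ₀ W₀ x := by
  unfold size
  have : 0 ≤ ∑ p, ‖x p‖ := by positivity
  have : 0 ≤ σ₀⁻¹ * ∑ m, ∑ j, ∑ p, |inner ℝ (filter (W₀ m) j) (x p)| := by positivity
  linarith

lemma sum_norm_le_size {σ₀ : ℝ} (hσ : 0 < σ₀) (W₀ : Experts M J d) (x : Input P d) :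
    ∑ p, ‖x p‖ ≤ size σ₀ W₀ x := by
  unfold size
  have : 0 ≤ σ₀⁻¹ * ∑ m, ∑ j, ∑ p, |inner ℝ (filter (W₀ m) j) (x p)| := by positivity
  linarith

lemma norm_le_size {σ₀ : ℝ} (hσ : 0 < σ₀) (W₀ : Experts M J d) (x : Input P d) (p : Fin P) :
    ‖x p‖ ≤ size σ₀ W₀ x :=
  (Finset.single_le_sum (f := fun p => ‖x p‖) (fun _ _ => by positivity)
    (Finset.mem_univ p)).trans (sum_norm_le_size hσ W₀ x)

lemma sum_abs_inner_init_le {σ₀ : ℝ} (hσ : 0 < σ₀) (W₀ : Experts M J d) (x : Input P d)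
    (m : Fin M) (j : Fin J) :
    ∑ p, |inner ℝ (filter (W₀ m) j) (x p)| ≤ σ₀ * (size σ₀ W₀ x - ∑ p, ‖x p‖) := by
  have h1 : ∑ p, |inner ℝ (filter (W₀ m) j) (x p)| ≤
      ∑ m, ∑ j, ∑ p, |inner ℝ (filter (W₀ m) j) (x p)| :=
    (Finset.single_le_sum (f := fun j => ∑ p, |inner ℝ (filter (W₀ m) j) (x p)|)
      (fun _ _ => by positivity) (Finset.mem_univ j)).trans
    (Finset.single_le_sum (f := fun m => ∑ j, ∑ p, |inner ℝ (filter (W₀ m) j) (x p)|)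
      (fun _ _ => by positivity) (Finset.mem_univ m))
  have h2 : σ₀ * (size σ₀ W₀ x - ∑ p, ‖x p‖) =
      σ₀ + ∑ m, ∑ j, ∑ p, |inner ℝ (filter (W₀ m) j) (x p)| := by
    unfold size; field_simp; ring
  linarith

lemma sum_abs_inner_le {σ₀ s : ℝ} (hσ : 0 < σ₀) {W₀ W : Experts M J d} {m : Fin M}
    (hW : ‖W m - W₀ m‖ ≤ s) (x : Input P d) (j : Fin J) :
    ∑ p, |inner ℝ (filter (W m) j) (x p)| ≤ (σ₀ + s) * size σ₀ W₀ x := by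
  have hs : 0 ≤ s := (norm_nonneg _).trans hW
  have h1 : ∀ p, |inner ℝ (filter (W m) j) (x p)| ≤
      |inner ℝ (filter (W₀ m) j) (x p)| + s * ‖x p‖ := fun p => by
    have : inner ℝ (filter (W m) j) (x p) = inner ℝ (filter (W₀ m) j) (x p) +
        inner ℝ (filter (W m - W₀ m) j) (x p) := by
      rw [filter_sub, inner_sub_left]; ring
    rw [this]
    refine (abs_add_le _ _).trans ?_
    gcongr
    refine (abs_real_inner_le_norm _ _).trans ?_
    gcongr
    exact (norm_filter_le _ _).trans hW
  calc _ ≤ ∑ p, (|inner ℝ (filter (W₀ m) j) (x p)| + s * ‖x p‖) :=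
        Finset.sum_le_sum fun p _ => h1 p
    _ = ∑ p, |inner ℝ (filter (W₀ m) j) (x p)| + s * ∑ p, ‖x p‖ := by
        rw [Finset.sum_add_distrib, Finset.mul_sum]
    _ ≤ σ₀ * (size σ₀ W₀ x - ∑ p, ‖x p‖) + s * size σ₀ W₀ x := by
        gcongr
        · exact sum_abs_inner_init_le hσ W₀ x m j
        · exact sum_norm_le_size hσ W₀ x
    _ ≤ (σ₀ + s) * size σ₀ W₀ x := by
        have : 0 ≤ σ₀ * ∑ p, ‖x p‖ := by positivity
        linarith

lemma sum_pow_le_pow_sum {ι : Type*} (s : Finset ι) {f : ι → ℝ} (hf : ∀ i, 0 ≤ f i) (k : ℕ) :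
    ∑ i ∈ s, f i ^ (k + 1) ≤ (∑ i ∈ s, f i) ^ (k + 1) := by
  rw [pow_succ (∑ i ∈ s, f i), Finset.mul_sum]
  refine Finset.sum_le_sum fun i hi => ?_
  rw [pow_succ]
  have := Finset.single_le_sum (f := f) (fun i _ => hf i) hi
  have := hf i
  gcongr

lemma norm_sampleField_le {σ₀ s : ℝ} (hσ : 0 < σ₀) {W₀ W : Experts M J d} {m : Fin M}
    (hW : ‖W m - W₀ m‖ ≤ s) {z : Sample P d} (hz : |z.2| ≤ 1) (j : Fin J) :
    ‖sampleField z (filter (W m) j)‖ ≤ (σ₀ + s) ^ 2 * size σ₀ W₀ z.1 ^ 3 := by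
  have h1 := sum_abs_inner_le hσ hW z.1 j
  have h0 : 0 ≤ size σ₀ W₀ z.1 := by linarith [one_le_size hσ W₀ z.1]
  unfold sampleField
  rw [norm_smul, Real.norm_eq_abs]
  calc |z.2| * ‖∑ p, inner ℝ (filter (W m) j) (z.1 p) ^ 2 • z.1 p‖
      ≤ 1 * ∑ p, |inner ℝ (filter (W m) j) (z.1 p)| ^ 2 * size σ₀ W₀ z.1 := by
        gcongr
        refine (norm_sum_le _ _).trans (Finset.sum_le_sum fun p _ => ?_)
        rw [norm_smul, Real.norm_eq_abs, abs_pow]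
        gcongr
        exact norm_le_size hσ W₀ z.1 p
    _ = (∑ p, |inner ℝ (filter (W m) j) (z.1 p)| ^ 2) * size σ₀ W₀ z.1 := by
        rw [one_mul, Finset.sum_mul]
    _ ≤ ((σ₀ + s) * size σ₀ W₀ z.1) ^ 2 * size σ₀ W₀ z.1 := by
        gcongr
        exact (sum_pow_le_pow_sum Finset.univ
          (f := fun p => |inner ℝ (filter (W m) j) (z.1 p)|) (fun _ => abs_nonneg _) 1).trans
          (pow_le_pow_left₀ (by positivity) h1 2)
    _ = (σ₀ + s) ^ 2 * size σ₀ W₀ z.1 ^ 3 := by ring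

lemma abs_expert_le {σ₀ s : ℝ} (hσ : 0 < σ₀) {W₀ W : Experts M J d} {m : Fin M}
    (hW : ‖W m - W₀ m‖ ≤ s) (x : Input P d) :
    |expert (W m) x| ≤ J * ((σ₀ + s) ^ 3 * size σ₀ W₀ x ^ 3) := by
  unfold expert
  refine (Finset.abs_sum_le_sum_abs _ _).trans ?_
  have : ∀ j ∈ Finset.univ, |∑ p, inner ℝ (filter (W m) j) (x p) ^ 3| ≤
      (σ₀ + s) ^ 3 * size σ₀ W₀ x ^ 3 := fun j _ => by
    refine (Finset.abs_sum_le_sum_abs _ _).trans ?_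
    simp only [abs_pow]
    refine (sum_pow_le_pow_sum Finset.univ
          (f := fun p => |inner ℝ (filter (W m) j) (x p)|) (fun _ => abs_nonneg _) 2).trans ?_
    rw [← mul_pow]
    exact pow_le_pow_left₀ (by positivity) (sum_abs_inner_le hσ hW x j) 3
  simpa using Finset.sum_le_sum this

lemma norm_expertField_le {σ₀ s : ℝ} (hσ : 0 < σ₀) {W₀ W : Experts M J d} {m : Fin M}
    (hW : ‖W m - W₀ m‖ ≤ s) {z : Sample P d} (hz : |z.2| ≤ 1) :
    ‖expertField z (W m)‖ ≤ J * ((σ₀ + s) ^ 2 * size σ₀ W₀ z.1 ^ 3) := by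
  unfold expertField
  refine (norm_sum_le _ _).trans ?_
  have : ∀ j ∈ Finset.univ, ‖embed j (sampleField z (filter (W m) j))‖ ≤
      (σ₀ + s) ^ 2 * size σ₀ W₀ z.1 ^ 3 := fun j _ => by
    rw [norm_embed]
    exact norm_sampleField_le hσ hW hz j
  simpa using Finset.sum_le_sum this

lemma abs_gate_le {σ₀ τ : ℝ} (hσ : 0 < σ₀) (W₀ : Experts M J d) {Θ : Router M d}
    (hΘ : ∀ m, ‖Θ m‖ ≤ τ) (x : Input P d) (m : Fin M) :
    |gate Θ x m| ≤ τ * size σ₀ W₀ x := by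
  have hτ : 0 ≤ τ := (norm_nonneg _).trans (hΘ m)
  unfold gate
  refine (Finset.abs_sum_le_sum_abs _ _).trans ?_
  calc ∑ p, |inner ℝ (Θ m) (x p)| ≤ ∑ p, τ * ‖x p‖ := by
        refine Finset.sum_le_sum fun p _ => (abs_real_inner_le_norm _ _).trans ?_
        gcongr
        exact hΘ m
    _ ≤ τ * size σ₀ W₀ x := by
        rw [← Finset.mul_sum]
        gcongr
        exact sum_norm_le_size hσ W₀ x

open Classical in
/-- Indicator that expert `m` is a maximizer of the pure router noise. -/
def routed (r : Fin M → ℝ) (m : Fin M) : ℝ := if m ∈ argmaxSet r then 1 else 0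

open Classical in
/-- Indicator that a perturbation of size `u` may change whether `m` maximizes `r`. -/
def nearTie (u : ℝ) (r : Fin M → ℝ) (m : Fin M) : ℝ :=
  if ∃ m', m' ≠ m ∧ |r m' - r m| ≤ 2 * u then 1 else 0

lemma nearTie_nonneg (u : ℝ) (r : Fin M → ℝ) (m : Fin M) : 0 ≤ nearTie u r m := by
  unfold nearTie; split_ifs <;> norm_num

lemma routed_mem (r : Fin M → ℝ) (m : Fin M) : 0 ≤ routed r m ∧ routed r m ≤ 1 := by
  unfold routed; split_ifs <;> norm_num

/-- A gate of size at most `u` changes the routing decision for `m` only when the noise of `m` is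
within `2 u` of that of another expert. -/
lemma abs_routed_sub_le {u : ℝ} {h : Fin M → ℝ} (hh : ∀ m, |h m| ≤ u) (r : Fin M → ℝ) (m : Fin M) :
    |routed (fun m => h m + r m) m - routed r m| ≤ nearTie u r m := by
  unfold nearTie
  split_ifs with hc
  · have h1 := routed_mem (fun m => h m + r m) m
    have h2 := routed_mem r m
    rw [abs_le]
    constructor <;> linarith
  · push Not at hc
    have : m ∈ argmaxSet (fun m => h m + r m) ↔ m ∈ argmaxSet r := by
      simp only [argmaxSet, Finset.mem_filter, Finset.mem_univ, true_and]
      refine forall_congr' fun m' => ?_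
      by_cases hm : m' = m
      · simp [hm]
      · have h1 := hc m' hm
        have h2 := abs_le.1 (hh m)
        have h3 := abs_le.1 (hh m')
        rcases lt_abs.1 h1 with h4 | h4 <;> constructor <;> intro h5 <;> linarith
    simp [routed, this]

/-- The scalar `y ∑_p ⟨u₁, x_p⟩ ⟨u₂, x_p⟩ ⟨u₃, x_p⟩` of an example. -/
def triple (z : Sample P d) (u₁ u₂ u₃ : EuclideanSpace ℝ (Fin d)) : ℝ :=
  z.2 * ∑ p, inner ℝ u₁ (z.1 p) * inner ℝ u₂ (z.1 p) * inner ℝ u₃ (z.1 p)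

/-- The signal tensor `∑_k v_k ⊗ v_k ⊗ v_k` evaluated at three vectors. -/
def signalTriple (v : Fin K → EuclideanSpace ℝ (Fin d)) (u₁ u₂ u₃ : EuclideanSpace ℝ (Fin d)) :
    ℝ :=
  ∑ k, inner ℝ u₁ (v k) * inner ℝ u₂ (v k) * inner ℝ u₃ (v k)

/-- Deviation of the empirical third-order tensor of the examples that pure router noise sends
to expert `m` from `κ` times the signal tensor. -/
def deviation (v : Fin K → EuclideanSpace ℝ (Fin d)) (κ : ℝ) (S : Fin n → Sample P d)
    (r : Fin n → Fin M → ℝ) (m : Fin M) (u₁ u₂ u₃ : EuclideanSpace ℝ (Fin d)) : ℝ :=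
  (n : ℝ)⁻¹ * ∑ i, routed (r i) m * triple (S i) u₁ u₂ u₃ - κ * signalTriple v u₁ u₂ u₃

/-- The standard basis, augmented by the initial filter in units of the initialization scale. -/
def frame (σ₀ : ℝ) (w : EuclideanSpace ℝ (Fin d)) : Option (Fin d) → EuclideanSpace ℝ (Fin d)
  | none => σ₀⁻¹ • w
  | some a => EuclideanSpace.single a 1

/-- Sum of squares of the deviation tensor in the augmented basis. -/
def deviationSq (v : Fin K → EuclideanSpace ℝ (Fin d)) (κ σ₀ : ℝ) (S : Fin n → Sample P d)
    (r : Fin n → Fin M → ℝ) (m : Fin M) (w : EuclideanSpace ℝ (Fin d)) : ℝ :=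
  ∑ α, ∑ β, ∑ a : Fin d, deviation v κ S r m (frame σ₀ w α) (frame σ₀ w β)
    (EuclideanSpace.single a 1) ^ 2

/-- The signal part of the ascent direction of a filter. -/
def signalField (v : Fin K → EuclideanSpace ℝ (Fin d)) (w : EuclideanSpace ℝ (Fin d)) :
    EuclideanSpace ℝ (Fin d) :=
  ∑ k, (inner ℝ w (v k)) ^ 2 • v k

lemma deviation_bilin (v : Fin K → EuclideanSpace ℝ (Fin d)) (κ : ℝ) (S : Fin n → Sample P d)
    (r : Fin n → Fin M → ℝ) (m : Fin M) (u₃ : EuclideanSpace ℝ (Fin d)) :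
    ∃ B : EuclideanSpace ℝ (Fin d) →ₗ[ℝ] EuclideanSpace ℝ (Fin d) →ₗ[ℝ] ℝ,
      ∀ u₁ u₂, B u₁ u₂ = deviation v κ S r m u₁ u₂ u₃ := by
  refine ⟨LinearMap.mk₂ ℝ (fun u₁ u₂ => deviation v κ S r m u₁ u₂ u₃) ?_ ?_ ?_ ?_, fun _ _ => rfl⟩
  · intro a b c
    simp only [deviation, triple, signalTriple, inner_add_left, add_mul, Finset.sum_add_distrib,
      mul_add]
    ring
  · intro a b c
    have e : ∀ x y z : ℝ, a * x * y * z = a * (x * y * z) := fun _ _ _ => by ring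
    have e2 : ∀ x y z : ℝ, x * (y * (a * z)) = a * (x * (y * z)) := fun _ _ _ => by ring
    simp only [deviation, triple, signalTriple, inner_smul_left, smul_eq_mul, conj_trivial, e,
      ← Finset.mul_sum, e2]
    ring
  · intro a b c
    simp only [deviation, triple, signalTriple, inner_add_left, add_mul, Finset.sum_add_distrib,
      mul_add]
    ring
  · intro a b c
    have e : ∀ x y z : ℝ, x * (a * y) * z = a * (x * y * z) := fun _ _ _ => by ring
    have e2 : ∀ x y z : ℝ, x * (y * (a * z)) = a * (x * (y * z)) := fun _ _ _ => by ring
    simp only [deviation, triple, signalTriple, inner_smul_left, smul_eq_mul, conj_trivial, e,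
      ← Finset.mul_sum, e2]
    ring

lemma sq_sum_sum_le {ι : Type*} [Fintype ι] (a : ι → ℝ) (D : ι → ι → ℝ) :
    (∑ α, ∑ β, a α * a β * D α β) ^ 2 ≤ (∑ α, a α ^ 2) ^ 2 * ∑ α, ∑ β, D α β ^ 2 := by
  have h := Finset.sum_mul_sq_le_sq_mul_sq (Finset.univ : Finset (ι × ι))
    (fun q => a q.1 * a q.2) (fun q => D q.1 q.2)
  simp only [Fintype.sum_prod_type, mul_pow] at h
  refine h.trans (le_of_eq ?_)
  congr 1
  rw [sq (∑ α, a α ^ 2), Finset.sum_mul_sum]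

/-- Along a displacement `Δ` from the initial filter `w`, the deviation field is of the order of
`σ₀² + ‖Δ‖²`: in the augmented basis `w + Δ` has coefficients `σ₀` and `Δ`. -/
lemma norm_deviation_le {σ₀ : ℝ} (hσ : 0 < σ₀) (v : Fin K → EuclideanSpace ℝ (Fin d)) (κ : ℝ)
    (S : Fin n → Sample P d) (r : Fin n → Fin M → ℝ) (m : Fin M)
    (w w' : EuclideanSpace ℝ (Fin d)) :
    ‖(n : ℝ)⁻¹ • ∑ i, routed (r i) m • sampleField (S i) w' - κ • signalField v w'‖ ≤
      (σ₀ ^ 2 + ‖w' - w‖ ^ 2) * √(deviationSq v κ σ₀ S r m w) := by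
  set a : Option (Fin d) → ℝ := fun o => o.elim σ₀ fun i => (w' - w) i with ha
  have hw' : w' = ∑ α, a α • frame σ₀ w α := by
    rw [Fintype.sum_option]
    have h1 : ∑ i, a (some i) • frame σ₀ w (some i) = w' - w := by
      have := (EuclideanSpace.basisFun (Fin d) ℝ).sum_repr (w' - w)
      simpa [ha, frame] using this
    rw [h1]
    simp [ha, frame, smul_smul, hσ.ne']
  have hsq : ∑ α, a α ^ 2 = σ₀ ^ 2 + ‖w' - w‖ ^ 2 := by
    rw [Fintype.sum_option, EuclideanSpace.real_norm_sq_eq]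
    simp [ha]
  have hc : ∀ c : Fin d, ((n : ℝ)⁻¹ • ∑ i, routed (r i) m • sampleField (S i) w' -
      κ • signalField v w') c = ∑ α, ∑ β, a α * a β * deviation v κ S r m (frame σ₀ w α)
        (frame σ₀ w β) (EuclideanSpace.single c 1) := fun c => by
    obtain ⟨B, hB⟩ := deviation_bilin v κ S r m (EuclideanSpace.single c 1)
    have h1 : ((n : ℝ)⁻¹ • ∑ i, routed (r i) m • sampleField (S i) w' -
        κ • signalField v w') c = B w' w' := by
      rw [hB]
      simp [deviation, sampleField, signalField, triple, signalTriple,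
        EuclideanSpace.inner_single_left, sq]
    rw [h1]
    conv_lhs => rw [hw']
    simp only [map_sum, map_smul, LinearMap.sum_apply, LinearMap.smul_apply, smul_eq_mul,
      Finset.mul_sum, hB]
    rw [Finset.sum_comm]
    refine Finset.sum_congr rfl fun α _ => Finset.sum_congr rfl fun β _ => by ring
  have h0 : 0 ≤ deviationSq v κ σ₀ S r m w := by unfold deviationSq; positivity
  rw [← Real.sqrt_sq (by positivity : 0 ≤ σ₀ ^ 2 + ‖w' - w‖ ^ 2),
    ← Real.sqrt_mul (by positivity)]
  apply Real.le_sqrt_of_sq_le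
  rw [EuclideanSpace.real_norm_sq_eq]
  simp only [hc]
  calc _ ≤ ∑ c : Fin d, (∑ α, a α ^ 2) ^ 2 * ∑ α, ∑ β, deviation v κ S r m (frame σ₀ w α)
        (frame σ₀ w β) (EuclideanSpace.single c 1) ^ 2 :=
        Finset.sum_le_sum fun c _ => sq_sum_sum_le a _
    _ = _ := by
        rw [← Finset.mul_sum, hsq]
        congr 1
        unfold deviationSq
        rw [Finset.sum_comm]
        exact Finset.sum_congr rfl fun α _ => Finset.sum_comm

/-- Bound for the relative error of the expert gradient. It depends on the router noise of the
current round only, and not on the trajectory of the weights. -/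
def gradientError (v : Fin K → EuclideanSpace ℝ (Fin d)) (κ σ₀ τ ρ : ℝ) (W₀ : Experts M J d)
    (S : Fin n → Sample P d) (r : Fin n → Fin M → ℝ) (m : Fin M) : ℝ :=
  3 * (J * ((n : ℝ)⁻¹ * ∑ i, size σ₀ W₀ (S i).1 ^ 3 *
        nearTie (τ * size σ₀ W₀ (S i).1) (r i) m) +
      J * ((M * (J * ρ ^ 3) + 4 * τ) * ((n : ℝ)⁻¹ * ∑ i, size σ₀ W₀ (S i).1 ^ 6)) +
      ∑ j, √(deviationSq v (κ / M) σ₀ S r m (filter (W₀ m) j)))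

lemma gradientError_nonneg (v : Fin K → EuclideanSpace ℝ (Fin d)) {κ σ₀ τ ρ : ℝ} (hσ : 0 < σ₀)
    (hτ : 0 ≤ τ) (hρ : 0 ≤ ρ) (W₀ : Experts M J d)
    (S : Fin n → Sample P d) (r : Fin n → Fin M → ℝ) (m : Fin M) :
    0 ≤ gradientError v κ σ₀ τ ρ W₀ S r m := by
  unfold gradientError
  have h : ∀ i, 0 ≤ size σ₀ W₀ (S i).1 := fun i => by linarith [one_le_size hσ W₀ (S i).1]
  have h1 : 0 ≤ ∑ i, size σ₀ W₀ (S i).1 ^ 3 * nearTie (τ * size σ₀ W₀ (S i).1) (r i) m :=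
    Finset.sum_nonneg fun i _ => mul_nonneg (pow_nonneg (h i) 3) (nearTie_nonneg _ _ _)
  have h2 : 0 ≤ ∑ i, size σ₀ W₀ (S i).1 ^ 6 := Finset.sum_nonneg fun i _ => pow_nonneg (h i) 6
  positivity

/-- The dispatch of one training round. -/
abbrev dispatch (Θ : Router M d) (S : Fin n → Sample P d) (r : Fin n → Fin M → ℝ) (i : Fin n) :
    Finset (Fin M) :=
  argmaxSet fun m => gate Θ (S i).1 m + r i m

/-- While the experts are `s`-close to the initialization and the router is `τ`-close to zero, the
negative expert gradient is a multiple of the signal field, up to the gradient error times the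
squared scale `σ₀ + s` of the weights. The logistic derivative contributes the factor `1 / 2`, the
gate value a factor `1 / M`, and the share of examples sent to the expert another factor `1 / M`.
-/
lemma norm_gradient_expert_sub_le {σ₀ τ ρ s κ : ℝ} (hσ : 0 < σ₀)
    (v : Fin K → EuclideanSpace ℝ (Fin d)) {W₀ W : Experts M J d} {Θ : Router M d}
    {S : Fin n → Sample P d} (hS : ∀ i, |(S i).2| ≤ 1) (r : Fin n → Fin M → ℝ)
    (hW : ∀ m, ‖W m - W₀ m‖ ≤ s) (hΘ : ∀ m, ‖Θ m‖ ≤ τ) (hsρ : σ₀ + s ≤ ρ) (m : Fin M) :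
    ‖-gradient (fun w => loss S (dispatch Θ S r) Θ (Function.update W m w)) (W m) -
      (3 * κ / (2 * (M : ℝ) ^ 2)) • ∑ j, embed j (signalField v (filter (W m) j))‖ ≤
      (σ₀ + s) ^ 2 * gradientError v κ σ₀ τ ρ W₀ S r m := by
  have hs : 0 ≤ s := (norm_nonneg _).trans (hW m)
  have hτ : 0 ≤ τ := (norm_nonneg _).trans (hΘ m)
  have hM : (1 : ℝ) ≤ M := by exact_mod_cast m.pos
  set Λ : Fin n → ℝ := fun i => size σ₀ W₀ (S i).1 with hΛ
  have hΛ1 : ∀ i, 1 ≤ Λ i := fun i => one_le_size hσ W₀ _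
  have hΛ0 : ∀ i, 0 ≤ Λ i := fun i => zero_le_one.trans (hΛ1 i)
  have hV : ∀ i, ‖expertField (S i) (W m)‖ ≤ J * ((σ₀ + s) ^ 2 * Λ i ^ 3) :=
    fun i => norm_expertField_le hσ (hW m) (hS i)
  set A := dispatch Θ S r with hA
  set f : Fin n → ℝ := fun i =>
    (S i).2 * ∑ m' ∈ A i, routeValue Θ (S i).1 m' * expert (W m') (S i).1 with hf
  have hf1 : ∀ i, |f i| ≤ M * (J * ρ ^ 3) * Λ i ^ 3 := fun i => by
    rw [hf, abs_mul]
    calc |(S i).2| * _ ≤ 1 * ∑ m' ∈ A i, |routeValue Θ (S i).1 m' * expert (W m') (S i).1| := by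
          gcongr
          · exact hS i
          · exact Finset.abs_sum_le_sum_abs _ _
      _ ≤ ∑ m', |routeValue Θ (S i).1 m' * expert (W m') (S i).1| := by
          rw [one_mul]
          exact Finset.sum_le_sum_of_subset_of_nonneg (Finset.subset_univ _)
            fun _ _ _ => abs_nonneg _
      _ ≤ ∑ _m' : Fin M, J * (ρ ^ 3 * Λ i ^ 3) := by
          refine Finset.sum_le_sum fun m' _ => ?_
          rw [abs_mul, abs_of_nonneg (routeValue_nonneg _ _ _)]
          calc _ ≤ 1 * |expert (W m') (S i).1| := by gcongr; exact routeValue_le_one _ _ _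
            _ ≤ J * ((σ₀ + s) ^ 3 * Λ i ^ 3) := by
                rw [one_mul]; exact abs_expert_le hσ (hW m') _
            _ ≤ _ := by gcongr; exact pow_nonneg (hΛ0 i) 3
      _ = _ := by rw [Finset.sum_const, Finset.card_univ, Fintype.card_fin, nsmul_eq_mul]; ring
  set a : Fin n → ℝ := fun i => sig (f i) * routeValue Θ (S i).1 m with ha
  have ha1 : ∀ i, |a i - 1 / (2 * M)| ≤ (M * (J * ρ ^ 3) + 4 * τ) * Λ i ^ 3 := fun i => by
    have h1 := abs_routeValue_sub_le Θ (S i).1 m (fun m' => abs_gate_le hσ W₀ hΘ (S i).1 m')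
    have h2 := (abs_sig_sub_half_le (f i)).trans (hf1 i)
    have h3 : a i - 1 / (2 * M) = (sig (f i) - 1 / 2) * routeValue Θ (S i).1 m +
        1 / 2 * (routeValue Θ (S i).1 m - 1 / M) := by rw [ha]; field_simp; ring
    rw [h3]
    refine (abs_add_le _ _).trans ?_
    rw [abs_mul, abs_mul, abs_of_nonneg (routeValue_nonneg _ _ _), abs_of_pos (one_half_pos (α := ℝ))]
    have h4 : |sig (f i) - 1 / 2| * routeValue Θ (S i).1 m ≤ |sig (f i) - 1 / 2| * 1 := by
      gcongr; exact routeValue_le_one _ _ _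
    have h5 : Λ i ≤ Λ i ^ 3 := le_self_pow₀ (hΛ1 i) (by norm_num)
    have h6 : τ * Λ i ≤ τ * Λ i ^ 3 := by gcongr
    have h7 : 0 ≤ τ * Λ i := mul_nonneg hτ (hΛ0 i)
    change |routeValue Θ (S i).1 m - 1 / M| ≤ 4 * (τ * Λ i) at h1
    linarith
  set R : Fin n → ℝ := fun i => routed (fun m => gate Θ (S i).1 m + r i m) m with hR
  have hR1 : ∀ i, |R i * a i - routed (r i) m * (1 / (2 * M))| ≤
      nearTie (τ * Λ i) (r i) m + (M * (J * ρ ^ 3) + 4 * τ) * Λ i ^ 3 := fun i => by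
    have h1 := abs_routed_sub_le (fun m' => abs_gate_le hσ W₀ hΘ (S i).1 m') (r i) m
    have h2 := routed_mem (r i) m
    have h3 : R i * a i - routed (r i) m * (1 / (2 * M)) =
        (R i - routed (r i) m) * a i + routed (r i) m * (a i - 1 / (2 * M)) := by ring
    have h4 : |a i| ≤ 1 := by
      rw [ha, abs_mul, abs_of_nonneg (sig_nonneg _), abs_of_nonneg (routeValue_nonneg _ _ _)]
      exact mul_le_one₀ (sig_le_one _) (routeValue_nonneg _ _ _) (routeValue_le_one _ _ _)
    rw [h3]
    refine (abs_add_le _ _).trans (add_le_add ?_ ?_)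
    · rw [abs_mul]
      exact (mul_le_of_le_one_right (abs_nonneg _) h4).trans h1
    · rw [abs_mul, abs_of_nonneg h2.1]
      exact (mul_le_of_le_one_left (abs_nonneg _) h2.2).trans (ha1 i)
  have hg : -gradient (fun w => loss S A Θ (Function.update W m w)) (W m) =
      (3 / (n : ℝ)) • ∑ i, (R i * a i) • expertField (S i) (W m) := by
    rw [gradient_loss_expert, neg_neg]
    congr 1
    refine Finset.sum_congr rfl fun i _ => ?_
    congr 1
    simp only [hR, ha, routed, hf, ite_mul, one_mul, zero_mul]
    rfl
  have hdec : (3 / (n : ℝ)) • ∑ i, (R i * a i) • expertField (S i) (W m) -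
      (3 * κ / (2 * (M : ℝ) ^ 2)) • ∑ j, embed j (signalField v (filter (W m) j)) =
      (3 / (n : ℝ)) • ∑ i, (R i * a i - routed (r i) m * (1 / (2 * M))) • expertField (S i) (W m) +
      (3 / (2 * (M : ℝ))) • ∑ j, embed j ((n : ℝ)⁻¹ • ∑ i, routed (r i) m •
        sampleField (S i) (filter (W m) j) - (κ / M) • signalField v (filter (W m) j)) := by
    have h1 : ∑ j, embed j ((n : ℝ)⁻¹ • ∑ i, routed (r i) m •
        sampleField (S i) (filter (W m) j) - (κ / M) • signalField v (filter (W m) j)) =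
        (n : ℝ)⁻¹ • ∑ i, routed (r i) m • expertField (S i) (W m) -
        (κ / M) • ∑ j, embed j (signalField v (filter (W m) j)) := by
      simp only [map_sub, map_smul, map_sum, Finset.sum_sub_distrib, ← Finset.smul_sum,
        expertField]
      congr 2
      simp only [Finset.smul_sum]
      exact Finset.sum_comm
    rw [h1]
    simp only [sub_smul, Finset.sum_sub_distrib, smul_sub, smul_smul, Finset.smul_sum]
    have e1 : ∀ i, 3 / (2 * (M : ℝ)) * ((n : ℝ)⁻¹ * routed (r i) m) =
        3 / (n : ℝ) * (routed (r i) m * (1 / (2 * M))) := fun i => by ring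
    have e2 : 3 / (2 * (M : ℝ)) * (κ / M) = 3 * κ / (2 * (M : ℝ) ^ 2) := by field_simp
    simp only [e1, e2]
    abel
  rw [hg, hdec]
  have hfirst : ‖(3 / (n : ℝ)) • ∑ i, (R i * a i - routed (r i) m * (1 / (2 * M))) •
      expertField (S i) (W m)‖ ≤ (σ₀ + s) ^ 2 * (3 * (J * ((n : ℝ)⁻¹ * ∑ i, Λ i ^ 3 *
        nearTie (τ * Λ i) (r i) m) +
      J * ((M * (J * ρ ^ 3) + 4 * τ) * ((n : ℝ)⁻¹ * ∑ i, Λ i ^ 6)))) := by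
    rw [norm_smul, Real.norm_of_nonneg (by positivity)]
    calc _ ≤ (3 / (n : ℝ)) * ∑ i, (nearTie (τ * Λ i) (r i) m +
          (M * (J * ρ ^ 3) + 4 * τ) * Λ i ^ 3) * (J * ((σ₀ + s) ^ 2 * Λ i ^ 3)) := by
          gcongr
          refine (norm_sum_le _ _).trans (Finset.sum_le_sum fun i _ => ?_)
          rw [norm_smul, Real.norm_eq_abs]
          exact mul_le_mul (hR1 i) (hV i) (norm_nonneg _)
            ((abs_nonneg _).trans (hR1 i))
      _ = _ := by
          simp only [Finset.mul_sum, mul_add, ← Finset.sum_add_distrib]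
          refine Finset.sum_congr rfl fun i _ => ?_
          ring
  have hsecond : ‖(3 / (2 * (M : ℝ))) • ∑ j, embed j ((n : ℝ)⁻¹ • ∑ i, routed (r i) m •
        sampleField (S i) (filter (W m) j) - (κ / M) • signalField v (filter (W m) j))‖ ≤
      (σ₀ + s) ^ 2 * (3 * ∑ j, √(deviationSq v (κ / M) σ₀ S r m (filter (W₀ m) j))) := by
    rw [norm_smul, Real.norm_of_nonneg (by positivity)]
    have h3 : 3 / (2 * (M : ℝ)) ≤ 3 := by
      rw [div_le_iff₀ (by positivity)]; linarith
    calc _ ≤ 3 * ∑ j, (σ₀ + s) ^ 2 * √(deviationSq v (κ / M) σ₀ S r m (filter (W₀ m) j)) := by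
          gcongr
          refine (norm_sum_le _ _).trans (Finset.sum_le_sum fun j _ => ?_)
          rw [norm_embed]
          refine (norm_deviation_le hσ v (κ / M) S r m (filter (W₀ m) j) _).trans ?_
          gcongr
          have h4 : ‖filter (W m) j - filter (W₀ m) j‖ ≤ s := by
            rw [← filter_sub]
            exact (norm_filter_le _ _).trans (hW m)
          nlinarith [norm_nonneg (filter (W m) j - filter (W₀ m) j)]
      _ = _ := by rw [← Finset.mul_sum]; ring
  refine (norm_add_le _ _).trans ((add_le_add hfirst hsecond).trans (le_of_eq ?_))
  unfold gradientError
  ring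

end Comparison

/-! ### The training trajectory -/

lemma norm_normalize_sub_le {E : Type*} [NormedAddCommGroup E] [NormedSpace ℝ E] (a : E) {b : E}
    (hb : b ≠ 0) : ‖‖a‖⁻¹ • a - ‖b‖⁻¹ • b‖ ≤ 2 * ‖a - b‖ / ‖b‖ := by
  have hb0 : 0 < ‖b‖ := norm_pos_iff.2 hb
  rw [le_div_iff₀ hb0]
  by_cases ha : a = 0
  · subst ha
    simp only [smul_zero, zero_sub, norm_neg, norm_smul, norm_inv, norm_norm]
    field_simp
    linarith
  · have ha0 : 0 < ‖a‖ := norm_pos_iff.2 ha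
    have h1 : ‖b‖ • (‖a‖⁻¹ • a - ‖b‖⁻¹ • b) = ((‖b‖ - ‖a‖) * ‖a‖⁻¹) • a + (a - b) := by
      rw [smul_sub, smul_smul, smul_smul, sub_mul, sub_smul, mul_inv_cancel₀ ha0.ne',
        mul_inv_cancel₀ hb0.ne']
      simp
    have h2 : ‖b‖ * ‖‖a‖⁻¹ • a - ‖b‖⁻¹ • b‖ = ‖‖b‖ • (‖a‖⁻¹ • a - ‖b‖⁻¹ • b)‖ := by
      rw [norm_smul, norm_norm]
    rw [mul_comm, h2, h1]
    refine (norm_add_le _ _).trans ?_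
    rw [norm_smul, norm_mul, norm_inv, norm_norm, mul_assoc, inv_mul_cancel₀ ha0.ne', mul_one,
      Real.norm_eq_abs]
    have := abs_norm_sub_norm_le b a
    rw [norm_sub_rev] at this
    linarith

section Trajectory

variable {K M J P d n : ℕ}

lemma filter_sum_embed (u : Fin J → EuclideanSpace ℝ (Fin d)) (j : Fin J) :
    filter (∑ j', embed j' (u j')) j = u j := by
  rw [filter_eq, map_sum]
  simp only [← filter_eq, filter_embed]
  simp

lemma inner_signalField {v : Fin K → EuclideanSpace ℝ (Fin d)} (hv : Orthonormal ℝ v)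
    (w : EuclideanSpace ℝ (Fin d)) (k : Fin K) :
    inner ℝ (signalField v w) (v k) = inner ℝ w (v k) ^ 2 := by
  unfold signalField
  rw [hv.inner_left_fintype]
  simp

lemma norm_signalField_sq {v : Fin K → EuclideanSpace ℝ (Fin d)} (hv : Orthonormal ℝ v)
    (w : EuclideanSpace ℝ (Fin d)) : ‖signalField v w‖ ^ 2 = ∑ k, inner ℝ w (v k) ^ 4 := by
  rw [← real_inner_self_eq_norm_sq]
  conv_lhs => rw [signalField]
  rw [hv.inner_sum]
  refine Finset.sum_congr rfl fun k _ => ?_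
  simp only [conj_trivial]
  ring

/-- Coordinates of an expert along the signal vectors. -/
def coords (v : Fin K → EuclideanSpace ℝ (Fin d)) (w : ExpertWeights J d) : Fin K × Fin J → ℝ :=
  fun q => inner ℝ (filter w q.2) (v q.1)

/-- The norm of the signal field is the normalizing factor of the cubic dynamics of the
coordinates. -/
lemma norm_signal_sum {v : Fin K → EuclideanSpace ℝ (Fin d)} (hv : Orthonormal ℝ v)
    (w : ExpertWeights J d) :
    ‖∑ j, embed j (signalField v (filter w j))‖ = √(∑ q, coords v w q ^ 4) := by
  rw [eq_comm, Real.sqrt_eq_iff_eq_sq (by positivity) (norm_nonneg _), ← sum_norm_filter_sq]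
  simp only [filter_sum_embed, norm_signalField_sq hv]
  rw [Fintype.sum_prod_type, Finset.sum_comm]
  rfl

/-- Normalized steps have length at most `η`. A vanishing gradient gives no step, as `η / 0 = 0`.
-/
lemma norm_train_sub_le {η ηr : ℝ} (hη : 0 ≤ η) (S : Fin n → Sample P d) (W₀ : Experts M J d)
    (r : ℕ → Fin n → Fin M → unitInterval) (t : ℕ) (m : Fin M) :
    ‖(train η ηr S W₀ r t).2 m - W₀ m‖ ≤ η * t := by
  induction t with
  | zero => simp [train]
  | succ t ih =>
    obtain ⟨g, hg⟩ : ∃ g : ExpertWeights J d, (train η ηr S W₀ r (t + 1)).2 m =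
        (train η ηr S W₀ r t).2 m - (η / ‖g‖) • g := ⟨_, rfl⟩
    rw [hg, sub_right_comm]
    refine (norm_sub_le _ _).trans ?_
    have : ‖(η / ‖g‖) • g‖ ≤ η := by
      rw [norm_smul, norm_div, norm_norm, Real.norm_of_nonneg hη]
      by_cases hg : ‖g‖ = 0
      · simp [hg, hη]
      · rw [div_mul_cancel₀ _ hg]
    push_cast
    linarith

/-- The router stays small, since its gradient is bounded by the outputs of the experts, which are
cubic in the scale `ρ` of the weights. -/
lemma norm_router_le {σ₀ η ηr ρ Γ : ℝ} (hσ : 0 < σ₀) (hη : 0 ≤ η) (hηr : 0 ≤ ηr)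
    {S : Fin n → Sample P d} (hS : ∀ i, |(S i).2| ≤ 1) {W₀ : Experts M J d}
    (hΓ : (n : ℝ)⁻¹ * ∑ i, size σ₀ W₀ (S i).1 ^ 6 ≤ Γ)
    (r : ℕ → Fin n → Fin M → unitInterval) {T : ℕ} (hT : σ₀ + η * T ≤ ρ) {t : ℕ} (ht : t ≤ T)
    (m : Fin M) :
    ‖(train η ηr S W₀ r t).1 m‖ ≤ t * (ηr * (M * (J * ρ ^ 3) * Γ)) := by
  induction t with
  | zero => simp [train]
  | succ t ih =>
    have ih := ih (by omega)
    simp only [train, step]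
    set W := (train η ηr S W₀ r t).2 with hW
    set Θ := (train η ηr S W₀ r t).1
    have ht' : σ₀ + η * t ≤ ρ := by
      have : (t : ℝ) ≤ T := by exact_mod_cast (by omega : t ≤ T)
      have : η * t ≤ η * T := by gcongr
      linarith
    have hρ : 0 ≤ σ₀ + η * t := by positivity
    set A : Fin n → Finset (Fin M) := dispatch Θ S fun i m => (r t i m : ℝ)
    have hg : ‖gradient (fun θ => loss S A (Function.update Θ m θ) W) (Θ m)‖ ≤
        M * (J * ρ ^ 3) * Γ := by
      refine (norm_gradient_router_le S hS A Θ W m).trans ?_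
      calc _ ≤ (1 / (n : ℝ)) * ∑ i, M * (J * ρ ^ 3) * size σ₀ W₀ (S i).1 ^ 6 := by
            refine mul_le_mul_of_nonneg_left (Finset.sum_le_sum fun i _ => ?_) (by positivity)
            have h1 := one_le_size hσ W₀ (S i).1
            have h2 : ∑ m', |expert (W m') (S i).1| ≤
                M * (J * (ρ ^ 3 * size σ₀ W₀ (S i).1 ^ 3)) := by
              have : ∀ m' ∈ Finset.univ, |expert (W m') (S i).1| ≤
                  J * (ρ ^ 3 * size σ₀ W₀ (S i).1 ^ 3) := fun m' _ => by
                refine (abs_expert_le hσ (norm_train_sub_le hη S W₀ r t m') _).trans ?_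
                gcongr
              simpa using Finset.sum_le_sum this
            have h3 := sum_norm_le_size hσ W₀ (S i).1
            have h5 : size σ₀ W₀ (S i).1 ^ 4 ≤ size σ₀ W₀ (S i).1 ^ 6 :=
              pow_le_pow_right₀ h1 (by norm_num)
            calc _ ≤ M * (J * (ρ ^ 3 * size σ₀ W₀ (S i).1 ^ 3)) * size σ₀ W₀ (S i).1 := by
                  refine mul_le_mul h2 h3 (by positivity) ?_
                  exact le_trans (by positivity) h2
              _ = M * (J * ρ ^ 3) * size σ₀ W₀ (S i).1 ^ 4 := by ring
              _ ≤ _ := by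
                  have : 0 ≤ ρ := hρ.trans ht'
                  exact mul_le_mul_of_nonneg_left h5 (by positivity)
        _ = M * (J * ρ ^ 3) * ((n : ℝ)⁻¹ * ∑ i, size σ₀ W₀ (S i).1 ^ 6) := by
            rw [← Finset.mul_sum]; ring
        _ ≤ _ := by
            have : 0 ≤ ρ := hρ.trans ht'
            gcongr
    refine (norm_sub_le _ _).trans ?_
    rw [norm_smul, Real.norm_of_nonneg hηr]
    have h6 := mul_le_mul_of_nonneg_left hg hηr
    push_cast
    linarith

/-- Deterministic description of an expert at the end of training, given a gap at initialization
and a small accumulated gradient error. The signal field is orthogonal to the cluster centers, so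
the coordinates along these move only through the error. -/
theorem trained_expert {v c : Fin K → EuclideanSpace ℝ (Fin d)}
    (hvc : Orthonormal ℝ (Sum.elim v c)) {σ₀ η ηr κ τ ρ Γ g L B ε : ℝ} (hσ : 0 < σ₀) (hη : 0 < η)
    (hηr : 0 ≤ ηr) (hκ : 0 < κ) {S : Fin n → Sample P d} (hS : ∀ i, |(S i).2| ≤ 1)
    {W₀ : Experts M J d} (hΓ : (n : ℝ)⁻¹ * ∑ i, size σ₀ W₀ (S i).1 ^ 6 ≤ Γ)
    (r : ℕ → Fin n → Fin M → unitInterval) {T : ℕ} (hT : σ₀ + η * T ≤ ρ)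
    (hτ : T * (ηr * (M * (J * ρ ^ 3) * Γ)) ≤ τ) {m : Fin M} {k₀ : Fin K} {j₀ : Fin J}
    (hg : 0 < g) (hgL : g ≤ L) (hstart : g ≤ coords v (W₀ m) (k₀, j₀))
    (hgap : ∀ q, q ≠ (k₀, j₀) → coords v (W₀ m) q + g ≤ coords v (W₀ m) (k₀, j₀))
    (hL : ∀ q, |coords v (W₀ m) q| ≤ L) (hLc : ∀ q, |coords c (W₀ m) q| ≤ L)
    (hηg : η * (512 * L ^ 4 * (K * J : ℕ)) ≤ g ^ 5)
    (hB : ∑ t ∈ Finset.range T,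
      η * gradientError v κ σ₀ τ ρ W₀ S (fun i m => (r t i m : ℝ)) m ≤ B)
    (hε : 0 < ε) (hεg : ε * σ₀ ≤ g / 2) (hεr : ε ≤ g ^ 2 / (16 * L ^ 2 * (K * J : ℕ)))
    (hbudget : 4 * (M : ℝ) ^ 2 / (3 * κ) * B / ε ^ 2 ≤ g / 16) :
    ε * (η * T) ≤ coords v ((train η ηr S W₀ r T).2 m) (k₀, j₀) ∧
    (∀ q, q ≠ (k₀, j₀) → |coords v ((train η ηr S W₀ r T).2 m) q| ≤ 4 * L ^ 2 / g) ∧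
    ∀ q, |coords c ((train η ηr S W₀ r T).2 m) q| ≤ 4 * L ^ 2 / g := by
  have hv : Orthonormal ℝ v := hvc.comp Sum.inl Sum.inl_injective
  have hvc0 : ∀ k k', inner ℝ (v k) (c k') = (0 : ℝ) := fun k k' =>
    hvc.2 (i := Sum.inl k) (j := Sum.inr k') (by simp)
  have hc1 : ∀ k, ‖c k‖ = 1 := fun k => hvc.1 (Sum.inr k)
  have hM : (1 : ℝ) ≤ M := by exact_mod_cast m.pos
  have hκ2 : 0 < 3 * κ / (2 * (M : ℝ) ^ 2) := by positivity
  have hρ0 : 0 ≤ ρ := le_trans (by positivity) hT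
  have hΓ0 : 0 ≤ Γ := by
    refine le_trans ?_ hΓ
    refine mul_nonneg (by positivity) (Finset.sum_nonneg fun i _ => ?_)
    exact pow_nonneg (by linarith [one_le_size hσ W₀ (S i).1]) 6
  have hτ0 : 0 ≤ τ := le_trans (by positivity) hτ
  set s := train η ηr S W₀ r with hs
  set rr : ℕ → Fin n → Fin M → ℝ := fun t i m => (r t i m : ℝ) with hrr
  -- gradient, signal direction and normalized error of each round
  set G : ℕ → ExpertWeights J d := fun t => gradient (fun w =>
    loss S (dispatch (s t).1 S (rr t)) (s t).1 (Function.update (s t).2 m w)) ((s t).2 m) with hG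
  set U : ℕ → ExpertWeights J d :=
    fun t => ∑ j, embed j (signalField v (filter ((s t).2 m) j)) with hU
  set e : ℕ → ExpertWeights J d := fun t => ‖-G t‖⁻¹ • (-G t) - ‖U t‖⁻¹ • U t with he
  set x : ℕ → Fin K × Fin J → ℝ := fun t => coords v ((s t).2 m) with hx
  have hN : ∀ t, ‖U t‖ = √(∑ q, x t q ^ 4) := fun t => norm_signal_sum hv _
  have hstep : ∀ t, (s (t + 1)).2 m = (s t).2 m + η • (‖U t‖⁻¹ • U t + e t) := fun t => by
    have h1 : (s (t + 1)).2 m = (s t).2 m - (η / ‖G t‖) • G t := rfl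
    rw [h1]
    simp only [he, norm_neg]
    rw [add_sub_cancel, smul_neg, smul_neg, smul_smul, sub_eq_add_neg, div_eq_mul_inv]
  have hxstep : ∀ t q, x (t + 1) q =
      x t q + η * (x t q ^ 2 / √(∑ q, x t q ^ 4) + coords v (e t) q) := fun t q => by
    simp only [hx, coords]
    rw [hstep, filter_eq, map_add, map_smul, map_add, map_smul]
    simp only [← filter_eq, inner_add_left, inner_smul_left, conj_trivial, hU, filter_sum_embed,
      inner_signalField hv]
    have := hN t
    simp only [hU, hx, coords] at this
    rw [← this, div_eq_inv_mul]
  have hcstep : ∀ t q, coords c ((s (t + 1)).2 m) q =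
      coords c ((s t).2 m) q + η * coords c (e t) q := fun t q => by
    simp only [coords]
    rw [hstep, filter_eq, map_add, map_smul, map_add, map_smul]
    simp only [← filter_eq, inner_add_left, inner_smul_left, conj_trivial, hU, filter_sum_embed]
    have : inner ℝ (signalField v (filter ((s t).2 m) q.2)) (c q.1) = (0 : ℝ) := by
      simp [signalField, sum_inner, inner_smul_left, hvc0]
    rw [this]
    ring
  set b : ℕ → ℝ := fun t => gradientError v κ σ₀ τ ρ W₀ S (rr t) m with hb
  have hb0 : ∀ t, 0 ≤ b t := fun t => gradientError_nonneg v hσ hτ0 hρ0 W₀ S (rr t) m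
  have herr : ∀ t < T, 0 < √(∑ q, x t q ^ 4) →
      ‖e t‖ ≤ 4 * (M : ℝ) ^ 2 / (3 * κ) * (b t * (σ₀ + η * t) ^ 2) / √(∑ q, x t q ^ 4) := by
    intro t ht hpos
    have htT : (t : ℝ) ≤ T := by exact_mod_cast ht.le
    have hU0 : U t ≠ 0 := by rw [← norm_pos_iff, hN]; exact hpos
    have h1 : ‖-G t - (3 * κ / (2 * (M : ℝ) ^ 2)) • U t‖ ≤ (σ₀ + η * t) ^ 2 * b t := by
      refine norm_gradient_expert_sub_le hσ v hS (rr t)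
        (fun m' => norm_train_sub_le hη.le S W₀ r t m') (fun m' => ?_) ?_ m
      · refine (norm_router_le hσ hη.le hηr hS hΓ r hT ht.le m').trans (le_trans ?_ hτ)
        gcongr
      · have : η * t ≤ η * T := by gcongr
        linarith
    have h2 := norm_normalize_sub_le (-G t) (smul_ne_zero hκ2.ne' hU0)
    have h3 : ‖(3 * κ / (2 * (M : ℝ) ^ 2)) • U t‖⁻¹ • ((3 * κ / (2 * (M : ℝ) ^ 2)) • U t) =
        ‖U t‖⁻¹ • U t := by
      rw [norm_smul, Real.norm_of_nonneg hκ2.le, smul_smul]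
      congr 1
      field_simp
    rw [h3] at h2
    refine h2.trans ?_
    rw [norm_smul, Real.norm_of_nonneg hκ2.le, ← hN]
    have hU1 : 0 < ‖U t‖ := norm_pos_iff.2 hU0
    calc _ ≤ 2 * ((σ₀ + η * t) ^ 2 * b t) / (3 * κ / (2 * (M : ℝ) ^ 2) * ‖U t‖) := by gcongr
      _ = _ := by field_simp; ring
  have hcard : (Fintype.card (Fin K × Fin J) : ℝ) = (K * J : ℕ) := by simp
  have D : Dynamics x (fun t => coords v (e t)) η g L (g / 16) (k₀, j₀) T :=
    { step := fun t _ q => hxstep t q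
      eta_pos := hη
      gap_pos := hg
      gap_le := hgL
      start := hstart
      gap := hgap
      bound := hL
      budget_le := le_rfl
      eta_le := by rw [hcard]; exact hηg }
  have hcoords : ∀ (u : Fin K → EuclideanSpace ℝ (Fin d)) (_ : ∀ k, ‖u k‖ = 1)
      (w : ExpertWeights J d) q, |coords u w q| ≤ ‖w‖ := fun u hu w q => by
    refine (abs_real_inner_le_norm _ _).trans ?_
    rw [hu, mul_one]
    exact norm_filter_le _ _
  have hrate : Dynamics.rate (Fin K × Fin J) g L = g ^ 2 / (16 * L ^ 2 * (K * J : ℕ)) := by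
    rw [Dynamics.rate, hcard]
  have hbd := fun t (ht : t ≤ T) => D.bounds (Q := 4 * (M : ℝ) ^ 2 / (3 * κ)) (B := B) (s₀ := σ₀)
    (b := b) hb0 hσ (by positivity)
    (fun t ht q hpos => (hcoords v hv.1 _ q).trans (herr t ht hpos)) hB hε hεg
    (by rw [hrate]; exact hεr) hbudget ht
  obtain ⟨h1, h2, h3⟩ := hbd T le_rfl
  refine ⟨?_, h2, fun q => ?_⟩
  · refine le_trans ?_ h1
    have : ε * (η * T) ≤ Dynamics.rate (Fin K × Fin J) g L * (η * T) := by
      rw [hrate]; gcongr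
    linarith
  · have hsum : ∀ t ≤ T, |coords c ((s t).2 m) q| ≤ L + ∑ i ∈ Finset.range t,
        η * (4 * (M : ℝ) ^ 2 / (3 * κ) * (b i * (σ₀ + η * i) ^ 2) / √(∑ q, x i q ^ 4)) := by
      intro t
      induction t with
      | zero => intro _; simpa [hs, train] using hLc q
      | succ t ih =>
        intro ht
        have ih := ih (by omega)
        rw [hcstep, Finset.sum_range_succ, ← add_assoc]
        refine (abs_add_le _ _).trans (add_le_add ih ?_)
        rw [abs_mul, abs_of_pos hη]
        have hpos : 0 < √(∑ q, x t q ^ 4) := by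
          have h4 := (hbd t (by omega)).1
          have h5 := Dynamics.sq_le_norm (x t) (k₀, j₀)
          have h6 : 0 ≤ Dynamics.rate (Fin K × Fin J) g L * η * t := by
            have := Dynamics.rate_pos (L := L) (k₀, j₀) hg (hg.trans_le hgL)
            positivity
          have h7 : 0 < x t (k₀, j₀) := by linarith
          exact lt_of_lt_of_le (by positivity) h5
        have := (hcoords c hc1 (e t) q).trans (herr t (by omega) hpos)
        gcongr
    have h4 := hsum T le_rfl
    have h5 : 2 * L ≤ 4 * L ^ 2 / g := by
      rw [le_div_iff₀ hg]; nlinarith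
    linarith

end Trajectory

/-! ### Gaussian estimates -/

section Gaussian

variable {ι : Type} [Fintype ι]

instance (s : ℝ) : IsProbabilityMeasure (isoGaussian ι s) :=
  Measure.isProbabilityMeasure_map (by fun_prop)

lemma map_inner_stdGaussian (u : EuclideanSpace ℝ ι) :
    (stdGaussian (EuclideanSpace ℝ ι)).map (fun w => inner ℝ w u) =
      (gaussianReal 0 1).map (fun x => ‖u‖ * x) := by
  have h : (fun w : EuclideanSpace ℝ ι => inner ℝ w u) = innerSL ℝ u := by
    ext w; rw [real_inner_comm]; rfl
  rw [h, IsGaussian.map_eq_gaussianReal, integral_strongDual_stdGaussian,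
    variance_dual_stdGaussian, gaussianReal_map_const_mul, mul_zero, mul_one, innerSL_apply_norm]
  congr 1
  ext
  simp

/-- Linear functionals of an isotropic Gaussian vector. -/
lemma map_inner_isoGaussian (s : ℝ) (u : EuclideanSpace ℝ ι) :
    (isoGaussian ι s).map (fun w => inner ℝ w u) =
      (gaussianReal 0 1).map (fun x => s * ‖u‖ * x) := by
  have h : (fun w : EuclideanSpace ℝ ι => inner ℝ w u) ∘ (fun g => s • g) =
      (fun x => s * x) ∘ fun g => inner ℝ g u := by
    ext g; simp [inner_smul_left]
  rw [isoGaussian, Measure.map_map (by fun_prop) (by fun_prop), h,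
    ← Measure.map_map (by fun_prop) (by fun_prop), map_inner_stdGaussian,
    Measure.map_map (by fun_prop) (by fun_prop)]
  congr 1
  ext x
  simp [mul_assoc]

lemma lintegral_inner_isoGaussian (s : ℝ) (u : EuclideanSpace ℝ ι) {f : ℝ → ENNReal}
    (hf : Measurable f) :
    ∫⁻ w, f (inner ℝ w u) ∂isoGaussian ι s = ∫⁻ x, f (s * ‖u‖ * x) ∂gaussianReal 0 1 := by
  rw [← lintegral_map (f := f) hf (by fun_prop : Measurable fun w => inner ℝ w u),
    map_inner_isoGaussian, lintegral_map hf (by fun_prop)]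

lemma measure_inner_isoGaussian (s : ℝ) (u : EuclideanSpace ℝ ι) {t : Set ℝ}
    (ht : MeasurableSet t) :
    isoGaussian ι s {w | inner ℝ w u ∈ t} = gaussianReal 0 1 {x | s * ‖u‖ * x ∈ t} := by
  have h1 : isoGaussian ι s {w | inner ℝ w u ∈ t} =
      (isoGaussian ι s).map (fun w => inner ℝ w u) t := by
    rw [Measure.map_apply (by fun_prop) ht]; rfl
  rw [h1, map_inner_isoGaussian, Measure.map_apply (by fun_prop) ht]
  rfl

/-- Isotropic Gaussian laws are symmetric. -/
lemma map_neg_isoGaussian (s : ℝ) : (isoGaussian ι s).map (fun w => -w) = isoGaussian ι s := by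
  have h : (fun w : EuclideanSpace ℝ ι => -w) ∘ (fun g => s • g) =
      (fun g => s • g) ∘ LinearIsometryEquiv.neg ℝ := by
    ext g; simp
  rw [isoGaussian, Measure.map_map (by fun_prop) (by fun_prop), h,
    ← Measure.map_map (by fun_prop) (by fun_prop), stdGaussian_map]

/-- The sixth moment of the standard Gaussian law. -/
def sixthMoment : ℝ := ∫ x, x ^ 6 ∂gaussianReal 0 1

lemma sixthMoment_nonneg : 0 ≤ sixthMoment := integral_nonneg fun x => by positivity

lemma lintegral_pow_six : ∫⁻ x, ENNReal.ofReal (x ^ 6) ∂gaussianReal 0 1 =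
    ENNReal.ofReal sixthMoment := by
  rw [sixthMoment, ofReal_integral_eq_lintegral_ofReal _
    (Filter.Eventually.of_forall fun x => by positivity)]
  have h : MemLp (id : ℝ → ℝ) (6 : ℕ) (gaussianReal 0 1) := memLp_id_gaussianReal' _ (by simp)
  have := h.integrable_norm_pow (by norm_num)
  refine this.congr (Filter.Eventually.of_forall fun x => ?_)
  simp only [id, Real.norm_eq_abs]
  exact Even.pow_abs (by decide) x

lemma lintegral_sq_gaussian : ∫⁻ x, ENNReal.ofReal (x ^ 2) ∂gaussianReal 0 1 = 1 := by
  have h : MemLp (id : ℝ → ℝ) 2 (gaussianReal 0 1) := memLp_id_gaussianReal' _ (by simp)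
  rw [← ofReal_integral_eq_lintegral_ofReal (f := fun x : ℝ => x ^ 2) h.integrable_sq
    (Filter.Eventually.of_forall fun x => by positivity)]
  have h1 := variance_eq_integral (μ := gaussianReal 0 1) (X := id) (by fun_prop)
  rw [variance_id_gaussianReal] at h1
  simp only [id, integral_id_gaussianReal, sub_zero] at h1
  rw [← h1]
  simp

lemma lintegral_inner_pow_six (s : ℝ) (u : EuclideanSpace ℝ ι) :
    ∫⁻ w, ENNReal.ofReal (inner ℝ w u ^ 6) ∂isoGaussian ι s =
      ENNReal.ofReal (sixthMoment * (s * ‖u‖) ^ 6) := by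
  rw [lintegral_inner_isoGaussian (f := fun x => ENNReal.ofReal (x ^ 6)) _ _ (by fun_prop)]
  have : ∀ x : ℝ, ENNReal.ofReal ((s * ‖u‖ * x) ^ 6) =
      ENNReal.ofReal ((s * ‖u‖) ^ 6) * ENNReal.ofReal (x ^ 6) := fun x => by
    rw [mul_pow, ENNReal.ofReal_mul (by positivity)]
  simp_rw [this]
  rw [lintegral_const_mul _ (by fun_prop), lintegral_pow_six, mul_comm sixthMoment,
    ENNReal.ofReal_mul (by positivity)]

lemma lintegral_inner_sq (s : ℝ) (u : EuclideanSpace ℝ ι) :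
    ∫⁻ w, ENNReal.ofReal (inner ℝ w u ^ 2) ∂isoGaussian ι s =
      ENNReal.ofReal ((s * ‖u‖) ^ 2) := by
  rw [lintegral_inner_isoGaussian (f := fun x => ENNReal.ofReal (x ^ 2)) _ _ (by fun_prop)]
  have : ∀ x : ℝ, ENNReal.ofReal ((s * ‖u‖ * x) ^ 2) =
      ENNReal.ofReal ((s * ‖u‖) ^ 2) * ENNReal.ofReal (x ^ 2) := fun x => by
    rw [mul_pow, ENNReal.ofReal_mul (by positivity)]
  simp_rw [this]
  rw [lintegral_const_mul _ (by fun_prop), lintegral_sq_gaussian, mul_one]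

lemma sum_pow_six_le {κ : Type*} (s : Finset κ) {f : κ → ℝ} (hf : ∀ i ∈ s, 0 ≤ f i) :
    (∑ i ∈ s, f i) ^ 6 ≤ (s.card : ℝ) ^ 5 * ∑ i ∈ s, f i ^ 6 := by
  rcases s.eq_empty_or_nonempty with rfl | hs
  · simp
  have h := pow_sum_div_card_le_sum_pow (s := s) hf 5
  have hc : (0 : ℝ) < s.card := by exact_mod_cast hs.card_pos
  rwa [div_le_iff₀' (by positivity)] at h

lemma lintegral_norm_pow_six_le (s : ℝ) :
    ∫⁻ w, ENNReal.ofReal (‖w‖ ^ 6) ∂isoGaussian ι s ≤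
      ENNReal.ofReal ((Fintype.card ι : ℝ) ^ 3 * (sixthMoment * s ^ 6)) := by
  classical
  have h1 : ∀ w : EuclideanSpace ℝ ι, ‖w‖ ^ 6 ≤ (Fintype.card ι : ℝ) ^ 2 *
      ∑ i, inner ℝ w (EuclideanSpace.single i 1) ^ 6 := fun w => by
    have h2 : ‖w‖ ^ 6 = (∑ i, w i ^ 2) ^ 3 := by
      rw [← EuclideanSpace.real_norm_sq_eq]; ring
    have h3 : ∑ i, inner ℝ w (EuclideanSpace.single i 1) ^ 6 = ∑ i, (w i ^ 2) ^ 3 := by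
      refine Finset.sum_congr rfl fun i _ => ?_
      simp [EuclideanSpace.inner_single_right, ← pow_mul]
    rw [h2, h3]
    rcases (Finset.univ : Finset ι).eq_empty_or_nonempty with h | h
    · simp [h]
    · have h4 := pow_sum_div_card_le_sum_pow (s := Finset.univ) (f := fun i => w i ^ 2)
        (fun i _ => by positivity) 2
      have : (0 : ℝ) < (Finset.univ : Finset ι).card := by exact_mod_cast h.card_pos
      rwa [div_le_iff₀' (by positivity), Finset.card_univ] at h4
  calc _ ≤ ∫⁻ w, ∑ i, ENNReal.ofReal ((Fintype.card ι : ℝ) ^ 2) *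
        ENNReal.ofReal (inner ℝ w (EuclideanSpace.single i 1) ^ 6) ∂isoGaussian ι s := by
        refine lintegral_mono fun w => (ENNReal.ofReal_le_ofReal (h1 w)).trans (le_of_eq ?_)
        rw [ENNReal.ofReal_mul (by positivity), ENNReal.ofReal_sum_of_nonneg
          (fun i _ => by positivity), Finset.mul_sum]
    _ = _ := by
        rw [lintegral_finsetSum _ (fun i _ => by fun_prop)]
        have : ∀ i : ι, ∫⁻ w, ENNReal.ofReal ((Fintype.card ι : ℝ) ^ 2) *
            ENNReal.ofReal (inner ℝ w (EuclideanSpace.single i 1) ^ 6) ∂isoGaussian ι s =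
            ENNReal.ofReal ((Fintype.card ι : ℝ) ^ 2) * ENNReal.ofReal (sixthMoment * s ^ 6) :=
          fun i => by
            rw [lintegral_const_mul _ (by fun_prop), lintegral_inner_pow_six]
            simp
        simp_rw [this]
        rw [Finset.sum_const, Finset.card_univ, nsmul_eq_mul, ← ENNReal.ofReal_natCast,
          ← ENNReal.ofReal_mul (by positivity), ← ENNReal.ofReal_mul (by positivity)]
        congr 1
        ring

lemma lintegral_norm_sq (s : ℝ) :
    ∫⁻ w, ENNReal.ofReal (‖w‖ ^ 2) ∂isoGaussian ι s =
      ENNReal.ofReal ((Fintype.card ι : ℝ) * s ^ 2) := by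
  classical
  have h1 : ∀ w : EuclideanSpace ℝ ι, ENNReal.ofReal (‖w‖ ^ 2) =
      ∑ i, ENNReal.ofReal (inner ℝ w (EuclideanSpace.single i 1) ^ 2) := fun w => by
    rw [EuclideanSpace.real_norm_sq_eq, ENNReal.ofReal_sum_of_nonneg (fun i _ => by positivity)]
    simp [EuclideanSpace.inner_single_right]
  simp_rw [h1]
  rw [lintegral_finsetSum _ (fun i _ => by fun_prop)]
  simp_rw [lintegral_inner_sq, PiLp.norm_single, norm_one, mul_one]
  rw [Finset.sum_const, Finset.card_univ, nsmul_eq_mul, ← ENNReal.ofReal_natCast,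
    ← ENNReal.ofReal_mul (by positivity)]

lemma gaussianReal_Icc_le (a b : ℝ) : gaussianReal 0 1 (Set.Icc a b) ≤ ENNReal.ofReal (b - a) := by
  rw [gaussianReal_apply _ (by norm_num)]
  calc _ ≤ ∫⁻ x in Set.Icc a b, 1 := by
        refine lintegral_mono fun x => ?_
        rw [gaussianPDF, ← ENNReal.ofReal_one]
        refine ENNReal.ofReal_le_ofReal ?_
        rw [gaussianPDFReal]
        refine mul_le_one₀ ?_ (by positivity) ?_
        · apply inv_le_one_of_one_le₀
          rw [Real.one_le_sqrt]
          have := Real.pi_gt_three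
          simp only [NNReal.coe_one]
          linarith
        · rw [Real.exp_le_one_iff]
          have : 0 ≤ (x - 0) ^ 2 / (2 * ((1 : NNReal) : ℝ)) := by positivity
          rw [neg_div]
          linarith
    _ = _ := by simp

lemma gaussianReal_Iio_le {δ : ℝ} (hδ : δ ≤ 1 / 4) :
    gaussianReal 0 1 (Set.Iio δ) ≤ ENNReal.ofReal (3 / 4) := by
  have h1 : gaussianReal 0 1 (Set.Iio 0) = gaussianReal 0 1 (Set.Ioi 0) := by
    have h := gaussianReal_map_neg (μ := 0) (v := 1)
    rw [neg_zero] at h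
    conv_lhs => rw [← h]
    rw [Measure.map_apply (by fun_prop) measurableSet_Iio]
    congr 1
    ext x
    simp
  have h2 : gaussianReal 0 1 (Set.Iio 0) ≤ ENNReal.ofReal (1 / 2) := by
    have h3 : gaussianReal 0 1 (Set.Iio 0) + gaussianReal 0 1 (Set.Ioi 0) ≤ 1 := by
      rw [← measure_union _ measurableSet_Ioi]
      · exact prob_le_one
      · rw [Set.disjoint_left]
        intro x hx hx'
        exact lt_asymm (Set.mem_Iio.1 hx) (Set.mem_Ioi.1 hx')
    rw [← h1, ← two_mul] at h3
    rw [one_div, ENNReal.ofReal_inv_of_pos (by norm_num), ENNReal.ofReal_ofNat,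
      ENNReal.le_inv_iff_mul_le, mul_comm]
    exact h3
  calc gaussianReal 0 1 (Set.Iio δ) ≤ gaussianReal 0 1 (Set.Iio 0 ∪ Set.Icc 0 (1 / 4)) := by
        refine measure_mono fun x hx => ?_
        rcases lt_or_ge x 0 with h | h
        · exact Or.inl h
        · exact Or.inr ⟨h, (le_of_lt hx).trans hδ⟩
    _ ≤ ENNReal.ofReal (1 / 2) + ENNReal.ofReal (1 / 4 - 0) :=
        (measure_union_le _ _).trans (add_le_add h2 (gaussianReal_Icc_le _ _))
    _ = ENNReal.ofReal (3 / 4) := by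
        rw [← ENNReal.ofReal_add (by norm_num) (by norm_num)]
        norm_num

/-- Small-ball estimate for a linear functional. -/
lemma measure_abs_inner_le {s δ : ℝ} (hs : 0 < s) {u : EuclideanSpace ℝ ι} (hu : 1 ≤ ‖u‖)
    (hδ : 0 ≤ δ) :
    isoGaussian ι s {w | |inner ℝ w u| ≤ δ * s} ≤ ENNReal.ofReal (2 * δ) := by
  have h := measure_inner_isoGaussian s u (t := {y : ℝ | |y| ≤ δ * s})
    (measurableSet_le (by fun_prop) (by fun_prop))
  simp only [Set.mem_ofPred_eq] at h
  rw [h]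
  refine le_trans (measure_mono ?_) ((gaussianReal_Icc_le (-δ) δ).trans (le_of_eq (by ring_nf)))
  intro x hx
  rw [Set.mem_ofPred_eq, abs_mul, abs_of_pos (by positivity)] at hx
  rw [Set.mem_Icc, ← abs_le]
  by_contra hlt
  push Not at hlt
  have : s * 1 * δ < s * ‖u‖ * |x| := by
    have : s * 1 ≤ s * ‖u‖ := by gcongr
    have h3 : 0 < |x| := hδ.trans_lt hlt
    nlinarith
  linarith

/-- The responses to an orthonormal family are independent standard Gaussians. -/
lemma measure_forall_inner_lt {κ : Type*} [Fintype κ] {s δ : ℝ} (hs : 0 < s) (hδ : δ ≤ 1 / 4)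
    {u : κ → EuclideanSpace ℝ ι} (hu : Orthonormal ℝ u) :
    isoGaussian ι s {w | ∀ j, inner ℝ w (u j) < δ * s} ≤
      ENNReal.ofReal (3 / 4) ^ Fintype.card κ := by
  have hind : iIndepFun (fun j (w : EuclideanSpace ℝ ι) => inner ℝ (u j) w)
      (stdGaussian (EuclideanSpace ℝ ι)) := by
    apply HasGaussianLaw.iIndepFun_of_covariance_eq_zero
    · let L : EuclideanSpace ℝ ι →L[ℝ] κ → ℝ := ContinuousLinearMap.pi fun j => innerSL ℝ (u j)
      exact (IsGaussian.hasGaussianLaw_id (μ := stdGaussian (EuclideanSpace ℝ ι))).map L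
    · intro i j hij
      have h := covarianceBilin_apply_eq_cov (μ := stdGaussian (EuclideanSpace ℝ ι))
        IsGaussian.memLp_two_id (u i) (u j)
      rw [← h, covarianceBilin_stdGaussian, innerSL_apply_apply]
      exact hu.2 hij
  rw [isoGaussian, Measure.map_apply (by fun_prop)]
  · have h1 : (fun g : EuclideanSpace ℝ ι => s • g) ⁻¹' {w | ∀ j, inner ℝ w (u j) < δ * s} =
        ⋂ j ∈ Finset.univ, (fun w => inner ℝ (u j) w) ⁻¹' Set.Iio δ := by
      ext g
      simp only [Set.mem_preimage, Set.mem_ofPred_eq, inner_smul_left, conj_trivial,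
        Finset.mem_univ, Set.iInter_true, Set.mem_iInter, Set.mem_Iio]
      refine forall_congr' fun j => ?_
      rw [mul_comm δ s, mul_lt_mul_iff_right₀ hs, real_inner_comm]
    rw [h1, hind.measure_inter_preimage_eq_mul _ fun j _ => measurableSet_Iio]
    calc _ ≤ ∏ _j : κ, ENNReal.ofReal (3 / 4) := by
          refine Finset.prod_le_prod' fun j _ => ?_
          have h2 := map_inner_stdGaussian (u j)
          rw [hu.1 j] at h2
          simp only [one_mul, Measure.map_id'] at h2
          have h3 : (fun w => inner ℝ (u j) w) = fun w => inner ℝ w (u j) := by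
            ext w; rw [real_inner_comm]
          rw [← Measure.map_apply (by fun_prop) measurableSet_Iio, h3, h2]
          exact gaussianReal_Iio_le hδ
      _ = _ := by simp
  · simp only [Set.ofPred_forall]
    exact MeasurableSet.iInter fun j => measurableSet_lt (by fun_prop) (by fun_prop)

end Gaussian

/-! ### Moments of the data distribution -/

section Uniform

lemma uniformOn_signs : uniformOn ({1, -1} : Set ℝ) =
    (2 : ENNReal)⁻¹ • (Measure.dirac 1 + Measure.dirac (-1)) := by
  have h2 : ({1, -1} : Set ℝ) = {1} ∪ {-1} := rfl
  have hd : Disjoint ({1} : Set ℝ) {-1} := by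
    rw [Set.disjoint_singleton]; norm_num
  have hcount : Measure.count ({1, -1} : Set ℝ) = 2 := by
    rw [h2, measure_union hd (measurableSet_singleton _)]
    simp only [Measure.count_singleton]
    norm_num
  rw [uniformOn, ProbabilityTheory.cond, hcount, h2, Measure.restrict_union hd (measurableSet_singleton _),
    Measure.restrict_singleton, Measure.restrict_singleton, Measure.count_singleton,
    Measure.count_singleton, one_smul, one_smul]

instance : IsProbabilityMeasure (uniformOn ({1, -1} : Set ℝ)) :=
  isProbabilityMeasure_uniformOn (by simp) (by simp)

lemma integral_signs (f : ℝ → ℝ) :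
    ∫ y, f y ∂uniformOn ({1, -1} : Set ℝ) = (f 1 + f (-1)) / 2 := by
  rw [uniformOn_signs, integral_smul_measure,
    integral_add_measure (integrable_dirac (by simp)) (integrable_dirac (by simp)),
    integral_dirac, integral_dirac]
  simp
  ring

lemma ae_signs : ∀ᵐ y ∂uniformOn ({1, -1} : Set ℝ), y = 1 ∨ y = -1 := by
  have h : uniformOn ({1, -1} : Set ℝ) ({1, -1} : Set ℝ)ᶜ = 0 := by
    rw [uniformOn_eq_zero_iff (by simp)]
    simp
  filter_upwards [compl_mem_ae_iff.2 h] with y hy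
  simpa using hy

/-- Distinct ordered pairs. -/
abbrev distinctPairs (K : ℕ) : Set (Fin K × Fin K) := {p | p.1 ≠ p.2}

variable {K : ℕ}

lemma isProbabilityMeasure_pairs (hK : 2 ≤ K) :
    IsProbabilityMeasure (uniformOn (distinctPairs K)) := by
  refine isProbabilityMeasure_uniformOn (Set.toFinite _) ⟨(⟨0, by omega⟩, ⟨1, by omega⟩), ?_⟩
  simp [distinctPairs]

lemma pairs_real_singleton (p : Fin K × Fin K) :
    (uniformOn (distinctPairs K)).real {p} =
      if p.1 ≠ p.2 then ((K : ℝ) * (K - 1))⁻¹ else 0 := by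
  have hc : (Measure.count (distinctPairs K)).toReal = (K : ℝ) * (K - 1) := by
    have h1 : distinctPairs K = ↑(Finset.univ.offDiag : Finset (Fin K × Fin K)) := by
      ext p; simp [distinctPairs]
    rw [h1, Measure.count_apply_finset]
    simp only [Finset.offDiag_card, Finset.card_univ, Fintype.card_fin, ENNReal.toReal_natCast]
    rw [Nat.cast_sub (Nat.le_mul_self K)]
    push_cast
    ring
  rw [measureReal_def, uniformOn, cond_apply (Set.toFinite _).measurableSet, ENNReal.toReal_mul,
    ENNReal.toReal_inv, hc]
  split_ifs with h
  · have : distinctPairs K ∩ {p} = {p} := by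
      rw [Set.inter_eq_right, Set.singleton_subset_iff]; exact h
    rw [this, Measure.count_singleton]
    simp
  · have : distinctPairs K ∩ {p} = ∅ := by
      rw [Set.inter_singleton_eq_empty]; exact h
    rw [this]
    simp

lemma ae_pairs : ∀ᵐ p ∂uniformOn (distinctPairs K), p.1 ≠ p.2 := by
  have h : uniformOn (distinctPairs K) (distinctPairs K)ᶜ = 0 := by
    rw [uniformOn_eq_zero_iff (Set.toFinite _)]
    simp
  filter_upwards [compl_mem_ae_iff.2 h] with y hy
  simpa using hy

lemma integral_pairs_fst (hK : 2 ≤ K) (f : Fin K → ℝ) :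
    ∫ p, f p.1 ∂uniformOn (distinctPairs K) = (K : ℝ)⁻¹ * ∑ k, f k := by
  have := isProbabilityMeasure_pairs hK
  have hK1 : (1 : ℝ) < K := by exact_mod_cast hK
  rw [integral_fintype (Integrable.of_finite), Fintype.sum_prod_type, Finset.mul_sum]
  refine Finset.sum_congr rfl fun k _ => ?_
  simp only [pairs_real_singleton, smul_eq_mul, ← Finset.sum_mul]
  congr 1
  rw [Finset.sum_ite, Finset.sum_const_zero, add_zero, Finset.sum_const, nsmul_eq_mul]
  have : (Finset.univ.filter fun x : Fin K => k ≠ x) = Finset.univ.erase k := by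
    ext x; simp [eq_comm]
  rw [this, Finset.card_erase_of_mem (Finset.mem_univ k), Finset.card_univ, Fintype.card_fin,
    Nat.cast_sub (by omega)]
  have : (K : ℝ) - 1 ≠ 0 := by linarith
  push_cast
  field_simp

end Uniform

/-- The standing assumptions on the data distribution. -/
structure IsDataModel {K P d : ℕ} (C₁ C₂ : ℝ) (v c : Fin K → EuclideanSpace ℝ (Fin d))
    (Dα Dβ Dγ : Measure ℝ) (place : Measure ((Fin 3 → Fin P) × Signal K)) : Prop where
  two_le : 2 ≤ K
  pos : 0 < C₁
  orthonormal : Orthonormal ℝ (Sum.elim v c)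
  prob_α : IsProbabilityMeasure Dα
  prob_β : IsProbabilityMeasure Dβ
  prob_γ : IsProbabilityMeasure Dγ
  supp_α : ∀ᵐ s ∂Dα, C₁ ≤ s ∧ s ≤ C₂
  supp_β : ∀ᵐ s ∂Dβ, C₁ ≤ s ∧ s ≤ C₂
  supp_γ : ∀ᵐ s ∂Dγ, C₁ ≤ s ∧ s ≤ C₂
  placement : IsPlacement Dα Dβ Dγ place

/-- Properties of the latent variables that hold almost surely. -/
structure IsRegular {K P : ℕ} (C₁ C₂ : ℝ) (z : (Fin 3 → Fin P) × Signal K) : Prop where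
  inj : Function.Injective z.1
  ne : z.2.1.1 ≠ z.2.1.2
  sign_y : z.2.2.1 = 1 ∨ z.2.2.1 = -1
  sign_e : z.2.2.2.1 = 1 ∨ z.2.2.2.1 = -1
  alpha : C₁ ≤ z.2.2.2.2.1 ∧ z.2.2.2.2.1 ≤ C₂
  beta : C₁ ≤ z.2.2.2.2.2.1 ∧ z.2.2.2.2.2.1 ≤ C₂
  gamma : C₁ ≤ z.2.2.2.2.2.2 ∧ z.2.2.2.2.2.2 ≤ C₂

/-- Joint law of the latent variables and the noise vectors of an example. -/
abbrev latentLaw {K P : ℕ} (d : ℕ) (σp : ℝ) (place : Measure ((Fin 3 → Fin P) × Signal K)) :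
    Measure (((Fin 3 → Fin P) × Signal K) × Input P d) :=
  place.prod (Measure.pi fun _ : Fin P => isoGaussian (Fin d) (σp / √(d : ℝ)))

section Data

variable {K P d : ℕ} {C₁ C₂ σp : ℝ} {v c : Fin K → EuclideanSpace ℝ (Fin d)}
  {Dα Dβ Dγ : Measure ℝ} {place : Measure ((Fin 3 → Fin P) × Signal K)}

lemma measurable_assemble (v c : Fin K → EuclideanSpace ℝ (Fin d)) :
    Measurable (assemble (P := P) v c) := by
  unfold assemble
  refine Measurable.prodMk (measurable_pi_lambda _ fun p => ?_) (by fun_prop)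
  have hv : ∀ u : Fin K → EuclideanSpace ℝ (Fin d), Measurable u := fun u => measurable_of_finite u
  have hv1 := hv v
  have hc1 := hv c
  have hq : ∀ i : Fin 3, MeasurableSet
      {z : ((Fin 3 → Fin P) × Signal K) × Input P d | p = z.1.1 i} := fun i =>
    measurableSet_eq_fun measurable_const (by fun_prop)
  refine Measurable.ite (hq 0) (by fun_prop) ?_
  refine Measurable.ite (hq 1) (by fun_prop) ?_
  exact Measurable.ite (hq 2) (by fun_prop) (by fun_prop)

lemma IsDataModel.prob_signal (hD : IsDataModel C₁ C₂ v c Dα Dβ Dγ place) :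
    IsProbabilityMeasure (signalLaw K Dα Dβ Dγ) := by
  have := hD.prob_α
  have := hD.prob_β
  have := hD.prob_γ
  have := isProbabilityMeasure_pairs hD.two_le
  unfold signalLaw
  infer_instance

lemma IsDataModel.prob_place (hD : IsDataModel C₁ C₂ v c Dα Dβ Dγ place) :
    IsProbabilityMeasure place := by
  have h1 := hD.prob_signal
  constructor
  have h2 : (place.map Prod.snd) Set.univ = 1 := by
    rw [hD.placement.law_signal]
    exact h1.measure_univ
  rwa [Measure.map_apply measurable_snd MeasurableSet.univ, Set.preimage_univ] at h2

lemma IsDataModel.prob_data (hD : IsDataModel C₁ C₂ v c Dα Dβ Dγ place) :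
    IsProbabilityMeasure (dataLaw v c σp place) := by
  have := hD.prob_place
  exact Measure.isProbabilityMeasure_map (measurable_assemble v c).aemeasurable

lemma IsDataModel.ae_regular (hD : IsDataModel C₁ C₂ v c Dα Dβ Dγ place) :
    ∀ᵐ z ∂place, IsRegular C₁ C₂ z := by
  have := hD.prob_α
  have := hD.prob_β
  have := hD.prob_γ
  have := isProbabilityMeasure_pairs hD.two_le
  have hs : Measure.QuasiMeasurePreserving (Prod.snd : (Fin 3 → Fin P) × Signal K → Signal K)
      place (signalLaw K Dα Dβ Dγ) :=
    ⟨measurable_snd, by rw [hD.placement.law_signal]⟩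
  unfold signalLaw at hs
  have q1 := Measure.quasiMeasurePreserving_snd.comp hs
  have q2 := Measure.quasiMeasurePreserving_snd.comp q1
  have q3 := Measure.quasiMeasurePreserving_snd.comp q2
  have q4 := Measure.quasiMeasurePreserving_snd.comp q3
  filter_upwards [hD.placement.distinct,
    (Measure.quasiMeasurePreserving_fst.comp hs).ae ae_pairs,
    (Measure.quasiMeasurePreserving_fst.comp q1).ae ae_signs,
    (Measure.quasiMeasurePreserving_fst.comp q2).ae ae_signs,
    (Measure.quasiMeasurePreserving_fst.comp q3).ae hD.supp_α,
    (Measure.quasiMeasurePreserving_fst.comp q4).ae hD.supp_β,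
    (Measure.quasiMeasurePreserving_snd.comp q4).ae hD.supp_γ] with z h1 h2 h3 h4 h5 h6 h7
  exact ⟨h1, h2, h3, h4, h5, h6, h7⟩

lemma IsDataModel.ae_latent (hD : IsDataModel C₁ C₂ v c Dα Dβ Dγ place) :
    ∀ᵐ z ∂latentLaw d σp place, IsRegular C₁ C₂ z.1 := by
  have := hD.prob_place
  exact Measure.quasiMeasurePreserving_fst.ae hD.ae_regular

lemma IsDataModel.ae_label (hD : IsDataModel C₁ C₂ v c Dα Dβ Dγ place) :
    ∀ᵐ z ∂dataLaw v c σp place, |z.2| ≤ 1 := by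
  rw [dataLaw, ae_map_iff (measurable_assemble v c).aemeasurable
    (measurableSet_le (by fun_prop) (by fun_prop))]
  filter_upwards [hD.ae_latent] with z hz
  rcases hz.sign_y with h | h <;> simp [assemble, h]

lemma IsDataModel.norm_v (hD : IsDataModel C₁ C₂ v c Dα Dβ Dγ place) (k : Fin K) : ‖v k‖ = 1 :=
  hD.orthonormal.1 (Sum.inl k)

lemma IsDataModel.norm_c (hD : IsDataModel C₁ C₂ v c Dα Dβ Dγ place) (k : Fin K) : ‖c k‖ = 1 :=
  hD.orthonormal.1 (Sum.inr k)

lemma IsDataModel.norm_patch_le (hD : IsDataModel C₁ C₂ v c Dα Dβ Dγ place)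
    {z : ((Fin 3 → Fin P) × Signal K) × Input P d} (hz : IsRegular C₁ C₂ z.1) (p : Fin P) :
    ‖(assemble v c z).1 p‖ ^ 6 ≤ C₂ ^ 6 + ‖z.2 p‖ ^ 6 := by
  have hC := hD.pos
  obtain ⟨⟨q, ⟨k, k'⟩, y, e, α, β, γ⟩, ξ⟩ := z
  obtain ⟨-, -, hy, he, hα, hβ, hγ⟩ := hz
  simp only at hy he hα hβ hγ ⊢
  have hy1 : |y| = 1 := by rcases hy with h | h <;> simp [h]
  have he1 : |e| = 1 := by rcases he with h | h <;> simp [h]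
  have hsig : ∀ s : ℝ, C₁ ≤ s ∧ s ≤ C₂ → |s| ^ 6 ≤ C₂ ^ 6 + ‖ξ p‖ ^ 6 := fun s hs => by
    have h1 : |s| ^ 6 ≤ C₂ ^ 6 := by
      rw [abs_of_pos (by linarith)]
      exact pow_le_pow_left₀ (by linarith) hs.2 6
    have : 0 ≤ ‖ξ p‖ ^ 6 := by positivity
    linarith
  simp only [assemble]
  split_ifs
  · rw [norm_smul, hD.norm_v, Real.norm_eq_abs, abs_mul, hy1, one_mul, mul_one]
    exact hsig α hα
  · rw [norm_smul, hD.norm_c, Real.norm_eq_abs, mul_one]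
    exact hsig β hβ
  · rw [norm_smul, hD.norm_v, Real.norm_eq_abs, abs_mul, he1, one_mul, mul_one]
    exact hsig γ hγ
  · have : 0 ≤ C₂ ^ 6 := by positivity
    linarith

/-- Bound for the sixth moment of the norm of a patch. -/
def patchMoment (C₂ σp : ℝ) : ℝ := C₂ ^ 6 + sixthMoment * σp ^ 6

lemma patchMoment_nonneg (C₂ σp : ℝ) : 0 ≤ patchMoment C₂ σp := by
  have := sixthMoment_nonneg
  unfold patchMoment
  positivity

lemma IsDataModel.lintegral_patch_le (hD : IsDataModel C₁ C₂ v c Dα Dβ Dγ place) (p : Fin P) :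
    ∫⁻ z, ENNReal.ofReal (‖z.1 p‖ ^ 6) ∂dataLaw v c σp place ≤
      ENNReal.ofReal (patchMoment C₂ σp) := by
  have := hD.prob_place
  rw [dataLaw, lintegral_map (by fun_prop) (measurable_assemble v c)]
  calc _ ≤ ∫⁻ z, (ENNReal.ofReal (C₂ ^ 6) + ENNReal.ofReal (‖z.2 p‖ ^ 6))
        ∂latentLaw d σp place := by
        refine lintegral_mono_ae ?_
        filter_upwards [hD.ae_latent] with z hz
        rw [← ENNReal.ofReal_add (by positivity) (by positivity)]
        exact ENNReal.ofReal_le_ofReal (hD.norm_patch_le hz p)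
    _ = ENNReal.ofReal (C₂ ^ 6) +
        ∫⁻ w, ENNReal.ofReal (‖w‖ ^ 6) ∂isoGaussian (Fin d) (σp / √(d : ℝ)) := by
        rw [lintegral_add_left (by fun_prop), lintegral_const, measure_univ, mul_one]
        congr 1
        have hmp : MeasurePreserving
            (fun z : ((Fin 3 → Fin P) × Signal K) × Input P d => z.2 p)
            (latentLaw d σp place) (isoGaussian (Fin d) (σp / √(d : ℝ))) :=
          (measurePreserving_eval (fun _ : Fin P => isoGaussian (Fin d) (σp / √(d : ℝ))) p).comp
            measurePreserving_snd
        exact hmp.lintegral_comp (f := fun w => ENNReal.ofReal (‖w‖ ^ 6)) (by fun_prop)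
    _ ≤ ENNReal.ofReal (C₂ ^ 6) + ENNReal.ofReal (sixthMoment * σp ^ 6) := by
        gcongr
        refine (lintegral_norm_pow_six_le _).trans (ENNReal.ofReal_le_ofReal ?_)
        have h6 := sixthMoment_nonneg
        rcases Nat.eq_zero_or_pos d with hd | hd
        · subst hd; simp; positivity
        · have hd' : (0 : ℝ) < d := by exact_mod_cast hd
          have : √(d : ℝ) ^ 6 = (d : ℝ) ^ 3 := by
            rw [show (6 : ℕ) = 2 * 3 from rfl, pow_mul, Real.sq_sqrt hd'.le]
          rw [div_pow, this, Fintype.card_fin]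
          apply le_of_eq
          field_simp
    _ = _ := by
        have h6 := sixthMoment_nonneg
        rw [← ENNReal.ofReal_add (by positivity) (by positivity)]
        rfl

lemma measurable_triple (u₁ u₂ u₃ : EuclideanSpace ℝ (Fin d)) :
    Measurable fun z : Sample P d => triple z u₁ u₂ u₃ := by
  unfold triple
  fun_prop

lemma abs_triple_le {z : Sample P d} (hz : |z.2| ≤ 1) (u₁ u₂ u₃ : EuclideanSpace ℝ (Fin d)) :
    |triple z u₁ u₂ u₃| ≤ ‖u₁‖ * ‖u₂‖ * ‖u₃‖ * ∑ p, ‖z.1 p‖ ^ 3 := by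
  unfold triple
  rw [abs_mul, Finset.mul_sum]
  calc _ ≤ 1 * ∑ p, |inner ℝ u₁ (z.1 p) * inner ℝ u₂ (z.1 p) * inner ℝ u₃ (z.1 p)| := by
        gcongr
        exact Finset.abs_sum_le_sum_abs _ _
    _ ≤ _ := by
        rw [one_mul]
        refine Finset.sum_le_sum fun p _ => ?_
        rw [abs_mul, abs_mul]
        calc _ ≤ (‖u₁‖ * ‖z.1 p‖) * (‖u₂‖ * ‖z.1 p‖) * (‖u₃‖ * ‖z.1 p‖) := by
              gcongr <;> exact abs_real_inner_le_norm _ _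
          _ = _ := by ring

lemma IsDataModel.memLp_triple (hD : IsDataModel C₁ C₂ v c Dα Dβ Dγ place)
    (u₁ u₂ u₃ : EuclideanSpace ℝ (Fin d)) :
    MemLp (fun z => triple z u₁ u₂ u₃) 2 (dataLaw v c σp place) := by
  have hp : ∀ p : Fin P, MemLp (fun z : Sample P d => ‖z.1 p‖ ^ 3) 2 (dataLaw v c σp place) := by
    intro p
    rw [memLp_two_iff_integrable_sq (by fun_prop)]
    refine ⟨by fun_prop, ?_⟩
    rw [hasFiniteIntegral_iff_ofReal (Filter.Eventually.of_forall fun z => by positivity)]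
    refine lt_of_le_of_lt (le_trans (le_of_eq ?_) (hD.lintegral_patch_le (σp := σp) p))
      ENNReal.ofReal_lt_top
    refine lintegral_congr fun z => ?_
    rw [← pow_mul]
  have hs := (memLp_finsetSum Finset.univ fun p _ => hp p).const_mul (‖u₁‖ * ‖u₂‖ * ‖u₃‖)
  refine hs.mono (measurable_triple _ _ _).aestronglyMeasurable ?_
  filter_upwards [hD.ae_label] with z hz
  refine (abs_triple_le hz u₁ u₂ u₃).trans (le_of_eq ?_)
  rw [Real.norm_of_nonneg (by positivity)]

/-- The third-order tensor of the examples has the signal tensor as its expectation: the labels of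
the center patches, the signs of the feature noise and the Gaussian patches are symmetric. -/
lemma IsDataModel.integral_triple (hD : IsDataModel C₁ C₂ v c Dα Dβ Dγ place)
    (u₁ u₂ u₃ : EuclideanSpace ℝ (Fin d)) :
    ∫ z, triple z u₁ u₂ u₃ ∂dataLaw v c σp place =
      (∫ α, α ^ 3 ∂Dα) / K * signalTriple v u₁ u₂ u₃ := by
  have := hD.prob_α
  have := hD.prob_β
  have := hD.prob_γ
  have := hD.prob_place
  have := hD.prob_signal
  have := isProbabilityMeasure_pairs hD.two_le
  have hC := hD.pos
  set Ξ : EuclideanSpace ℝ (Fin d) → ℝ := fun x => inner ℝ u₁ x * inner ℝ u₂ x * inner ℝ u₃ x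
    with hΞ
  have hΞm : Measurable Ξ := by fun_prop
  have hΞs : ∀ (a : ℝ) x, Ξ (a • x) = a ^ 3 * Ξ x := fun a x => by
    simp only [hΞ, inner_smul_right]; ring
  -- the contribution of the three structured patches
  set F : Signal K → ℝ := fun s => s.2.1 * ((s.2.1 * s.2.2.2.1) ^ 3 * Ξ (v s.1.1) +
    s.2.2.2.2.1 ^ 3 * Ξ (c s.1.1) + (s.2.2.1 * s.2.2.2.2.2) ^ 3 * Ξ (v s.1.2)) with hF
  -- the contribution of the Gaussian patches
  set N : ((Fin 3 → Fin P) × Signal K) × Input P d → ℝ := fun z => z.1.2.2.1 * ∑ p,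
    if p = z.1.1 0 ∨ p = z.1.1 1 ∨ p = z.1.1 2 then 0 else Ξ (z.2 p) with hN
  have hsplit : ∀ᵐ z ∂latentLaw d σp place,
      triple (assemble v c z) u₁ u₂ u₃ = F z.1.2 + N z := by
    filter_upwards [hD.ae_latent] with z hz
    obtain ⟨⟨q, ⟨k, k'⟩, y, e, α, β, γ⟩, ξ⟩ := z
    have hq := hz.inj
    have h01 : q 1 ≠ q 0 := fun h => by simpa using hq h
    have h02 : q 2 ≠ q 0 := fun h => by simpa using hq h
    have h12 : q 2 ≠ q 1 := fun h => by simpa using hq h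
    simp only [triple, assemble, hF, hN]
    rw [← mul_add]
    congr 1
    have hterm : ∀ p, Ξ (if p = q 0 then (y * α) • v k else if p = q 1 then β • c k
        else if p = q 2 then (e * γ) • v k' else ξ p) =
        (if p = q 0 then (y * α) ^ 3 * Ξ (v k) else 0) + (if p = q 1 then β ^ 3 * Ξ (c k) else 0) +
        (if p = q 2 then (e * γ) ^ 3 * Ξ (v k') else 0) +
        (if p = q 0 ∨ p = q 1 ∨ p = q 2 then 0 else Ξ (ξ p)) := fun p => by
      by_cases h0 : p = q 0
      · subst h0; simp [hΞs, h01.symm, h02.symm]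
      · by_cases h1 : p = q 1
        · subst h1; simp [hΞs, h01, h12.symm]
        · by_cases h2 : p = q 2
          · subst h2; simp [hΞs, h02, h12]
          · simp [h0, h1, h2]
    change ∑ p, Ξ (if p = q 0 then (y * α) • v k else if p = q 1 then β • c k
        else if p = q 2 then (e * γ) • v k' else ξ p) = _
    simp only [hterm, Finset.sum_add_distrib, Finset.sum_ite_eq', Finset.mem_univ, if_true]
  have hFm : Measurable F := by
    have h1 : Measurable fun k => Ξ (v k) := measurable_of_finite _
    have h2 : Measurable fun k => Ξ (c k) := measurable_of_finite _
    simp only [hF]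
    fun_prop
  have hNm : Measurable N := by
    simp only [hN]
    refine Measurable.mul (by fun_prop) (Finset.measurable_sum _ fun p _ => ?_)
    refine Measurable.ite ?_ measurable_const (by fun_prop)
    have hq : ∀ i : Fin 3, MeasurableSet
      {z : ((Fin 3 → Fin P) × Signal K) × Input P d | p = z.1.1 i} := fun i =>
      measurableSet_eq_fun measurable_const (by fun_prop)
    exact (hq 0).union ((hq 1).union (hq 2))
  -- moments of the signal variables
  have hpow : ∀ D : Measure ℝ, IsProbabilityMeasure D → (∀ᵐ s ∂D, C₁ ≤ s ∧ s ≤ C₂) →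
      Integrable (fun s : ℝ => s ^ 3) D := fun D _ hs => by
    refine Integrable.of_bound (by fun_prop) (C₂ ^ 3) ?_
    filter_upwards [hs] with s hs
    rw [Real.norm_of_nonneg (pow_nonneg (by linarith) 3)]
    exact pow_le_pow_left₀ (by linarith) hs.2 3
  have hsgn : ∀ f : ℝ → ℝ, Measurable f → Integrable f (uniformOn ({1, -1} : Set ℝ)) :=
    fun f hf => by
      refine Integrable.of_bound hf.aestronglyMeasurable (|f 1| + |f (-1)|) ?_
      filter_upwards [ae_signs] with y hy
      rcases hy with h | h <;> simp [h]
  have hfin : ∀ f : Fin K × Fin K → ℝ, Integrable f (uniformOn (distinctPairs K)) :=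
    fun f => Integrable.of_finite
  have one_int : ∀ {X : Type} [MeasurableSpace X] (μ : Measure X) [IsProbabilityMeasure μ],
      Integrable (fun _ : X => (1 : ℝ)) μ := fun μ _ => integrable_const _
  set g1 : Signal K → ℝ := fun s => Ξ (v s.1.1) * (s.2.1 ^ 4 * (1 * (s.2.2.2.1 ^ 3 * 1))) with hg1
  set g2 : Signal K → ℝ := fun s => Ξ (c s.1.1) * (s.2.1 * (1 * (1 * (s.2.2.2.2.1 ^ 3 * 1))))
    with hg2
  set g3 : Signal K → ℝ := fun s =>
    Ξ (v s.1.2) * (s.2.1 * (s.2.2.1 ^ 3 * (1 * (1 * s.2.2.2.2.2 ^ 3)))) with hg3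
  have hFg : F = g1 + g2 + g3 := by
    ext s; simp only [hF, hg1, hg2, hg3, Pi.add_apply]; ring
  have i1 : Integrable g1 (signalLaw K Dα Dβ Dγ) :=
    (hfin fun p => Ξ (v p.1)).mul_prod ((hsgn (fun y => y ^ 4) (by fun_prop)).mul_prod
      ((one_int _).mul_prod ((hpow Dα hD.prob_α hD.supp_α).mul_prod (one_int (Dβ.prod Dγ)))))
  have i2 : Integrable g2 (signalLaw K Dα Dβ Dγ) :=
    (hfin fun p => Ξ (c p.1)).mul_prod ((hsgn (fun y => y) (by fun_prop)).mul_prod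
      ((one_int _).mul_prod ((one_int Dα).mul_prod
        ((hpow Dβ hD.prob_β hD.supp_β).mul_prod (one_int Dγ)))))
  have i3 : Integrable g3 (signalLaw K Dα Dβ Dγ) :=
    (hfin fun p => Ξ (v p.2)).mul_prod ((hsgn (fun y => y) (by fun_prop)).mul_prod
      ((hsgn (fun y => y ^ 3) (by fun_prop)).mul_prod ((one_int Dα).mul_prod
        ((one_int Dβ).mul_prod (hpow Dγ hD.prob_γ hD.supp_γ)))))
  have v1 : ∫ s, g1 s ∂signalLaw K Dα Dβ Dγ = (∫ α, α ^ 3 ∂Dα) / K * signalTriple v u₁ u₂ u₃ := by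
    simp only [hg1, signalLaw]
    rw [integral_prod_mul (fun p : Fin K × Fin K => Ξ (v p.1))
      (fun s : ℝ × ℝ × ℝ × ℝ × ℝ => s.1 ^ 4 * (1 * (s.2.2.1 ^ 3 * 1)))]
    rw [integral_prod_mul (fun y : ℝ => y ^ 4)
      (fun s : ℝ × ℝ × ℝ × ℝ => (1 * (s.2.1 ^ 3 * 1)))]
    rw [integral_prod_mul (fun y : ℝ => (1 : ℝ)) (fun s : ℝ × ℝ × ℝ => (s.1 ^ 3 * 1))]
    rw [integral_prod_mul (fun y : ℝ => y ^ 3) (fun s : ℝ × ℝ => (1 : ℝ))]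
    rw [integral_pairs_fst hD.two_le (fun k => Ξ (v k)), integral_signs]
    simp only [integral_const, probReal_univ, smul_eq_mul]
    simp only [hΞ, signalTriple]
    ring
  have v2 : ∫ s, g2 s ∂signalLaw K Dα Dβ Dγ = 0 := by
    simp only [hg2, signalLaw]
    rw [integral_prod_mul (fun p : Fin K × Fin K => Ξ (c p.1))
      (fun s : ℝ × ℝ × ℝ × ℝ × ℝ => s.1 * (1 * (1 * (s.2.2.2.1 ^ 3 * 1))))]
    rw [integral_prod_mul (fun y : ℝ => y)
      (fun s : ℝ × ℝ × ℝ × ℝ => (1 * (1 * (s.2.2.1 ^ 3 * 1)))), integral_signs]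
    simp
  have v3 : ∫ s, g3 s ∂signalLaw K Dα Dβ Dγ = 0 := by
    simp only [hg3, signalLaw]
    rw [integral_prod_mul (fun p : Fin K × Fin K => Ξ (v p.2))
      (fun s : ℝ × ℝ × ℝ × ℝ × ℝ => s.1 * (s.2.1 ^ 3 * (1 * (1 * s.2.2.2.2 ^ 3))))]
    rw [integral_prod_mul (fun y : ℝ => y)
      (fun s : ℝ × ℝ × ℝ × ℝ => (s.1 ^ 3 * (1 * (1 * s.2.2.2 ^ 3)))), integral_signs]
    simp
  have iF : Integrable F (signalLaw K Dα Dβ Dγ) := by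
    rw [hFg]; exact (i1.add i2).add i3
  have hmpF : MeasurePreserving (fun z : ((Fin 3 → Fin P) × Signal K) × Input P d => z.1.2)
      (latentLaw d σp place) (signalLaw K Dα Dβ Dγ) :=
    MeasurePreserving.comp (g := Prod.snd) ⟨measurable_snd, hD.placement.law_signal⟩
      measurePreserving_fst
  have iF' : Integrable (fun z : ((Fin 3 → Fin P) × Signal K) × Input P d => F z.1.2)
      (latentLaw d σp place) := hmpF.integrable_comp_of_integrable iF
  have vF : ∫ z, F z.1.2 ∂latentLaw d σp place =
      (∫ α, α ^ 3 ∂Dα) / K * signalTriple v u₁ u₂ u₃ := by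
    rw [← integral_map (f := F) hmpF.measurable.aemeasurable hFm.aestronglyMeasurable, hmpF.map_eq,
      hFg, integral_add' (i1.add i2) i3, integral_add' i1 i2, v1, v2, v3, add_zero, add_zero]
  have iT : Integrable (fun z => triple (assemble v c z) u₁ u₂ u₃) (latentLaw d σp place) := by
    have := hD.prob_data (σp := σp)
    have h1 := ((hD.memLp_triple (σp := σp) u₁ u₂ u₃)).integrable one_le_two
    rw [dataLaw, integrable_map_measure (measurable_triple _ _ _).aestronglyMeasurable
      (measurable_assemble v c).aemeasurable] at h1
    exact h1
  have iN : Integrable N (latentLaw d σp place) := by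
    refine (iT.sub iF').congr ?_
    filter_upwards [hsplit] with z hz
    simp [hz]
  have vN : ∫ z, N z ∂latentLaw d σp place = 0 := by
    have hpi : MeasurePreserving (fun (ξ : Input P d) p => -ξ p)
        (Measure.pi fun _ : Fin P => isoGaussian (Fin d) (σp / √(d : ℝ)))
        (Measure.pi fun _ : Fin P => isoGaussian (Fin d) (σp / √(d : ℝ))) :=
      measurePreserving_pi _ _ fun p => ⟨by fun_prop, map_neg_isoGaussian _⟩
    have hmp := (MeasurePreserving.id place).prod hpi
    have h1 : ∫ z, N z ∂latentLaw d σp place = ∫ z, -N z ∂latentLaw d σp place := by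
      conv_lhs => rw [latentLaw, ← hmp.map_eq]
      rw [integral_map hmp.measurable.aemeasurable hNm.aestronglyMeasurable]
      refine integral_congr_ae (Filter.Eventually.of_forall fun z => ?_)
      have hodd : ∀ x, Ξ (-x) = -Ξ x := fun x => by
        rw [← neg_one_smul ℝ x, hΞs]; ring
      simp only [hN, Prod.map, id, hodd]
      rw [← mul_neg, ← Finset.sum_neg_distrib]
      congr 1
      refine Finset.sum_congr rfl fun p _ => ?_
      split_ifs <;> simp
    rw [integral_neg] at h1
    linarith
  rw [dataLaw, integral_map (measurable_assemble v c).aemeasurable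
    (measurable_triple _ _ _).aestronglyMeasurable, integral_congr_ae hsplit,
    integral_add iF' iN, vF, vN, add_zero]

end Data

/-! ### Router noise -/

/-- Law of the router noise of one example in one round. -/
abbrev routerLaw (M : ℕ) : Measure (Fin M → unitInterval) :=
  Measure.pi fun _ => (volume : Measure unitInterval)

section RouterNoise

variable {M : ℕ}

lemma measurable_routed (m : Fin M) :
    Measurable fun r : Fin M → unitInterval => routed (fun m => (r m : ℝ)) m := by
  unfold routed
  refine Measurable.ite ?_ measurable_const measurable_const
  have : {r : Fin M → unitInterval | m ∈ argmaxSet fun m => (r m : ℝ)} =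
      ⋂ m', {r | (r m' : ℝ) ≤ r m} := by
    ext r; simp [argmaxSet]
  rw [this]
  exact MeasurableSet.iInter fun m' => measurableSet_le (by fun_prop) (by fun_prop)

lemma volume_unitInterval_close_le (x : ℝ) (u : ℝ) :
    (volume : Measure unitInterval) {y | |(y : ℝ) - x| ≤ 2 * u} ≤ ENNReal.ofReal (4 * u) := by
  have hm : MeasurableSet {y : unitInterval | |(y : ℝ) - x| ≤ 2 * u} :=
    measurableSet_le (by fun_prop) (by fun_prop)
  rw [Measure.Subtype.volume_def, comap_subtype_coe_apply measurableSet_Icc]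
  calc _ ≤ volume (Set.Icc (x - 2 * u) (x + 2 * u)) := by
        refine measure_mono ?_
        rintro _ ⟨y, hy, rfl⟩
        rw [Set.mem_ofPred_eq, abs_le] at hy
        exact ⟨by linarith, by linarith⟩
    _ = ENNReal.ofReal (4 * u) := by
        rw [Real.volume_Icc]; congr 1; ring

lemma routerLaw_close_le {m m' : Fin M} (hm : m' ≠ m) (u : ℝ) :
    routerLaw M {r | |(r m' : ℝ) - r m| ≤ 2 * u} ≤ ENNReal.ofReal (4 * u) := by
  have hind : IndepFun (fun r : Fin M → unitInterval => r m) (fun r => r m') (routerLaw M) :=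
    (iIndepFun_pi (μ := fun _ : Fin M => (volume : Measure unitInterval))
      (X := fun _ => id) fun _ => aemeasurable_id).indepFun hm.symm
  have hev : ∀ k : Fin M, (routerLaw M).map (fun r => r k) = volume := fun k =>
    (measurePreserving_eval (fun _ : Fin M => (volume : Measure unitInterval)) k).map_eq
  have hmap := (indepFun_iff_map_prod_eq_prod_map_map (measurable_pi_apply m).aemeasurable
    (measurable_pi_apply m').aemeasurable).1 hind
  rw [hev, hev] at hmap
  set s : Set (unitInterval × unitInterval) := {q | |(q.2 : ℝ) - q.1| ≤ 2 * u} with hs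
  have hsm : MeasurableSet s := measurableSet_le (by fun_prop) (by fun_prop)
  have h1 : routerLaw M {r | |(r m' : ℝ) - r m| ≤ 2 * u} =
      ((routerLaw M).map fun r => (r m, r m')) s := by
    rw [Measure.map_apply (by fun_prop) hsm]; rfl
  rw [h1, hmap, Measure.prod_apply hsm]
  calc _ ≤ ∫⁻ _x : unitInterval, ENNReal.ofReal (4 * u) :=
        lintegral_mono fun x => volume_unitInterval_close_le x u
    _ = _ := by simp

lemma measurableSet_nearTie (m : Fin M) :
    MeasurableSet {q : ℝ × (Fin M → unitInterval) |
      ∃ m', m' ≠ m ∧ |(q.2 m' : ℝ) - q.2 m| ≤ 2 * q.1} := by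
  have : {q : ℝ × (Fin M → unitInterval) |
      ∃ m', m' ≠ m ∧ |(q.2 m' : ℝ) - q.2 m| ≤ 2 * q.1} =
      ⋃ m' ∈ Finset.univ.erase m, {q | |(q.2 m' : ℝ) - q.2 m| ≤ 2 * q.1} := by
    ext q; simp
  rw [this]
  exact Finset.measurableSet_biUnion _ fun m' _ => measurableSet_le (by fun_prop) (by fun_prop)

lemma measurable_nearTie (m : Fin M) :
    Measurable fun q : ℝ × (Fin M → unitInterval) =>
      nearTie q.1 (fun m => (q.2 m : ℝ)) m := by
  unfold nearTie
  exact Measurable.ite (measurableSet_nearTie m) measurable_const measurable_const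

lemma lintegral_nearTie_le (u : ℝ) (m : Fin M) :
    ∫⁻ r, ENNReal.ofReal (nearTie u (fun m => (r m : ℝ)) m) ∂routerLaw M ≤
      ENNReal.ofReal (4 * M * u) := by
  have h1 : ∀ r : Fin M → unitInterval, ENNReal.ofReal (nearTie u (fun m => (r m : ℝ)) m) ≤
      Set.indicator (⋃ m' ∈ Finset.univ.erase m, {r : Fin M → unitInterval |
        |(r m' : ℝ) - r m| ≤ 2 * u}) 1 r := fun r => by
    unfold nearTie
    split_ifs with h
    · obtain ⟨m', h1, h2⟩ := h
      rw [Set.indicator_of_mem]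
      · simp
      · simp only [Set.mem_iUnion]
        exact ⟨m', by simpa using h1, h2⟩
    · simp
  refine (lintegral_mono h1).trans ?_
  rw [lintegral_indicator_one]
  · calc _ ≤ ∑ m' ∈ Finset.univ.erase m, routerLaw M {r | |(r m' : ℝ) - r m| ≤ 2 * u} :=
          measure_biUnion_finset_le _ _
      _ ≤ ∑ _m' ∈ Finset.univ.erase m, ENNReal.ofReal (4 * u) :=
          Finset.sum_le_sum fun m' hm' => routerLaw_close_le (Finset.ne_of_mem_erase hm') u
      _ ≤ ∑ _m' : Fin M, ENNReal.ofReal (4 * u) :=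
          Finset.sum_le_sum_of_subset (Finset.subset_univ _)
      _ = _ := by
          rw [Finset.sum_const, Finset.card_univ, Fintype.card_fin, nsmul_eq_mul,
            ← ENNReal.ofReal_natCast, ← ENNReal.ofReal_mul (by positivity)]
          congr 1; ring
  · exact Finset.measurableSet_biUnion _ fun m' _ => measurableSet_le (by fun_prop) (by fun_prop)

lemma ae_injective_router : ∀ᵐ r ∂routerLaw M, Function.Injective fun m => (r m : ℝ) := by
  have h : ∀ m m' : Fin M, m' ≠ m → ∀ᵐ r ∂routerLaw M, (r m' : ℝ) ≠ r m := fun m m' hm => by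
    have h1 := routerLaw_close_le hm 0
    rw [ae_iff]
    refine le_antisymm (le_trans (measure_mono fun r hr => ?_) (h1.trans (by simp))) zero_le
    have : (r m' : ℝ) = r m := by simpa using hr
    simp [this]
  have h2 : ∀ᵐ r ∂routerLaw M, ∀ m m' : Fin M, m' ≠ m → (r m' : ℝ) ≠ r m := by
    rw [ae_all_iff]; intro m
    rw [ae_all_iff]; intro m'
    by_cases hm : m' = m
    · simp [hm]
    · filter_upwards [h m m' hm] with r hr _ using hr
  filter_upwards [h2] with r hr m' m hmm
  by_contra hne
  exact hr m m' hne hmm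

/-- Pure router noise sends an example to each expert with equal probability: the noise is
exchangeable and has no ties. -/
lemma integral_routed (m : Fin M) :
    ∫ r, routed (fun m => (r m : ℝ)) m ∂routerLaw M = 1 / M := by
  have hM : (M : ℝ) ≠ 0 := by exact_mod_cast m.pos.ne'
  have hsum : ∀ᵐ r ∂routerLaw M, ∑ k, routed (fun m => (r m : ℝ)) k = 1 := by
    filter_upwards [ae_injective_router] with r hr
    have : Nonempty (Fin M) := ⟨m⟩
    obtain ⟨k, hk⟩ := Finite.exists_max fun m => (r m : ℝ)
    rw [Finset.sum_eq_single k]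
    · simp only [routed, argmaxSet, Finset.mem_filter, Finset.mem_univ, true_and]
      exact if_pos hk
    · intro k' _ hk'
      unfold routed
      rw [if_neg]
      intro hmem
      simp only [argmaxSet, Finset.mem_filter, Finset.mem_univ, true_and] at hmem
      exact hk' (hr (le_antisymm (hk k') (hmem k)))
    · simp
  have hint : ∀ k, Integrable (fun r => routed (fun m => (r m : ℝ)) k) (routerLaw M) := fun k =>
    Integrable.of_bound (measurable_routed k).aestronglyMeasurable 1
      (Filter.Eventually.of_forall fun r => by
        have := routed_mem (fun m => (r m : ℝ)) k
        rw [Real.norm_of_nonneg this.1]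
        exact this.2)
  have hsymm : ∀ k, ∫ r, routed (fun m => (r m : ℝ)) k ∂routerLaw M =
      ∫ r, routed (fun m => (r m : ℝ)) m ∂routerLaw M := fun k => by
    have hmp := measurePreserving_piCongrLeft (α := fun _ : Fin M => unitInterval)
      (fun _ : Fin M => (volume : Measure unitInterval)) (Equiv.swap k m)
    have hmap : (routerLaw M).map
      (MeasurableEquiv.piCongrLeft (fun _ : Fin M => unitInterval) (Equiv.swap k m)) =
        routerLaw M := hmp.map_eq
    conv_lhs => rw [← hmap]
    rw [integral_map hmp.measurable.aemeasurable (measurable_routed k).aestronglyMeasurable]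
    refine integral_congr_ae (Filter.Eventually.of_forall fun r => ?_)
    have hr : ∀ l, (MeasurableEquiv.piCongrLeft (fun _ : Fin M => unitInterval)
        (Equiv.swap k m)) r l = r (Equiv.swap k m l) := fun l => by
      have := MeasurableEquiv.piCongrLeft_apply_apply (Equiv.swap k m)
        (β := fun _ : Fin M => unitInterval) r (Equiv.swap k m l)
      simpa using this
    have hiff : k ∈ argmaxSet (fun l => (r (Equiv.swap k m l) : ℝ)) ↔
        m ∈ argmaxSet fun l => (r l : ℝ) := by
      simp only [argmaxSet, Finset.mem_filter, Finset.mem_univ, true_and, Equiv.swap_apply_left]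
      exact (Equiv.swap k m).forall_congr_left.trans (by simp)
    simp only [routed, hr, hiff]
  have h1 : ∑ k, ∫ r, routed (fun m => (r m : ℝ)) k ∂routerLaw M = 1 := by
    rw [← integral_finsetSum _ fun k _ => hint k, integral_congr_ae hsum]
    simp
  simp only [hsymm, Finset.sum_const, Finset.card_univ, Fintype.card_fin, nsmul_eq_mul] at h1
  field_simp
  linarith

end RouterNoise

/-! ### Concentration of the empirical third-order tensor -/

/-- The mean square error of an empirical mean is at most the second moment divided by the sample
size. -/
lemma lintegral_sq_mean_sub_le {X : Type*} [MeasurableSpace X] (μ : Measure X)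
    [IsProbabilityMeasure μ] {φ : X → ℝ} (hφ : MemLp φ 2 μ) {n : ℕ} (hn : 0 < n) :
    ∫⁻ x, ENNReal.ofReal (((n : ℝ)⁻¹ * ∑ i, φ (x i) - ∫ y, φ y ∂μ) ^ 2)
        ∂Measure.pi (fun _ : Fin n => μ) ≤
      ENNReal.ofReal ((n : ℝ)⁻¹) * ∫⁻ y, ENNReal.ofReal (φ y ^ 2) ∂μ := by
  have hn' : (n : ℝ) ≠ 0 := by exact_mod_cast hn.ne'
  have hev : ∀ i : Fin n, MeasurePreserving (fun x : Fin n → X => x i)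
      (Measure.pi fun _ : Fin n => μ) μ := fun i => measurePreserving_eval (fun _ => μ) i
  have hmem : ∀ i : Fin n, MemLp (fun x : Fin n → X => φ (x i)) 2
      (Measure.pi fun _ : Fin n => μ) := fun i => hφ.comp_measurePreserving (hev i)
  set Y : (Fin n → X) → ℝ := fun x => (n : ℝ)⁻¹ * ∑ i, φ (x i) with hY
  have hYmem : MemLp Y 2 (Measure.pi fun _ : Fin n => μ) :=
    (memLp_finsetSum Finset.univ fun i _ => hmem i).const_mul _
  have hEi : ∀ i : Fin n, ∫ x, φ (x i) ∂Measure.pi (fun _ : Fin n => μ) = ∫ y, φ y ∂μ :=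
    fun i => by
      rw [← (hev i).map_eq, integral_map (hev i).measurable.aemeasurable]
      · rw [(hev i).map_eq]
      · rw [(hev i).map_eq]; exact hφ.aestronglyMeasurable
  have hEY : ∫ x, Y x ∂Measure.pi (fun _ : Fin n => μ) = ∫ y, φ y ∂μ := by
    simp only [hY]
    rw [integral_const_mul, integral_finsetSum _ fun i _ => (hmem i).integrable one_le_two]
    simp only [hEi, Finset.sum_const, Finset.card_univ, Fintype.card_fin, nsmul_eq_mul]
    field_simp
  have hVar : Var[Y; Measure.pi fun _ : Fin n => μ] = (n : ℝ)⁻¹ * Var[φ; μ] := by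
    have h1 : Y = fun x => (n : ℝ)⁻¹ * (∑ i, fun x : Fin n → X => φ (x i)) x := by
      ext x; simp [hY]
    rw [h1, variance_const_mul, variance_sum_pi (X := fun _ => φ) fun _ => hφ]
    simp only [Finset.sum_const, Finset.card_univ, Fintype.card_fin, nsmul_eq_mul]
    field_simp
  have h2 : ∫⁻ x, ENNReal.ofReal ((Y x - ∫ y, φ y ∂μ) ^ 2) ∂Measure.pi (fun _ : Fin n => μ) =
      ENNReal.ofReal (Var[Y; Measure.pi fun _ : Fin n => μ]) := by
    rw [variance_eq_integral hYmem.aestronglyMeasurable.aemeasurable, hEY,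
      ofReal_integral_eq_lintegral_ofReal]
    · exact (hYmem.sub (memLp_const _)).integrable_sq
    · exact Filter.Eventually.of_forall fun x => sq_nonneg _
  rw [h2, hVar, ENNReal.ofReal_mul (by positivity)]
  gcongr
  rw [← ofReal_integral_eq_lintegral_ofReal hφ.integrable_sq
    (Filter.Eventually.of_forall fun x => sq_nonneg _)]
  exact ENNReal.ofReal_le_ofReal (variance_le_expectation_sq hφ.aestronglyMeasurable)

/-- Law of the router noise of one round. -/
abbrev roundLaw (n M : ℕ) : Measure (Fin n → Fin M → unitInterval) :=
  Measure.pi fun _ => routerLaw M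

section Concentration

variable {K M J P d n : ℕ} {C₁ C₂ σp σ₀ : ℝ} {v c : Fin K → EuclideanSpace ℝ (Fin d)}
  {Dα Dβ Dγ : Measure ℝ} {place : Measure ((Fin 3 → Fin P) × Signal K)}

lemma measurable_deviation (v : Fin K → EuclideanSpace ℝ (Fin d)) (κ : ℝ) (m : Fin M)
    (u₁ u₂ u₃ : EuclideanSpace ℝ (Fin d)) :
    Measurable fun q : (Fin n → Sample P d) × (Fin n → Fin M → unitInterval) =>
      deviation v κ q.1 (fun i m => (q.2 i m : ℝ)) m u₁ u₂ u₃ := by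
  unfold deviation
  have h1 : ∀ i : Fin n, Measurable fun q : (Fin n → Sample P d) × (Fin n → Fin M → unitInterval) =>
      routed (fun m => (q.2 i m : ℝ)) m := fun i =>
    (measurable_routed m).comp (by fun_prop : Measurable fun q :
      (Fin n → Sample P d) × (Fin n → Fin M → unitInterval) => q.2 i)
  have h2 : ∀ i : Fin n, Measurable fun q : (Fin n → Sample P d) × (Fin n → Fin M → unitInterval) =>
      triple (q.1 i) u₁ u₂ u₃ := fun i =>
    (measurable_triple u₁ u₂ u₃).comp (by fun_prop : Measurable fun q :
      (Fin n → Sample P d) × (Fin n → Fin M → unitInterval) => q.1 i)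
  exact ((Finset.measurable_sum _ fun i _ => (h1 i).mul (h2 i)).const_mul _).sub_const _

/-- Each entry of the deviation tensor has mean zero: the expected tensor is the signal tensor, and
an example is sent to a given expert with probability `1 / M`, independently of the example. -/
lemma IsDataModel.lintegral_deviation_sq_le (hD : IsDataModel C₁ C₂ v c Dα Dβ Dγ place)
    (hn : 0 < n) (m : Fin M) (u₁ u₂ u₃ : EuclideanSpace ℝ (Fin d)) :
    ∫⁻ q, ENNReal.ofReal (deviation v ((∫ α, α ^ 3 ∂Dα) / K / M) q.1
        (fun i m => (q.2 i m : ℝ)) m u₁ u₂ u₃ ^ 2)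
        ∂((Measure.pi fun _ : Fin n => dataLaw v c σp place).prod (roundLaw n M)) ≤
      ENNReal.ofReal ((n : ℝ)⁻¹) *
        ∫⁻ z, ENNReal.ofReal (triple z u₁ u₂ u₃ ^ 2) ∂dataLaw v c σp place := by
  have := hD.prob_data (σp := σp)
  set D := dataLaw v c σp place
  set φ : Sample P d × (Fin M → unitInterval) → ℝ := fun y =>
    triple y.1 u₁ u₂ u₃ * routed (fun m => (y.2 m : ℝ)) m with hφ
  have hrm : ∀ y : Sample P d × (Fin M → unitInterval), |φ y| ≤ |triple y.1 u₁ u₂ u₃| := fun y => by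
    have := routed_mem (fun m => (y.2 m : ℝ)) m
    rw [hφ, abs_mul, abs_of_nonneg this.1]
    exact mul_le_of_le_one_right (abs_nonneg _) this.2
  have hφm : Measurable φ :=
    ((measurable_triple u₁ u₂ u₃).comp measurable_fst).mul
      ((measurable_routed m).comp measurable_snd)
  have hfst : MemLp (fun y : Sample P d × (Fin M → unitInterval) => triple y.1 u₁ u₂ u₃) 2
      (D.prod (routerLaw M)) :=
    (hD.memLp_triple u₁ u₂ u₃).comp_measurePreserving measurePreserving_fst
  have hφ2 : MemLp φ 2 (D.prod (routerLaw M)) :=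
    hfst.mono hφm.aestronglyMeasurable (Filter.Eventually.of_forall hrm)
  have hmean : ∫ y, φ y ∂D.prod (routerLaw M) =
      (∫ α, α ^ 3 ∂Dα) / K / M * signalTriple v u₁ u₂ u₃ := by
    rw [hφ, integral_prod_mul (fun z => triple z u₁ u₂ u₃)
      (fun r : Fin M → unitInterval => routed (fun m => (r m : ℝ)) m), hD.integral_triple,
      integral_routed]
    ring
  have hmp := measurePreserving_arrowProdEquivProdArrow (Sample P d) (Fin M → unitInterval)
    (Fin n) (fun _ => D) (fun _ => routerLaw M)
  rw [← hmp.lintegral_comp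
    (((measurable_deviation v _ m u₁ u₂ u₃).pow_const 2).ennreal_ofReal)]
  have h1 := lintegral_sq_mean_sub_le (D.prod (routerLaw M)) hφ2 hn
  rw [hmean] at h1
  refine le_trans (le_of_eq ?_) (h1.trans ?_)
  · refine lintegral_congr fun x => ?_
    simp only [deviation, hφ, mul_comm (routed _ _)]
    rfl
  · gcongr
    calc _ ≤ ∫⁻ y, ENNReal.ofReal (triple y.1 u₁ u₂ u₃ ^ 2) ∂D.prod (routerLaw M) :=
          lintegral_mono fun y => ENNReal.ofReal_le_ofReal (sq_le_sq.2 (hrm y))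
      _ = _ := (measurePreserving_fst (μ := D) (ν := routerLaw M)).lintegral_comp
          (f := fun z => ENNReal.ofReal (triple z u₁ u₂ u₃ ^ 2))
          ((measurable_triple u₁ u₂ u₃).pow_const 2).ennreal_ofReal

/-- The squared entries of the tensor of one example in the augmented basis sum up to at most the
sixth power of its size. -/
lemma sum_triple_sq_le (hσ : 0 < σ₀) (W₀ : Experts M J d) (m : Fin M) (j : Fin J)
    {z : Sample P d} (hz : |z.2| ≤ 1) :
    ∑ α, ∑ β, ∑ a : Fin d, triple z (frame σ₀ (filter (W₀ m) j) α)
      (frame σ₀ (filter (W₀ m) j) β) (EuclideanSpace.single a 1) ^ 2 ≤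
      (P : ℝ) ^ 2 * size σ₀ W₀ z.1 ^ 6 := by
  set F := frame σ₀ (filter (W₀ m) j)
  set Λ := size σ₀ W₀ z.1 with hΛ
  have hΛ1 : 1 ≤ Λ := one_le_size hσ W₀ z.1
  have hframe : ∀ p, ∑ α, inner ℝ (F α) (z.1 p) ^ 2 ≤ Λ ^ 2 := fun p => by
    rw [Fintype.sum_option]
    have h1 : ∑ a : Fin d, inner ℝ (F (some a)) (z.1 p) ^ 2 = ‖z.1 p‖ ^ 2 := by
      rw [EuclideanSpace.real_norm_sq_eq]
      simp [F, frame, EuclideanSpace.inner_single_left]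
    have h2 : |inner ℝ (F none) (z.1 p)| + ‖z.1 p‖ ≤ Λ := by
      have h3 := sum_abs_inner_init_le hσ W₀ z.1 m j
      have h4 : |inner ℝ (filter (W₀ m) j) (z.1 p)| ≤
          ∑ p, |inner ℝ (filter (W₀ m) j) (z.1 p)| :=
        Finset.single_le_sum (f := fun p => |inner ℝ (filter (W₀ m) j) (z.1 p)|)
          (fun _ _ => abs_nonneg _) (Finset.mem_univ p)
      have h5 : ‖z.1 p‖ ≤ ∑ p, ‖z.1 p‖ :=
        Finset.single_le_sum (f := fun p => ‖z.1 p‖) (fun _ _ => norm_nonneg _)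
          (Finset.mem_univ p)
      have h6 : |inner ℝ (F none) (z.1 p)| = σ₀⁻¹ * |inner ℝ (filter (W₀ m) j) (z.1 p)| := by
        simp [F, frame, inner_smul_left, abs_mul, abs_of_pos hσ]
      have h7 : σ₀⁻¹ * |inner ℝ (filter (W₀ m) j) (z.1 p)| ≤ Λ - ∑ p, ‖z.1 p‖ := by
        rw [inv_mul_le_iff₀ hσ]; linarith
      linarith
    rw [h1, ← sq_abs]
    have h8 := abs_nonneg (inner ℝ (F none) (z.1 p))
    have h9 := norm_nonneg (z.1 p)
    calc _ ≤ (|inner ℝ (F none) (z.1 p)| + ‖z.1 p‖) ^ 2 := by nlinarith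
      _ ≤ Λ ^ 2 := by gcongr
  have hpt : ∀ u₁ u₂ u₃, triple z u₁ u₂ u₃ ^ 2 ≤
      P * ∑ p, inner ℝ u₁ (z.1 p) ^ 2 * inner ℝ u₂ (z.1 p) ^ 2 * inner ℝ u₃ (z.1 p) ^ 2 :=
    fun u₁ u₂ u₃ => by
      unfold triple
      rw [mul_pow, ← sq_abs z.2]
      calc _ ≤ 1 * (∑ p, inner ℝ u₁ (z.1 p) * inner ℝ u₂ (z.1 p) * inner ℝ u₃ (z.1 p)) ^ 2 := by
            gcongr
            exact pow_le_one₀ (abs_nonneg _) hz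
        _ ≤ P * ∑ p, (inner ℝ u₁ (z.1 p) * inner ℝ u₂ (z.1 p) * inner ℝ u₃ (z.1 p)) ^ 2 := by
            rw [one_mul]
            simpa using sq_sum_le_card_mul_sum_sq (s := Finset.univ)
              (f := fun p => inner ℝ u₁ (z.1 p) * inner ℝ u₂ (z.1 p) * inner ℝ u₃ (z.1 p))
        _ = _ := by simp only [mul_pow]
  have hlast : ∀ p, ∑ a : Fin d, inner ℝ (EuclideanSpace.single a (1 : ℝ)) (z.1 p) ^ 2 ≤ Λ ^ 2 :=
    fun p => by
      have : ∑ a : Fin d, inner ℝ (EuclideanSpace.single a (1 : ℝ)) (z.1 p) ^ 2 = ‖z.1 p‖ ^ 2 := by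
        rw [EuclideanSpace.real_norm_sq_eq]
        simp [EuclideanSpace.inner_single_left]
      rw [this]
      have := norm_le_size hσ W₀ z.1 p
      gcongr
  calc _ ≤ ∑ α, ∑ β, ∑ a : Fin d, (P : ℝ) * ∑ p, inner ℝ (F α) (z.1 p) ^ 2 *
        inner ℝ (F β) (z.1 p) ^ 2 * inner ℝ (EuclideanSpace.single a (1 : ℝ)) (z.1 p) ^ 2 := by
        gcongr
        exact hpt _ _ _
    _ = P * ∑ p, (∑ α, inner ℝ (F α) (z.1 p) ^ 2) * (∑ β, inner ℝ (F β) (z.1 p) ^ 2) *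
        ∑ a : Fin d, inner ℝ (EuclideanSpace.single a (1 : ℝ)) (z.1 p) ^ 2 := by
        simp only [← Finset.mul_sum]
        congr 1
        have e1 : ∀ α β, ∑ a : Fin d, ∑ p, inner ℝ (F α) (z.1 p) ^ 2 *
            inner ℝ (F β) (z.1 p) ^ 2 * inner ℝ (EuclideanSpace.single a (1 : ℝ)) (z.1 p) ^ 2 =
            ∑ p, inner ℝ (F α) (z.1 p) ^ 2 * inner ℝ (F β) (z.1 p) ^ 2 *
              ∑ a : Fin d, inner ℝ (EuclideanSpace.single a (1 : ℝ)) (z.1 p) ^ 2 := fun α β => by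
          rw [Finset.sum_comm]
          simp only [Finset.mul_sum]
        simp only [e1]
        have e2 : ∀ α, ∑ β, ∑ p, inner ℝ (F α) (z.1 p) ^ 2 * inner ℝ (F β) (z.1 p) ^ 2 *
              ∑ a : Fin d, inner ℝ (EuclideanSpace.single a (1 : ℝ)) (z.1 p) ^ 2 =
            ∑ p, inner ℝ (F α) (z.1 p) ^ 2 * (∑ β, inner ℝ (F β) (z.1 p) ^ 2) *
              ∑ a : Fin d, inner ℝ (EuclideanSpace.single a (1 : ℝ)) (z.1 p) ^ 2 := fun α => by
          rw [Finset.sum_comm]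
          refine Finset.sum_congr rfl fun p _ => ?_
          rw [← Finset.sum_mul, ← Finset.mul_sum]
        simp only [e2]
        rw [Finset.sum_comm]
        refine Finset.sum_congr rfl fun p _ => ?_
        rw [← Finset.sum_mul, ← Finset.sum_mul]
    _ ≤ P * ∑ _p : Fin P, Λ ^ 2 * Λ ^ 2 * Λ ^ 2 := by
        gcongr with p
        · exact hframe p
        · exact hframe p
        · exact hlast p
    _ = _ := by
        rw [Finset.sum_const, Finset.card_univ, Fintype.card_fin, nsmul_eq_mul]
        ring

/-- For fixed initial weights the squared deviation has expectation of order `1 / n`; no union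
bound over the filters that occur during training is needed, as they are expanded in the augmented
basis. -/
lemma IsDataModel.lintegral_deviationSq_le (hD : IsDataModel C₁ C₂ v c Dα Dβ Dγ place)
    (hn : 0 < n) (hσ : 0 < σ₀) (W₀ : Experts M J d) (m : Fin M) (j : Fin J) :
    ∫⁻ q, ENNReal.ofReal (deviationSq v ((∫ α, α ^ 3 ∂Dα) / K / M) σ₀ q.1
        (fun i m => (q.2 i m : ℝ)) m (filter (W₀ m) j))
        ∂((Measure.pi fun _ : Fin n => dataLaw v c σp place).prod (roundLaw n M)) ≤
      ENNReal.ofReal ((n : ℝ)⁻¹ * (P : ℝ) ^ 2) *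
        ∫⁻ z, ENNReal.ofReal (size σ₀ W₀ z.1 ^ 6) ∂dataLaw v c σp place := by
  set F := frame σ₀ (filter (W₀ m) j)
  have hdm : ∀ u₁ u₂ u₃, Measurable fun q : (Fin n → Sample P d) × (Fin n → Fin M → unitInterval) =>
      ENNReal.ofReal (deviation v ((∫ α, α ^ 3 ∂Dα) / K / M) q.1 (fun i m => (q.2 i m : ℝ)) m
        u₁ u₂ u₃ ^ 2) := fun u₁ u₂ u₃ =>
    ((measurable_deviation v _ m u₁ u₂ u₃).pow_const 2).ennreal_ofReal
  have htm : ∀ u₁ u₂ u₃, Measurable fun z : Sample P d =>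
      ENNReal.ofReal (triple z u₁ u₂ u₃ ^ 2) := fun u₁ u₂ u₃ =>
    ((measurable_triple u₁ u₂ u₃).pow_const 2).ennreal_ofReal
  calc _ = ∑ α, ∑ β, ∑ a : Fin d, ∫⁻ q, ENNReal.ofReal (deviation v ((∫ α, α ^ 3 ∂Dα) / K / M) q.1
        (fun i m => (q.2 i m : ℝ)) m (F α) (F β) (EuclideanSpace.single a 1) ^ 2)
        ∂((Measure.pi fun _ : Fin n => dataLaw v c σp place).prod (roundLaw n M)) := by
        have h1 : ∀ q : (Fin n → Sample P d) × (Fin n → Fin M → unitInterval),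
            ENNReal.ofReal (deviationSq v ((∫ α, α ^ 3 ∂Dα) / K / M) σ₀ q.1
              (fun i m => (q.2 i m : ℝ)) m (filter (W₀ m) j)) =
            ∑ α, ∑ β, ∑ a : Fin d, ENNReal.ofReal (deviation v ((∫ α, α ^ 3 ∂Dα) / K / M) q.1
              (fun i m => (q.2 i m : ℝ)) m (F α) (F β) (EuclideanSpace.single a 1) ^ 2) :=
          fun q => by
            unfold deviationSq
            rw [ENNReal.ofReal_sum_of_nonneg fun α _ => by positivity]
            refine Finset.sum_congr rfl fun α _ => ?_
            rw [ENNReal.ofReal_sum_of_nonneg fun β _ => by positivity]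
            refine Finset.sum_congr rfl fun β _ => ?_
            rw [ENNReal.ofReal_sum_of_nonneg fun a _ => by positivity]
        simp only [h1]
        rw [lintegral_finsetSum _ fun α _ => Finset.measurable_sum _ fun β _ =>
          Finset.measurable_sum _ fun a _ => hdm _ _ _]
        refine Finset.sum_congr rfl fun α _ => ?_
        rw [lintegral_finsetSum _ fun β _ => Finset.measurable_sum _ fun a _ => hdm _ _ _]
        refine Finset.sum_congr rfl fun β _ => ?_
        rw [lintegral_finsetSum _ fun a _ => hdm _ _ _]
    _ ≤ ∑ α, ∑ β, ∑ a : Fin d, ENNReal.ofReal ((n : ℝ)⁻¹) * ∫⁻ z, ENNReal.ofReal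
        (triple z (F α) (F β) (EuclideanSpace.single a 1) ^ 2) ∂dataLaw v c σp place := by
        gcongr
        exact hD.lintegral_deviation_sq_le hn m _ _ _
    _ = ENNReal.ofReal ((n : ℝ)⁻¹) * ∫⁻ z, ∑ α, ∑ β, ∑ a : Fin d, ENNReal.ofReal
        (triple z (F α) (F β) (EuclideanSpace.single a 1) ^ 2) ∂dataLaw v c σp place := by
        simp only [← Finset.mul_sum]
        congr 1
        rw [lintegral_finsetSum _ fun α _ => Finset.measurable_sum _ fun β _ =>
          Finset.measurable_sum _ fun a _ => htm _ _ _]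
        refine Finset.sum_congr rfl fun α _ => ?_
        rw [lintegral_finsetSum _ fun β _ => Finset.measurable_sum _ fun a _ => htm _ _ _]
        refine Finset.sum_congr rfl fun β _ => ?_
        rw [lintegral_finsetSum _ fun a _ => htm _ _ _]
    _ ≤ ENNReal.ofReal ((n : ℝ)⁻¹) * ∫⁻ z, ENNReal.ofReal ((P : ℝ) ^ 2) *
        ENNReal.ofReal (size σ₀ W₀ z.1 ^ 6) ∂dataLaw v c σp place := by
        gcongr 1
        refine lintegral_mono_ae ?_
        filter_upwards [hD.ae_label] with z hz
        rw [← ENNReal.ofReal_mul (by positivity)]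
        refine le_trans (le_of_eq ?_) (ENNReal.ofReal_le_ofReal (sum_triple_sq_le hσ W₀ m j hz))
        rw [ENNReal.ofReal_sum_of_nonneg fun α _ => by positivity]
        refine Finset.sum_congr rfl fun α _ => ?_
        rw [ENNReal.ofReal_sum_of_nonneg fun β _ => by positivity]
        refine Finset.sum_congr rfl fun β _ => ?_
        rw [ENNReal.ofReal_sum_of_nonneg fun a _ => by positivity]
    _ = _ := by
        rw [lintegral_const_mul' _ _ ENNReal.ofReal_ne_top, ← mul_assoc,
          ← ENNReal.ofReal_mul (by positivity)]

end Concentration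

/-! ### Expected size of the inputs and of the gradient error -/

section Expectation

variable {K M J P d n : ℕ} {C₁ C₂ σp σ₀ : ℝ} {v c : Fin K → EuclideanSpace ℝ (Fin d)}
  {Dα Dβ Dγ : Measure ℝ} {place : Measure ((Fin 3 → Fin P) × Signal K)}

/-- Law of the initial expert weights. -/
abbrev initLaw (M J d : ℕ) (σ₀ : ℝ) : Measure (Experts M J d) :=
  Measure.pi fun _ => isoGaussian (Fin J × Fin d) σ₀

lemma continuous_filter (j : Fin J) :
    Continuous fun w : ExpertWeights J d => filter w j := by
  simp only [filter_eq]
  exact LinearMap.continuous_of_finiteDimensional _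

lemma continuous_filter_apply (m : Fin M) (j : Fin J) :
    Continuous fun W : Experts M J d => filter (W m) j :=
  (continuous_filter j).comp (continuous_apply m)

lemma continuous_size (σ₀ : ℝ) :
    Continuous fun q : Experts M J d × Input P d => size σ₀ q.1 q.2 := by
  unfold size
  have h : ∀ m j, Continuous fun q : Experts M J d × Input P d => filter (q.1 m) j :=
    fun m j => (continuous_filter_apply m j).comp continuous_fst
  have h2 : ∀ m j p, Continuous fun q : Experts M J d × Input P d =>
      |inner ℝ (filter (q.1 m) j) (q.2 p)| := fun m j p =>
    ((h m j).inner ((continuous_apply p).comp continuous_snd)).abs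
  refine Continuous.add (by fun_prop) (continuous_const.mul ?_)
  exact continuous_finsetSum _ fun m _ => continuous_finsetSum _ fun j _ =>
    continuous_finsetSum _ fun p _ => h2 m j p

lemma measurable_comp_input {f : Experts M J d × Input P d → ℝ} (h : Continuous f) :
    Measurable fun q : Experts M J d × Sample P d => f (q.1, q.2.1) :=
  h.measurable.comp (measurable_fst.prodMk (measurable_fst.comp measurable_snd))

lemma measurable_size (σ₀ : ℝ) :
    Measurable fun q : Experts M J d × Sample P d => size σ₀ q.1 q.2.1 :=
  measurable_comp_input (continuous_size σ₀)

lemma measurable_size_sample (σ₀ : ℝ) (W₀ : Experts M J d) :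
    Measurable fun z : Sample P d => size σ₀ W₀ z.1 :=
  Measurable.of_uncurry_left (f := fun (W : Experts M J d) (z : Sample P d) => size σ₀ W z.1)
    (measurable_size σ₀)

/-- A bound on the sixth moment of the size of an example. -/
def sizeMoment (M J P : ℕ) (C₂ σp : ℝ) : ℝ :=
  243 * (1 + ((P : ℝ) ^ 5 + ((M * J * P : ℕ) : ℝ) ^ 5 * (M * J * sixthMoment)) *
    (P * patchMoment C₂ σp))

lemma size_pow_six_le (hσ : 0 < σ₀) (W₀ : Experts M J d) (x : Input P d) :
    size σ₀ W₀ x ^ 6 ≤ 243 * (1 + (P : ℝ) ^ 5 * ∑ p, ‖x p‖ ^ 6 +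
      ((M * J * P : ℕ) : ℝ) ^ 5 * ∑ m, ∑ j, ∑ p,
        (σ₀⁻¹) ^ 6 * inner ℝ (W₀ m) (embed j (x p)) ^ 6) := by
  have h1 : (∑ p, ‖x p‖) ^ 6 ≤ (P : ℝ) ^ 5 * ∑ p, ‖x p‖ ^ 6 := by
    simpa using sum_pow_six_le Finset.univ (f := fun p => ‖x p‖) fun _ _ => norm_nonneg _
  have h2 : (σ₀⁻¹ * ∑ m, ∑ j, ∑ p, |inner ℝ (filter (W₀ m) j) (x p)|) ^ 6 ≤
      ((M * J * P : ℕ) : ℝ) ^ 5 * ∑ m, ∑ j, ∑ p,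
        (σ₀⁻¹) ^ 6 * inner ℝ (W₀ m) (embed j (x p)) ^ 6 := by
    have h := sum_pow_six_le (Finset.univ : Finset (Fin M × Fin J × Fin P))
      (f := fun q => |inner ℝ (filter (W₀ q.1) q.2.1) (x q.2.2)|) fun _ _ => abs_nonneg _
    simp only [Fintype.sum_prod_type, Finset.card_univ, Fintype.card_prod, Fintype.card_fin] at h
    simp only [← Finset.mul_sum]
    rw [mul_pow, mul_left_comm]
    refine mul_le_mul_of_nonneg_left (h.trans (le_of_eq ?_)) (by positivity)
    rw [mul_assoc M J P]
    congr 1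
    refine Finset.sum_congr rfl fun m _ => Finset.sum_congr rfl fun j _ =>
      Finset.sum_congr rfl fun p _ => ?_
    rw [inner_filter, Even.pow_abs (by decide)]
  have h3 := sum_pow_six_le (Finset.univ : Finset (Fin 3))
    (f := ![1, ∑ p, ‖x p‖, σ₀⁻¹ * ∑ m, ∑ j, ∑ p, |inner ℝ (filter (W₀ m) j) (x p)|]) (by
      intro i _
      fin_cases i
      · simp
      · simpa using Finset.sum_nonneg fun p _ => norm_nonneg (x p)
      · simp only [Fin.reduceFinMk, Matrix.cons_val]
        positivity)
  simp only [Fin.sum_univ_three, Matrix.cons_val, one_pow, Finset.card_univ,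
    Fintype.card_fin] at h3
  unfold size
  norm_num at h3
  linarith

/-- For a fixed input the initial responses are Gaussian, which bounds the expected size. -/
lemma lintegral_size_init_le (hσ : 0 < σ₀) (x : Input P d) :
    ∫⁻ W₀, ENNReal.ofReal (size σ₀ W₀ x ^ 6) ∂initLaw M J d σ₀ ≤
      ENNReal.ofReal (243 * (1 + ((P : ℝ) ^ 5 + ((M * J * P : ℕ) : ℝ) ^ 5 *
        (M * J * sixthMoment)) * ∑ p, ‖x p‖ ^ 6)) := by
  have hs := sixthMoment_nonneg
  have hev : ∀ (m : Fin M) (j : Fin J) (p : Fin P),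
      ∫⁻ W₀, ENNReal.ofReal ((σ₀⁻¹) ^ 6 * inner ℝ (W₀ m) (embed j (x p)) ^ 6)
        ∂initLaw M J d σ₀ = ENNReal.ofReal (sixthMoment * ‖x p‖ ^ 6) := fun m j p => by
    have hmp := measurePreserving_eval
      (fun _ : Fin M => isoGaussian (Fin J × Fin d) σ₀) m
    have h1 := hmp.lintegral_comp (f := fun w : ExpertWeights J d =>
      ENNReal.ofReal ((σ₀⁻¹) ^ 6 * inner ℝ w (embed j (x p)) ^ 6)) (by fun_prop)
    refine h1.trans ?_
    simp only [ENNReal.ofReal_mul (by positivity : 0 ≤ (σ₀⁻¹) ^ 6)]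
    rw [lintegral_const_mul _ (by fun_prop), lintegral_inner_pow_six, norm_embed,
      ← ENNReal.ofReal_mul (by positivity)]
    congr 1
    field_simp
  have hm : ∀ (m : Fin M) (j : Fin J) (p : Fin P), Measurable fun W₀ : Experts M J d =>
      ENNReal.ofReal ((σ₀⁻¹) ^ 6 * inner ℝ (W₀ m) (embed j (x p)) ^ 6) := fun m j p => by
    have : Measurable fun W₀ : Experts M J d => inner ℝ (W₀ m) (embed j (x p)) :=
      (measurable_pi_apply m).inner measurable_const
    fun_prop
  calc _ ≤ ∫⁻ W₀, ENNReal.ofReal (243 * (1 + (P : ℝ) ^ 5 * ∑ p, ‖x p‖ ^ 6)) +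
        ENNReal.ofReal (243 * ((M * J * P : ℕ) : ℝ) ^ 5) * ∑ m, ∑ j, ∑ p,
          ENNReal.ofReal ((σ₀⁻¹) ^ 6 * inner ℝ (W₀ m) (embed j (x p)) ^ 6)
          ∂initLaw M J d σ₀ := by
        refine lintegral_mono fun W₀ => ?_
        refine (ENNReal.ofReal_le_ofReal (size_pow_six_le hσ W₀ x)).trans (le_of_eq ?_)
        have e : ∑ m, ∑ j, ∑ p,
            ENNReal.ofReal ((σ₀⁻¹) ^ 6 * inner ℝ (W₀ m) (embed j (x p)) ^ 6) =
            ENNReal.ofReal (∑ m, ∑ j, ∑ p, (σ₀⁻¹) ^ 6 * inner ℝ (W₀ m) (embed j (x p)) ^ 6) := by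
          rw [ENNReal.ofReal_sum_of_nonneg fun m _ => by positivity]
          refine Finset.sum_congr rfl fun m _ => ?_
          rw [ENNReal.ofReal_sum_of_nonneg fun j _ => by positivity]
          refine Finset.sum_congr rfl fun j _ => ?_
          rw [ENNReal.ofReal_sum_of_nonneg fun p _ => by positivity]
        rw [e, ← ENNReal.ofReal_mul (by positivity), ← ENNReal.ofReal_add (by positivity)
          (by positivity)]
        congr 1
        ring
    _ = ENNReal.ofReal (243 * (1 + (P : ℝ) ^ 5 * ∑ p, ‖x p‖ ^ 6)) +
        ENNReal.ofReal (243 * ((M * J * P : ℕ) : ℝ) ^ 5) * ∑ m : Fin M, ∑ j : Fin J, ∑ p,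
          ENNReal.ofReal (sixthMoment * ‖x p‖ ^ 6) := by
        rw [lintegral_add_left (by fun_prop), lintegral_const, measure_univ, mul_one,
          lintegral_const_mul' _ _ ENNReal.ofReal_ne_top,
          lintegral_finsetSum _ fun m _ => Finset.measurable_sum _ fun j _ =>
            Finset.measurable_sum _ fun p _ => hm m j p]
        congr 2
        refine Finset.sum_congr rfl fun m _ => ?_
        rw [lintegral_finsetSum _ fun j _ => Finset.measurable_sum _ fun p _ => hm m j p]
        refine Finset.sum_congr rfl fun j _ => ?_
        rw [lintegral_finsetSum _ fun p _ => hm m j p]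
        exact Finset.sum_congr rfl fun p _ => hev m j p
    _ = _ := by
        rw [← ENNReal.ofReal_sum_of_nonneg fun p _ => by positivity]
        simp only [Finset.sum_const, Finset.card_univ, Fintype.card_fin, nsmul_eq_mul]
        rw [← ENNReal.ofReal_natCast, ← ENNReal.ofReal_natCast,
          ← ENNReal.ofReal_mul (by positivity), ← ENNReal.ofReal_mul (by positivity),
          ← ENNReal.ofReal_mul (by positivity), ← ENNReal.ofReal_add (by positivity)
          (by positivity), ← Finset.mul_sum]
        congr 1
        ring

lemma IsDataModel.lintegral_size_le (hD : IsDataModel C₁ C₂ v c Dα Dβ Dγ place) (hσ : 0 < σ₀) :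
    ∫⁻ W₀, ∫⁻ z, ENNReal.ofReal (size σ₀ W₀ z.1 ^ 6) ∂dataLaw v c σp place ∂initLaw M J d σ₀ ≤
      ENNReal.ofReal (sizeMoment M J P C₂ σp) := by
  have := hD.prob_data (σp := σp)
  have hs := sixthMoment_nonneg
  have hp := patchMoment_nonneg C₂ σp
  rw [lintegral_lintegral_swap (((measurable_size σ₀).pow_const 6).ennreal_ofReal.aemeasurable)]
  set a : ℝ := (P : ℝ) ^ 5 + ((M * J * P : ℕ) : ℝ) ^ 5 * (M * J * sixthMoment) with ha
  have ha0 : 0 ≤ a := by positivity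
  calc _ ≤ ∫⁻ z : Sample P d, ENNReal.ofReal 243 + ENNReal.ofReal (243 * a) *
        ∑ p, ENNReal.ofReal (‖z.1 p‖ ^ 6) ∂dataLaw v c σp place := by
        refine lintegral_mono fun z => (lintegral_size_init_le hσ z.1).trans (le_of_eq ?_)
        rw [← ENNReal.ofReal_sum_of_nonneg fun p _ => by positivity,
          ← ENNReal.ofReal_mul (by positivity), ← ENNReal.ofReal_add (by positivity)
          (by positivity)]
        congr 1
        ring
    _ = ENNReal.ofReal 243 + ENNReal.ofReal (243 * a) *
        ∑ p, ∫⁻ z : Sample P d, ENNReal.ofReal (‖z.1 p‖ ^ 6) ∂dataLaw v c σp place := by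
        rw [lintegral_add_left (by fun_prop), lintegral_const, measure_univ, mul_one,
          lintegral_const_mul' _ _ ENNReal.ofReal_ne_top, lintegral_finsetSum]
        intro p _
        have : Measurable fun z : Sample P d => z.1 p := (measurable_pi_apply p).comp measurable_fst
        fun_prop
    _ ≤ ENNReal.ofReal 243 + ENNReal.ofReal (243 * a) *
        ∑ _p : Fin P, ENNReal.ofReal (patchMoment C₂ σp) := by
        gcongr with p
        exact hD.lintegral_patch_le p
    _ = _ := by
        simp only [Finset.sum_const, Finset.card_univ, Fintype.card_fin, nsmul_eq_mul]
        rw [← ENNReal.ofReal_natCast, ← ENNReal.ofReal_mul (by positivity),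
          ← ENNReal.ofReal_mul (by positivity), ← ENNReal.ofReal_add (by positivity)
          (by positivity)]
        congr 1
        rw [sizeMoment, ← ha]
        ring

end Expectation

section GradientErrorMoment

variable {K M J P d n : ℕ} {C₁ C₂ σp σ₀ τ ρ ν : ℝ} {v c : Fin K → EuclideanSpace ℝ (Fin d)}
  {Dα Dβ Dγ : Measure ℝ} {place : Measure ((Fin 3 → Fin P) × Signal K)}

lemma continuous_frame (σ₀ : ℝ) (m : Fin M) (j : Fin J) (α : Option (Fin d)) :
    Continuous fun W : Experts M J d => frame σ₀ (filter (W m) j) α := by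
  cases α with
  | none => exact (continuous_filter_apply m j).const_smul σ₀⁻¹
  | some a => exact continuous_const

lemma continuous_triple :
    Continuous fun q : Sample P d × EuclideanSpace ℝ (Fin d) × EuclideanSpace ℝ (Fin d) ×
      EuclideanSpace ℝ (Fin d) => triple q.1 q.2.1 q.2.2.1 q.2.2.2 := by
  unfold triple
  fun_prop

/-- The initialization, the sample and the router noise of one round. -/
abbrev RoundOutcome (M J P d n : ℕ) :=
  Experts M J d × (Fin n → Sample P d) × (Fin n → Fin M → unitInterval)

lemma measurable_sample_apply (i : Fin n) :
    Measurable fun q : RoundOutcome M J P d n => (q.1, q.2.1 i) :=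
  measurable_fst.prodMk ((measurable_pi_apply i).comp (measurable_fst.comp measurable_snd))

lemma measurable_noise_apply (i : Fin n) :
    Measurable fun q : RoundOutcome M J P d n => q.2.2 i :=
  (measurable_pi_apply i).comp (measurable_snd.comp measurable_snd)

lemma measurable_triple_frame (σ₀ : ℝ) (m : Fin M) (j : Fin J) (α β : Option (Fin d))
    (u : EuclideanSpace ℝ (Fin d)) :
    Measurable fun q : Experts M J d × Sample P d =>
      triple q.2 (frame σ₀ (filter (q.1 m) j) α) (frame σ₀ (filter (q.1 m) j) β) u := by
  have h : Continuous fun q : Experts M J d × Sample P d =>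
      (q.2, frame σ₀ (filter (q.1 m) j) α, frame σ₀ (filter (q.1 m) j) β, u) :=
    continuous_snd.prodMk (((continuous_frame σ₀ m j α).comp continuous_fst).prodMk
      (((continuous_frame σ₀ m j β).comp continuous_fst).prodMk continuous_const))
  have h2 := continuous_triple.comp h
  exact h2.measurable

lemma measurable_deviationSq (v : Fin K → EuclideanSpace ℝ (Fin d)) (κ σ₀ : ℝ) (m : Fin M)
    (j : Fin J) :
    Measurable fun q : RoundOutcome M J P d n =>
      deviationSq v κ σ₀ q.2.1 (fun i m => (q.2.2 i m : ℝ)) m (filter (q.1 m) j) := by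
  unfold deviationSq
  refine Finset.measurable_sum _ fun α _ => Finset.measurable_sum _ fun β _ =>
    Finset.measurable_sum _ fun a _ => Measurable.pow_const ?_ 2
  unfold deviation
  have h1 : ∀ i : Fin n, Measurable fun q : RoundOutcome M J P d n =>
      routed (fun m => (q.2.2 i m : ℝ)) m := fun i =>
    (measurable_routed m).comp (measurable_noise_apply i)
  have h2 : ∀ i : Fin n, Measurable fun q : RoundOutcome M J P d n =>
      triple (q.2.1 i) (frame σ₀ (filter (q.1 m) j) α) (frame σ₀ (filter (q.1 m) j) β)
        (EuclideanSpace.single a 1) := fun i =>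
    (measurable_triple_frame σ₀ m j α β _).comp (measurable_sample_apply i)
  have h3 : Measurable fun q : RoundOutcome M J P d n =>
      signalTriple v (frame σ₀ (filter (q.1 m) j) α) (frame σ₀ (filter (q.1 m) j) β)
        (EuclideanSpace.single a 1) := by
    have h4 : Continuous fun W : Experts M J d =>
        signalTriple v (frame σ₀ (filter (W m) j) α) (frame σ₀ (filter (W m) j) β)
          (EuclideanSpace.single a 1) := by
      have ha := continuous_frame σ₀ (d := d) m j α
      have hb := continuous_frame σ₀ (d := d) m j β
      unfold signalTriple
      exact continuous_finsetSum _ fun k _ =>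
        ((ha.inner continuous_const).mul (hb.inner continuous_const)).mul continuous_const
    exact h4.measurable.comp measurable_fst
  exact ((Finset.measurable_sum _ fun i _ => (h1 i).mul (h2 i)).const_mul _).sub
    (h3.const_mul κ)

lemma measurable_comp_sample {f : Experts M J d × Sample P d → ℝ} (h : Measurable f) (i : Fin n) :
    Measurable fun q : RoundOutcome M J P d n => f (q.1, q.2.1 i) :=
  h.comp (measurable_sample_apply i)

lemma measurable_section {f : RoundOutcome M J P d n → ℝ} (h : Measurable f)
    (W₀ : Experts M J d) :
    Measurable fun q : (Fin n → Sample P d) × (Fin n → Fin M → unitInterval) => f (W₀, q) :=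
  h.comp measurable_prodMk_left

lemma measurable_size_round (σ₀ : ℝ) (i : Fin n) :
    Measurable fun q : RoundOutcome M J P d n => size σ₀ q.1 (q.2.1 i).1 :=
  measurable_comp_sample (measurable_size σ₀) i

lemma measurable_nearTie_round (σ₀ τ : ℝ) (m : Fin M) (i : Fin n) :
    Measurable fun q : RoundOutcome M J P d n =>
      nearTie (τ * size σ₀ q.1 (q.2.1 i).1) (fun m => (q.2.2 i m : ℝ)) m :=
  (measurable_nearTie m).comp
    (((measurable_size_round σ₀ i).const_mul τ).prodMk (measurable_noise_apply i))

lemma measurable_gradientError (v : Fin K → EuclideanSpace ℝ (Fin d)) (κ σ₀ τ ρ : ℝ)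
    (m : Fin M) :
    Measurable fun q : RoundOutcome M J P d n =>
      gradientError v κ σ₀ τ ρ q.1 q.2.1 (fun i m => (q.2.2 i m : ℝ)) m := by
  unfold gradientError
  have h1 : ∀ i : Fin n, Measurable fun q : RoundOutcome M J P d n =>
      size σ₀ q.1 (q.2.1 i).1 ^ 3 *
        nearTie (τ * size σ₀ q.1 (q.2.1 i).1) (fun m => (q.2.2 i m : ℝ)) m := fun i =>
    ((measurable_size_round σ₀ i).pow_const 3).mul (measurable_nearTie_round σ₀ τ m i)
  have h2 : ∀ i : Fin n, Measurable fun q : RoundOutcome M J P d n =>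
      size σ₀ q.1 (q.2.1 i).1 ^ 6 := fun i => (measurable_size_round σ₀ i).pow_const 6
  have h3 : ∀ j, Measurable fun q : RoundOutcome M J P d n =>
      √(deviationSq v (κ / M) σ₀ q.2.1 (fun i m => (q.2.2 i m : ℝ)) m (filter (q.1 m) j)) :=
    fun j => (measurable_deviationSq v (κ / M) σ₀ m j).sqrt
  exact (((((Finset.measurable_sum _ fun i _ => h1 i).const_mul _).const_mul _).add
    ((((Finset.measurable_sum _ fun i _ => h2 i).const_mul _).const_mul _).const_mul _)).add
    (Finset.measurable_sum _ fun j _ => h3 j)).const_mul 3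

/-- The scale `ν` is a free parameter, which balances the two terms once the sample size is known.
-/
lemma sqrt_le_div_add {x ν : ℝ} (hx : 0 ≤ x) (hν : 0 < ν) : √x ≤ ν⁻¹ * x + ν := by
  have h := Real.sq_sqrt hx
  have h2 : ν⁻¹ * x + ν - √x = ν⁻¹ * ((√x - ν / 2) ^ 2 + 3 / 4 * ν ^ 2) := by
    rw [show (√x - ν / 2) ^ 2 = √x ^ 2 - ν * √x + ν ^ 2 / 4 by ring, h]
    field_simp
    ring
  have h3 : 0 ≤ ν⁻¹ * ((√x - ν / 2) ^ 2 + 3 / 4 * ν ^ 2) := by positivity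
  linarith

/-- Bound for the expected gradient error in terms of the expected sixth power `E` of the size. -/
def errorMoment (M J P n : ℕ) (τ ρ ν E : ℝ) : ℝ :=
  3 * (J * (4 * M * τ) + J * (M * (J * ρ ^ 3) + 4 * τ) +
    J * (ν⁻¹ * ((n : ℝ)⁻¹ * (P : ℝ) ^ 2))) * E + 3 * (J * ν)

set_option maxHeartbeats 1000000 in
lemma IsDataModel.lintegral_gradientError_le (hD : IsDataModel C₁ C₂ v c Dα Dβ Dγ place)
    (hn : 0 < n) (hσ : 0 < σ₀) (hτ : 0 ≤ τ) (hρ : 0 ≤ ρ) (hν : 0 < ν) (W₀ : Experts M J d)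
    (m : Fin M) :
    ∫⁻ q, ENNReal.ofReal (gradientError v ((∫ α, α ^ 3 ∂Dα) / K) σ₀ τ ρ W₀ q.1
        (fun i m => (q.2 i m : ℝ)) m)
        ∂((Measure.pi fun _ : Fin n => dataLaw v c σp place).prod (roundLaw n M)) ≤
      ENNReal.ofReal (3 * (J * (4 * M * τ) + J * (M * (J * ρ ^ 3) + 4 * τ) +
        J * (ν⁻¹ * ((n : ℝ)⁻¹ * (P : ℝ) ^ 2)))) *
        ∫⁻ z, ENNReal.ofReal (size σ₀ W₀ z.1 ^ 6) ∂dataLaw v c σp place +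
        ENNReal.ofReal (3 * (J * ν)) := by
  have := hD.prob_data (σp := σp)
  have hn' : (n : ℝ) ≠ 0 := by exact_mod_cast hn.ne'
  set D := dataLaw v c σp place
  set κ := (∫ α, α ^ 3 ∂Dα) / K
  set E := ∫⁻ z, ENNReal.ofReal (size σ₀ W₀ z.1 ^ 6) ∂D
  have hs : ∀ z : Sample P d, 1 ≤ size σ₀ W₀ z.1 := fun z => one_le_size hσ W₀ z.1
  have hs0 : ∀ z : Sample P d, 0 ≤ size σ₀ W₀ z.1 := fun z => zero_le_one.trans (hs z)
  set Q := (Measure.pi fun _ : Fin n => D).prod (roundLaw n M)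
  let A : Fin n → (Fin n → Sample P d) × (Fin n → Fin M → unitInterval) → ℝ := fun i q =>
    size σ₀ W₀ (q.1 i).1 ^ 3 *
      nearTie (τ * size σ₀ W₀ (q.1 i).1) (fun m => (q.2 i m : ℝ)) m
  let B : Fin n → (Fin n → Sample P d) × (Fin n → Fin M → unitInterval) → ℝ := fun i q =>
    size σ₀ W₀ (q.1 i).1 ^ 6
  let F : Fin J → (Fin n → Sample P d) × (Fin n → Fin M → unitInterval) → ℝ := fun j q =>
    deviationSq v (κ / M) σ₀ q.1 (fun i m => (q.2 i m : ℝ)) m (filter (W₀ m) j)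
  have hA0 : ∀ i q, 0 ≤ A i q := fun i q =>
    mul_nonneg (pow_nonneg (hs0 _) 3) (nearTie_nonneg _ _ _)
  have hB0 : ∀ i q, 0 ≤ B i q := fun i q => pow_nonneg (hs0 _) 6
  have hF0 : ∀ j q, 0 ≤ F j q := fun j q => by
    simp only [F]; unfold deviationSq; positivity
  have hAm : ∀ i, Measurable (A i) := fun i =>
    measurable_section (((measurable_size_round σ₀ i).pow_const 3).mul
      (measurable_nearTie_round σ₀ τ m i)) W₀
  have hBm : ∀ i, Measurable (B i) := fun i =>
    measurable_section ((measurable_size_round σ₀ i).pow_const 6) W₀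
  have hFm : ∀ j, Measurable (F j) := fun j =>
    measurable_section (measurable_deviationSq v (κ / M) σ₀ m j) W₀
  have hprodmp : ∀ i, MeasurePreserving
      (Prod.map (fun S : Fin n → Sample P d => S i) fun r : Fin n → Fin M → unitInterval => r i)
      Q (D.prod (routerLaw M)) := fun i =>
    (measurePreserving_eval (fun _ : Fin n => D) i).prod
      (measurePreserving_eval (fun _ : Fin n => routerLaw M) i)
  have hAE : ∀ i, ∫⁻ q, ENNReal.ofReal (A i q) ∂Q ≤ ENNReal.ofReal (4 * M * τ) * E := fun i => by
    let f : Sample P d × (Fin M → unitInterval) → ENNReal := fun y =>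
      ENNReal.ofReal (size σ₀ W₀ y.1.1 ^ 3 *
        nearTie (τ * size σ₀ W₀ y.1.1) (fun m => (y.2 m : ℝ)) m)
    have hsz : Measurable fun y : Sample P d × (Fin M → unitInterval) => size σ₀ W₀ y.1.1 :=
      (measurable_size_sample σ₀ W₀).comp measurable_fst
    have hf : Measurable f := ((hsz.pow_const 3).mul ((measurable_nearTie m).comp
      ((hsz.const_mul τ).prodMk measurable_snd))).ennreal_ofReal
    have h1 : ∫⁻ q, ENNReal.ofReal (A i q) ∂Q = ∫⁻ y, f y ∂D.prod (routerLaw M) :=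
      (hprodmp i).lintegral_comp hf
    rw [h1, lintegral_prod _ hf.aemeasurable]
    calc _ ≤ ∫⁻ z, ENNReal.ofReal (4 * M * τ) * ENNReal.ofReal (size σ₀ W₀ z.1 ^ 6) ∂D := by
          refine lintegral_mono fun z => ?_
          simp only [f, ENNReal.ofReal_mul (pow_nonneg (hs0 z) 3)]
          rw [lintegral_const_mul' _ _ ENNReal.ofReal_ne_top]
          refine (mul_le_mul_right (lintegral_nearTie_le _ m) _).trans ?_
          rw [← ENNReal.ofReal_mul (pow_nonneg (hs0 z) 3), ← ENNReal.ofReal_mul (by positivity)]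
          refine ENNReal.ofReal_le_ofReal ?_
          have h4 : size σ₀ W₀ z.1 ^ 4 ≤ size σ₀ W₀ z.1 ^ 6 :=
            pow_le_pow_right₀ (hs z) (by norm_num)
          calc _ = 4 * M * τ * size σ₀ W₀ z.1 ^ 4 := by ring
            _ ≤ _ := mul_le_mul_of_nonneg_left h4 (by positivity)
      _ = _ := lintegral_const_mul' _ _ ENNReal.ofReal_ne_top
  have hBE : ∀ i, ∫⁻ q, ENNReal.ofReal (B i q) ∂Q = E := fun i => by
    let f : Sample P d × (Fin M → unitInterval) → ENNReal := fun y =>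
      ENNReal.ofReal (size σ₀ W₀ y.1.1 ^ 6)
    have hf1 : Measurable fun z : Sample P d => ENNReal.ofReal (size σ₀ W₀ z.1 ^ 6) :=
      ((measurable_size_sample σ₀ W₀).pow_const 6).ennreal_ofReal
    have h1 : ∫⁻ q, ENNReal.ofReal (B i q) ∂Q = ∫⁻ y, f y ∂D.prod (routerLaw M) :=
      (hprodmp i).lintegral_comp (hf1.comp measurable_fst)
    rw [h1]
    exact (measurePreserving_fst (μ := D) (ν := routerLaw M)).lintegral_comp hf1
  have hFE : ∀ j, ∫⁻ q, ENNReal.ofReal (F j q) ∂Q ≤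
      ENNReal.ofReal ((n : ℝ)⁻¹ * (P : ℝ) ^ 2) * E := fun j =>
    hD.lintegral_deviationSq_le hn hσ W₀ m j
  set b : ℝ := M * (J * ρ ^ 3) + 4 * τ with hb
  have hb0 : 0 ≤ b := by positivity
  have hpt : ∀ q, ENNReal.ofReal (gradientError v κ σ₀ τ ρ W₀ q.1 (fun i m => (q.2 i m : ℝ)) m) ≤
      ENNReal.ofReal (3 * (J * (n : ℝ)⁻¹)) * ∑ i, ENNReal.ofReal (A i q) +
      ENNReal.ofReal (3 * (J * b * (n : ℝ)⁻¹)) * ∑ i, ENNReal.ofReal (B i q) +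
      ENNReal.ofReal (3 * ν⁻¹) * ∑ j, ENNReal.ofReal (F j q) + ENNReal.ofReal (3 * (J * ν)) :=
    fun q => by
      rw [← ENNReal.ofReal_sum_of_nonneg fun i _ => hA0 i q,
        ← ENNReal.ofReal_sum_of_nonneg fun i _ => hB0 i q,
        ← ENNReal.ofReal_sum_of_nonneg fun i _ => hF0 i q,
        ← ENNReal.ofReal_mul (by positivity), ← ENNReal.ofReal_mul (by positivity),
        ← ENNReal.ofReal_mul (by positivity)]
      have e1 := Finset.sum_nonneg fun i (_ : i ∈ Finset.univ) => hA0 i q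
      have e2 := Finset.sum_nonneg fun i (_ : i ∈ Finset.univ) => hB0 i q
      have e3 := Finset.sum_nonneg fun i (_ : i ∈ Finset.univ) => hF0 i q
      rw [← ENNReal.ofReal_add (by positivity) (by positivity),
        ← ENNReal.ofReal_add (by positivity) (by positivity),
        ← ENNReal.ofReal_add (by positivity) (by positivity)]
      refine ENNReal.ofReal_le_ofReal ?_
      have e4 : ∑ j, √(F j q) ≤ ν⁻¹ * ∑ j, F j q + J * ν := by
        calc _ ≤ ∑ j, (ν⁻¹ * F j q + ν) :=
              Finset.sum_le_sum fun j _ => sqrt_le_div_add (hF0 j q) hν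
          _ = _ := by
              rw [Finset.sum_add_distrib, ← Finset.mul_sum]
              simp
      have e5 : gradientError v κ σ₀ τ ρ W₀ q.1 (fun i m => (q.2 i m : ℝ)) m =
          3 * (J * ((n : ℝ)⁻¹ * ∑ i, A i q) + J * (b * ((n : ℝ)⁻¹ * ∑ i, B i q)) +
            ∑ j, √(F j q)) := rfl
      rw [e5]
      linarith
  refine (lintegral_mono hpt).trans ?_
  rw [lintegral_add_right _ measurable_const, lintegral_const, measure_univ, mul_one]
  gcongr
  rw [lintegral_add_left, lintegral_add_left, lintegral_const_mul' _ _ ENNReal.ofReal_ne_top,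
    lintegral_const_mul' _ _ ENNReal.ofReal_ne_top, lintegral_const_mul' _ _ ENNReal.ofReal_ne_top,
    lintegral_finsetSum _ fun i _ => (hAm i).ennreal_ofReal,
    lintegral_finsetSum _ fun i _ => (hBm i).ennreal_ofReal,
    lintegral_finsetSum _ fun i _ => (hFm i).ennreal_ofReal]
  · calc _ ≤ ENNReal.ofReal (3 * (J * (n : ℝ)⁻¹)) * ∑ _i : Fin n, ENNReal.ofReal (4 * M * τ) * E +
          ENNReal.ofReal (3 * (J * b * (n : ℝ)⁻¹)) * ∑ _i : Fin n, E +
          ENNReal.ofReal (3 * ν⁻¹) * ∑ _j : Fin J, ENNReal.ofReal ((n : ℝ)⁻¹ * (P : ℝ) ^ 2) * E := by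
          gcongr with i _ i _ j _
          · exact hAE i
          · exact (hBE i).le
          · exact hFE j
      _ = _ := by
          simp only [Finset.sum_const, Finset.card_univ, Fintype.card_fin, nsmul_eq_mul]
          have key : ∀ a b c x y z w : ENNReal, a * (x * (y * E)) + b * (x * E) + c * (z * (w * E)) =
              (a * x * y + b * x + c * z * w) * E := fun a b c x y z w => by ring
          rw [← ENNReal.ofReal_natCast n, ← ENNReal.ofReal_natCast J, key,
            ← ENNReal.ofReal_mul (by positivity), ← ENNReal.ofReal_mul (by positivity),
            ← ENNReal.ofReal_mul (by positivity), ← ENNReal.ofReal_mul (by positivity),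
            ← ENNReal.ofReal_mul (by positivity), ← ENNReal.ofReal_add (by positivity)
            (by positivity), ← ENNReal.ofReal_add (by positivity) (by positivity)]
          congr 2
          field_simp
  · exact (Finset.measurable_sum _ fun i _ => (hAm i).ennreal_ofReal).const_mul _
  · exact ((Finset.measurable_sum _ fun i _ => (hAm i).ennreal_ofReal).const_mul _).add
      ((Finset.measurable_sum _ fun i _ => (hBm i).ennreal_ofReal).const_mul _)

lemma measurable_comp_round {f : RoundOutcome M J P d n → ℝ} (h : Measurable f) (t : ℕ) :
    Measurable fun ω : Outcome M J P d n => f (ω.2.1, ω.1, ω.2.2 t) := by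
  have h1 : Measurable fun ω : Outcome M J P d n => ω.2.2 t :=
    (measurable_pi_apply t).comp (measurable_snd.comp measurable_snd)
  exact h.comp ((measurable_fst.comp measurable_snd).prodMk (measurable_fst.prodMk h1))

lemma measurable_comp_init_sample {f : Experts M J d × Sample P d → ℝ} (h : Measurable f)
    (i : Fin n) : Measurable fun q : Experts M J d × (Fin n → Sample P d) => f (q.1, q.2 i) :=
  h.comp (measurable_fst.prodMk ((measurable_pi_apply i).comp measurable_snd))

lemma measurable_comp_pair {f : Experts M J d × (Fin n → Sample P d) → ℝ} (h : Measurable f) :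
    Measurable fun ω : Outcome M J P d n => f (ω.2.1, ω.1) :=
  h.comp ((measurable_fst.comp measurable_snd).prodMk measurable_fst)

/-- Markov's inequality for a real random variable. -/
lemma measure_lt_le_of_lintegral_le {Ω : Type*} [MeasurableSpace Ω] {μ : Measure Ω} {f : Ω → ℝ}
    (hf : Measurable f) {E B : ℝ} (hE : ∫⁻ ω, ENNReal.ofReal (f ω) ∂μ ≤ ENNReal.ofReal E)
    (hB : 0 < B) : μ {ω | B < f ω} ≤ ENNReal.ofReal (E / B) := by
  calc _ ≤ μ {ω | ENNReal.ofReal B ≤ ENNReal.ofReal (f ω)} :=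
        measure_mono fun ω hω => ENNReal.ofReal_le_ofReal (le_of_lt hω)
    _ ≤ (∫⁻ ω, ENNReal.ofReal (f ω) ∂μ) / ENNReal.ofReal B :=
        meas_ge_le_lintegral_div hf.ennreal_ofReal.aemeasurable (by simpa using hB)
          ENNReal.ofReal_ne_top
    _ ≤ ENNReal.ofReal E / ENNReal.ofReal B := by gcongr
    _ = _ := (ENNReal.ofReal_div_of_pos hB).symm

/-- The initialization, the sample and the noise of a single round are independent, whatever the
round. -/
lemma measurePreserving_round (D : Measure (Sample P d)) [IsProbabilityMeasure D] (t : ℕ) :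
    MeasurePreserving (fun ω : Outcome M J P d n => ((ω.2.1, ω.1, ω.2.2 t) : RoundOutcome M J P d n))
      (trainingLaw M J n D σ₀)
      ((initLaw M J d σ₀).prod ((Measure.pi fun _ : Fin n => D).prod (roundLaw n M))) := by
  have h1 : MeasurePreserving (fun r : ℕ → Fin n → Fin M → unitInterval => r t)
      (Measure.infinitePi fun _ : ℕ => roundLaw n M) (roundLaw n M) :=
    measurePreserving_eval_infinitePi (fun _ : ℕ => roundLaw n M) t
  have h2 := (MeasurePreserving.id (Measure.pi fun _ : Fin n => D)).prod
    ((MeasurePreserving.id (initLaw M J d σ₀)).prod h1)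
  have h3 := (measurePreserving_prodAssoc (Measure.pi fun _ : Fin n => D) (initLaw M J d σ₀)
    (roundLaw n M)).symm
  have h4 := (Measure.measurePreserving_swap (μ := Measure.pi fun _ : Fin n => D)
    (ν := initLaw M J d σ₀)).prod (MeasurePreserving.id (roundLaw n M))
  have h5 := measurePreserving_prodAssoc (initLaw M J d σ₀) (Measure.pi fun _ : Fin n => D)
    (roundLaw n M)
  exact h5.comp (h4.comp (h3.comp h2))

lemma IsDataModel.lintegral_round_le (hD : IsDataModel C₁ C₂ v c Dα Dβ Dγ place)
    (hn : 0 < n) (hσ : 0 < σ₀) (hτ : 0 ≤ τ) (hρ : 0 ≤ ρ) (hν : 0 < ν) (m : Fin M) (t : ℕ) :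
    ∫⁻ ω, ENNReal.ofReal (gradientError v ((∫ α, α ^ 3 ∂Dα) / K) σ₀ τ ρ ω.2.1 ω.1
        (fun i m => (ω.2.2 t i m : ℝ)) m) ∂trainingLaw M J n (dataLaw v c σp place) σ₀ ≤
      ENNReal.ofReal (errorMoment M J P n τ ρ ν (sizeMoment M J P C₂ σp)) := by
  have := hD.prob_data (σp := σp)
  have hE : 0 ≤ sizeMoment M J P C₂ σp := by
    have := sixthMoment_nonneg
    have := patchMoment_nonneg C₂ σp
    unfold sizeMoment
    positivity
  have hmeas := (measurable_gradientError (J := J) (P := P) (n := n) v ((∫ α, α ^ 3 ∂Dα) / K) σ₀ τ ρ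
    m).ennreal_ofReal
  have h1 := (measurePreserving_round (M := M) (J := J) (n := n) (σ₀ := σ₀)
    (dataLaw v c σp place) t).lintegral_comp hmeas
  refine (le_of_eq h1).trans ?_
  rw [lintegral_prod _ hmeas.aemeasurable]
  refine (lintegral_mono fun W₀ => hD.lintegral_gradientError_le hn hσ hτ hρ hν W₀ m).trans ?_
  rw [lintegral_add_right _ measurable_const, lintegral_const, measure_univ, mul_one,
    lintegral_const_mul' _ _ ENNReal.ofReal_ne_top]
  refine (add_le_add_left (mul_le_mul_right (hD.lintegral_size_le hσ) _) _).trans (le_of_eq ?_)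
  rw [← ENNReal.ofReal_mul (by positivity), ← ENNReal.ofReal_add (by positivity) (by positivity)]
  rfl

/-- The accumulated gradient error of all experts. -/
def totalError (v : Fin K → EuclideanSpace ℝ (Fin d)) (κ σ₀ τ ρ η : ℝ) (T : ℕ)
    (ω : Outcome M J P d n) : ℝ :=
  ∑ t ∈ Finset.range T, ∑ m, η * gradientError v κ σ₀ τ ρ ω.2.1 ω.1
    (fun i m => (ω.2.2 t i m : ℝ)) m

lemma sum_gradientError_le_totalError {κ η : ℝ} (hσ : 0 < σ₀) (hτ : 0 ≤ τ) (hρ : 0 ≤ ρ)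
    (hη : 0 ≤ η) (T : ℕ) (ω : Outcome M J P d n) (m : Fin M) :
    ∑ t ∈ Finset.range T, η * gradientError v κ σ₀ τ ρ ω.2.1 ω.1
      (fun i m => (ω.2.2 t i m : ℝ)) m ≤ totalError v κ σ₀ τ ρ η T ω :=
  Finset.sum_le_sum fun t _ => Finset.single_le_sum
    (f := fun m => η * gradientError v κ σ₀ τ ρ ω.2.1 ω.1 (fun i m => (ω.2.2 t i m : ℝ)) m)
    (fun m _ => mul_nonneg hη (gradientError_nonneg v hσ hτ hρ _ _ _ m)) (Finset.mem_univ m)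

/-- Since the gradient error of a round does not involve the trajectory, its expectation is the
same in all rounds, and Markov's inequality applies to the accumulated error. -/
lemma IsDataModel.measure_totalError_le (hD : IsDataModel C₁ C₂ v c Dα Dβ Dγ place)
    (hn : 0 < n) (hσ : 0 < σ₀) (hτ : 0 ≤ τ) (hρ : 0 ≤ ρ) (hν : 0 < ν) {η B : ℝ} (hη : 0 ≤ η)
    (T : ℕ) (hB : 0 < B) :
    trainingLaw M J n (dataLaw v c σp place) σ₀
        {ω | B < totalError v ((∫ α, α ^ 3 ∂Dα) / K) σ₀ τ ρ η T ω} ≤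
      ENNReal.ofReal (T * (M * (η * errorMoment M J P n τ ρ ν (sizeMoment M J P C₂ σp))) / B) := by
  have := hD.prob_data (σp := σp)
  have hm : ∀ t m, Measurable fun ω : Outcome M J P d n =>
      gradientError v ((∫ α, α ^ 3 ∂Dα) / K) σ₀ τ ρ ω.2.1 ω.1 (fun i m => (ω.2.2 t i m : ℝ)) m :=
    fun t m => measurable_comp_round (measurable_gradientError v _ σ₀ τ ρ m) t
  have hmt : Measurable fun ω : Outcome M J P d n =>
      totalError v ((∫ α, α ^ 3 ∂Dα) / K) σ₀ τ ρ η T ω := Finset.measurable_sum _ fun t _ =>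
    Finset.measurable_sum _ fun m _ => (hm t m).const_mul η
  refine measure_lt_le_of_lintegral_le hmt ?_ hB
  have h0 : ∀ (ω : Outcome M J P d n) t m, 0 ≤ η * gradientError v ((∫ α, α ^ 3 ∂Dα) / K) σ₀ τ ρ
      ω.2.1 ω.1 (fun i m => (ω.2.2 t i m : ℝ)) m := fun ω t m =>
    mul_nonneg hη (gradientError_nonneg v hσ hτ hρ _ _ _ m)
  have h1 : ∀ ω : Outcome M J P d n, ENNReal.ofReal
      (totalError v ((∫ α, α ^ 3 ∂Dα) / K) σ₀ τ ρ η T ω) =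
      ∑ t ∈ Finset.range T, ∑ m, ENNReal.ofReal η * ENNReal.ofReal
        (gradientError v ((∫ α, α ^ 3 ∂Dα) / K) σ₀ τ ρ ω.2.1 ω.1
          (fun i m => (ω.2.2 t i m : ℝ)) m) := fun ω => by
    rw [totalError, ENNReal.ofReal_sum_of_nonneg fun t _ => Finset.sum_nonneg fun m _ => h0 ω t m]
    refine Finset.sum_congr rfl fun t _ => ?_
    rw [ENNReal.ofReal_sum_of_nonneg fun m _ => h0 ω t m]
    exact Finset.sum_congr rfl fun m _ => ENNReal.ofReal_mul hη
  rw [lintegral_congr h1, lintegral_finsetSum _ fun t _ => Finset.measurable_sum _ fun m _ =>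
    ((hm t m).ennreal_ofReal.const_mul _)]
  calc _ ≤ ∑ _t ∈ Finset.range T, ∑ _m : Fin M, ENNReal.ofReal η *
        ENNReal.ofReal (errorMoment M J P n τ ρ ν (sizeMoment M J P C₂ σp)) := by
        refine Finset.sum_le_sum fun t _ => ?_
        rw [lintegral_finsetSum _ fun m _ => ((hm t m).ennreal_ofReal.const_mul _)]
        refine Finset.sum_le_sum fun m _ => ?_
        rw [lintegral_const_mul' _ _ ENNReal.ofReal_ne_top]
        exact mul_le_mul_right (hD.lintegral_round_le hn hσ hτ hρ hν m t) _
    _ = _ := by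
        simp only [Finset.sum_const, Finset.card_univ, Fintype.card_fin, nsmul_eq_mul,
          Finset.card_range]
        rw [← ENNReal.ofReal_natCast, ← ENNReal.ofReal_natCast, ← ENNReal.ofReal_mul hη,
          ← ENNReal.ofReal_mul (by positivity), ← ENNReal.ofReal_mul (by positivity)]

lemma lintegral_mean {X : Type*} [MeasurableSpace X] (μ : Measure X) [IsProbabilityMeasure μ]
    (hn : 0 < n) {g : X → ℝ} (hg : Measurable g) (hg0 : ∀ x, 0 ≤ g x) :
    ∫⁻ S, ENNReal.ofReal ((n : ℝ)⁻¹ * ∑ i, g (S i)) ∂Measure.pi (fun _ : Fin n => μ) =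
      ∫⁻ x, ENNReal.ofReal (g x) ∂μ := by
  have hn' : (n : ℝ) ≠ 0 := by exact_mod_cast hn.ne'
  have h3 : ∀ S : Fin n → X, ENNReal.ofReal ((n : ℝ)⁻¹ * ∑ i, g (S i)) =
      ENNReal.ofReal ((n : ℝ)⁻¹) * ∑ i, ENNReal.ofReal (g (S i)) := fun S => by
    rw [ENNReal.ofReal_mul (by positivity), ENNReal.ofReal_sum_of_nonneg fun i _ => hg0 _]
  have h4 : ∀ i : Fin n, ∫⁻ S : Fin n → X, ENNReal.ofReal (g (S i))
      ∂Measure.pi (fun _ : Fin n => μ) = ∫⁻ x, ENNReal.ofReal (g x) ∂μ := fun i =>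
    (measurePreserving_eval (fun _ : Fin n => μ) i).lintegral_comp hg.ennreal_ofReal
  have h5 : ∀ i : Fin n, Measurable fun S : Fin n → X => ENNReal.ofReal (g (S i)) := fun i =>
    (hg.comp (measurable_pi_apply i)).ennreal_ofReal
  rw [lintegral_congr h3, lintegral_const_mul' _ _ ENNReal.ofReal_ne_top,
    lintegral_finsetSum _ fun i _ => h5 i]
  simp only [h4, Finset.sum_const, Finset.card_univ, Fintype.card_fin, nsmul_eq_mul]
  rw [← mul_assoc, ← ENNReal.ofReal_natCast, ← ENNReal.ofReal_mul (by positivity),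
    inv_mul_cancel₀ hn', ENNReal.ofReal_one, one_mul]

lemma measurePreserving_init_sample (D : Measure (Sample P d)) [IsProbabilityMeasure D] :
    MeasurePreserving (fun ω : Outcome M J P d n => (ω.2.1, ω.1)) (trainingLaw M J n D σ₀)
      ((initLaw M J d σ₀).prod (Measure.pi fun _ : Fin n => D)) :=
  ((MeasurePreserving.id (initLaw M J d σ₀)).prod (measurePreserving_fst
    (μ := Measure.pi fun _ : Fin n => D) (ν := roundLaw n M))).comp (measurePreserving_round D 0)

lemma lintegral_init_sample (D : Measure (Sample P d)) [IsProbabilityMeasure D]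
    {f : Experts M J d × (Fin n → Sample P d) → ENNReal} (hf : Measurable f) :
    ∫⁻ ω, f (ω.2.1, ω.1) ∂trainingLaw M J n D σ₀ =
      ∫⁻ W₀, ∫⁻ S, f (W₀, S) ∂(Measure.pi fun _ : Fin n => D) ∂initLaw M J d σ₀ := by
  rw [(measurePreserving_init_sample D).lintegral_comp hf, lintegral_prod _ hf.aemeasurable]

lemma IsDataModel.measure_mean_size_le (hD : IsDataModel C₁ C₂ v c Dα Dβ Dγ place)
    (hn : 0 < n) (hσ : 0 < σ₀) {Γ : ℝ} (hΓ : 0 < Γ) :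
    trainingLaw M J n (dataLaw v c σp place) σ₀
        {ω | Γ < (n : ℝ)⁻¹ * ∑ i, size σ₀ ω.2.1 (ω.1 i).1 ^ 6} ≤
      ENNReal.ofReal (sizeMoment M J P C₂ σp / Γ) := by
  have := hD.prob_data (σp := σp)
  have hm : ∀ i : Fin n, Measurable fun q : Experts M J d × (Fin n → Sample P d) =>
      size σ₀ q.1 (q.2 i).1 ^ 6 := fun i =>
    (measurable_comp_init_sample (measurable_size σ₀) i).pow_const 6
  have hfm : Measurable fun q : Experts M J d × (Fin n → Sample P d) =>
      (n : ℝ)⁻¹ * ∑ i, size σ₀ q.1 (q.2 i).1 ^ 6 :=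
    (Finset.measurable_sum _ fun i _ => hm i).const_mul _
  have hfm2 : Measurable fun ω : Outcome M J P d n =>
      (n : ℝ)⁻¹ * ∑ i, size σ₀ ω.2.1 (ω.1 i).1 ^ 6 :=
    measurable_comp_pair hfm
  refine measure_lt_le_of_lintegral_le hfm2 ?_ hΓ
  rw [lintegral_init_sample (dataLaw v c σp place) (f := fun q : Experts M J d × (Fin n → Sample P d)
    => ENNReal.ofReal ((n : ℝ)⁻¹ * ∑ i, size σ₀ q.1 (q.2 i).1 ^ 6)) hfm.ennreal_ofReal]
  refine le_trans (lintegral_mono fun W₀ => le_of_eq ?_) (hD.lintegral_size_le hσ)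
  exact lintegral_mean (dataLaw v c σp place) hn (g := fun z => size σ₀ W₀ z.1 ^ 6)
    ((measurable_size_sample σ₀ W₀).pow_const 6)
    fun z => pow_nonneg (zero_le_one.trans (one_le_size hσ W₀ z.1)) 6

end GradientErrorMoment

/-! ### The initialization -/

section Initialization

variable {K M J P d n : ℕ} {σ₀ δ L N : ℝ} {v c : Fin K → EuclideanSpace ℝ (Fin d)}

/-- A generic initialization: within each expert the responses to the feature signals are
separated and not all small, and the weights have the expected magnitude. -/
structure IsGenericInit (v c : Fin K → EuclideanSpace ℝ (Fin d)) (g L N : ℝ)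
    (W₀ : Experts M J d) : Prop where
  gap : ∀ m q q', q ≠ q' → g < |coords v (W₀ m) q - coords v (W₀ m) q'|
  large : ∀ m, ∃ q, g ≤ coords v (W₀ m) q
  bound_v : ∀ m q, |coords v (W₀ m) q| ≤ L
  bound_c : ∀ m q, |coords c (W₀ m) q| ≤ L
  norm : ∀ m, ‖W₀ m‖ ^ 2 ≤ N

lemma coords_eq_inner (v : Fin K → EuclideanSpace ℝ (Fin d)) (w : ExpertWeights J d)
    (q : Fin K × Fin J) : coords v w q = inner ℝ w (embed q.2 (v q.1)) := inner_filter _ _ _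

lemma orthonormal_embed (hv : Orthonormal ℝ v) :
    Orthonormal ℝ fun q : Fin K × Fin J => (embed q.2 (v q.1) : ExpertWeights J d) := by
  refine ⟨fun q => by rw [norm_embed]; exact hv.1 q.1, fun q q' hq => ?_⟩
  simp only
  rw [inner_embed_embed]
  split_ifs with h
  · exact hv.2 fun h' => hq (Prod.ext h' h)
  · rfl

/-- In a generic initialization the leading response of an expert is unique and positive. -/
lemma IsGenericInit.exists_leader {g : ℝ} {W₀ : Experts M J d}
    (h : IsGenericInit v c g L N W₀)
    {k : Fin K} {m : Fin M} (hm : m ∈ expertSet v W₀ k) :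
    ∃ j, g ≤ coords v (W₀ m) (k, j) ∧
      ∀ q, q ≠ (k, j) → coords v (W₀ m) q + g ≤ coords v (W₀ m) (k, j) := by
  obtain ⟨j, hj⟩ := hm
  have hmax : ∀ q, coords v (W₀ m) q ≤ coords v (W₀ m) (k, j) := fun q => by
    have := hj q.1 q.2
    rwa [real_inner_comm, real_inner_comm _ (v k)] at this
  refine ⟨j, ?_, fun q hq => ?_⟩
  · obtain ⟨q, hq⟩ := h.large m
    exact hq.trans (hmax q)
  · have h1 := h.gap m q (k, j) hq
    rw [abs_of_nonpos (by linarith [hmax q])] at h1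
    linarith

lemma initLaw_apply_le (m : Fin M) {s : Set (ExpertWeights J d)} {b : ENNReal}
    (hs : isoGaussian (Fin J × Fin d) σ₀ s ≤ b) : initLaw M J d σ₀ {W₀ | W₀ m ∈ s} ≤ b := by
  have hmp := measurePreserving_eval (fun _ : Fin M => isoGaussian (Fin J × Fin d) σ₀) m
  calc _ ≤ initLaw M J d σ₀ (Function.eval m ⁻¹' toMeasurable (isoGaussian (Fin J × Fin d) σ₀) s) :=
        measure_mono fun W₀ hW => subset_toMeasurable _ _ hW
    _ = isoGaussian (Fin J × Fin d) σ₀ (toMeasurable (isoGaussian (Fin J × Fin d) σ₀) s) :=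
        hmp.measure_preimage (measurableSet_toMeasurable _ _).nullMeasurableSet
    _ ≤ b := by rwa [measure_toMeasurable]

/-- A difference of two coordinates is a centered Gaussian of variance `2 σ₀²`. -/
lemma measure_gap_le (hσ : 0 < σ₀) (hδ : 0 ≤ δ) (hv : Orthonormal ℝ v) {q q' : Fin K × Fin J}
    (hq : q ≠ q') :
    isoGaussian (Fin J × Fin d) σ₀ {w | |coords v w q - coords v w q'| ≤ δ * σ₀} ≤
      ENNReal.ofReal (2 * δ) := by
  have ho := orthonormal_embed (J := J) hv
  have hu : 1 ≤ ‖(embed q.2 (v q.1) : ExpertWeights J d) - embed q'.2 (v q'.1)‖ := by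
    have h1 := norm_sub_sq_real (embed q.2 (v q.1) : ExpertWeights J d) (embed q'.2 (v q'.1))
    have h2 : inner ℝ (embed q.2 (v q.1) : ExpertWeights J d) (embed q'.2 (v q'.1)) = 0 := ho.2 hq
    have h3 : ‖(embed q.2 (v q.1) : ExpertWeights J d)‖ = 1 := ho.1 q
    have h4 : ‖(embed q'.2 (v q'.1) : ExpertWeights J d)‖ = 1 := ho.1 q'
    rw [h2, h3, h4] at h1
    nlinarith [norm_nonneg ((embed q.2 (v q.1) : ExpertWeights J d) - embed q'.2 (v q'.1))]
  refine le_trans (measure_mono fun w hw => ?_) (measure_abs_inner_le hσ hu hδ)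
  simpa only [Set.mem_ofPred_eq, coords_eq_inner, inner_sub_right] using hw

lemma measure_small_le (hσ : 0 < σ₀) (hδ : δ ≤ 1 / 4) (hv : Orthonormal ℝ v) (k : Fin K) :
    isoGaussian (Fin J × Fin d) σ₀ {w | ∀ q, coords v w q < δ * σ₀} ≤
      ENNReal.ofReal ((3 / 4) ^ J) := by
  have ho : Orthonormal ℝ fun j : Fin J => (embed j (v k) : ExpertWeights J d) :=
    (orthonormal_embed (J := J) hv).comp (fun j => (k, j)) fun j j' h => (Prod.ext_iff.1 h).2
  have h := measure_forall_inner_lt hσ hδ ho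
  rw [Fintype.card_fin, ← ENNReal.ofReal_pow (by norm_num)] at h
  refine le_trans (measure_mono fun w hw => ?_) h
  intro j
  have := hw (k, j)
  rwa [coords_eq_inner] at this

lemma measure_bound_le (hL : 0 < L) {u : Fin K → EuclideanSpace ℝ (Fin d)} (hu : ∀ k, ‖u k‖ = 1)
    (q : Fin K × Fin J) :
    isoGaussian (Fin J × Fin d) σ₀ {w | L < |coords u w q|} ≤
      ENNReal.ofReal (σ₀ ^ 2 / L ^ 2) := by
  have h := measure_lt_le_of_lintegral_le (μ := isoGaussian (Fin J × Fin d) σ₀)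
    (f := fun w : ExpertWeights J d => inner ℝ w (embed q.2 (u q.1)) ^ 2) (E := σ₀ ^ 2)
    (B := L ^ 2) (by fun_prop) (by rw [lintegral_inner_sq, norm_embed, hu, mul_one]) (by positivity)
  refine le_trans (measure_mono fun w hw => ?_) h
  rw [Set.mem_ofPred_eq, coords_eq_inner] at hw
  rw [Set.mem_ofPred_eq, ← sq_abs (inner ℝ w _)]
  gcongr

lemma measure_norm_le (hN : 0 < N) :
    isoGaussian (Fin J × Fin d) σ₀ {w | N < ‖w‖ ^ 2} ≤
      ENNReal.ofReal (J * d * σ₀ ^ 2 / N) := by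
  refine measure_lt_le_of_lintegral_le (μ := isoGaussian (Fin J × Fin d) σ₀)
    (f := fun w : ExpertWeights J d => ‖w‖ ^ 2) (by fun_prop) ?_ hN
  rw [lintegral_norm_sq]
  simp

/-- Failure probability of a generic initialization with separation `δ σ₀`. -/
def initFailure (K M J d : ℕ) (σ₀ δ L N : ℝ) : ℝ :=
  M * ((K * J) ^ 2 * (2 * δ) + (3 / 4) ^ J + 2 * (K * J * (σ₀ ^ 2 / L ^ 2)) +
    J * d * σ₀ ^ 2 / N)

/-- Union bound over the experts, and over the pairs of coordinates of an expert. The term `M (3 /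
4) ^ J` accounts for the experts without a large positive coordinate. -/
lemma measure_not_isGenericInit_le (hK : 0 < K) (hσ : 0 < σ₀) (hδ : 0 ≤ δ) (hδ4 : δ ≤ 1 / 4)
    (hL : 0 < L) (hN : 0 < N) (hv : Orthonormal ℝ v) (hc : ∀ k, ‖c k‖ = 1) :
    initLaw M J d σ₀ {W₀ | ¬ IsGenericInit v c (δ * σ₀) L N W₀} ≤
      ENNReal.ofReal (initFailure K M J d σ₀ δ L N) := by
  set s₁ : Set (ExpertWeights J d) := ⋃ q, ⋃ q', {w | q ≠ q' ∧
    |coords v w q - coords v w q'| ≤ δ * σ₀}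
  set s₂ : Set (ExpertWeights J d) := {w | ∀ q, coords v w q < δ * σ₀}
  set s₃ : Set (ExpertWeights J d) := ⋃ q, {w | L < |coords v w q|}
  set s₄ : Set (ExpertWeights J d) := ⋃ q, {w | L < |coords c w q|}
  set s₅ : Set (ExpertWeights J d) := {w | N < ‖w‖ ^ 2}
  set μ := isoGaussian (Fin J × Fin d) σ₀
  have hsub : {W₀ : Experts M J d | ¬ IsGenericInit v c (δ * σ₀) L N W₀} ⊆
      ⋃ m, {W₀ | W₀ m ∈ s₁ ∪ s₂ ∪ (s₃ ∪ s₄) ∪ s₅} := by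
    intro W₀ hW
    by_contra hno
    simp only [Set.mem_iUnion, Set.mem_ofPred_eq, Set.mem_union, not_exists, not_or, s₁, s₂, s₃,
      s₄, s₅, not_and, not_le, not_lt, not_forall] at hno
    exact hW ⟨fun m q q' h => (hno m).1.1.1 q q' h, fun m => (hno m).1.1.2,
      fun m => (hno m).1.2.1, fun m => (hno m).1.2.2, fun m => (hno m).2⟩
  have h1 : μ s₁ ≤ ENNReal.ofReal ((K * J) ^ 2 * (2 * δ)) := by
    calc μ s₁ ≤ ∑ q : Fin K × Fin J, ∑ q' : Fin K × Fin J, ENNReal.ofReal (2 * δ) := by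
          refine (measure_iUnion_fintype_le _ _).trans (Finset.sum_le_sum fun q _ => ?_)
          refine (measure_iUnion_fintype_le _ _).trans (Finset.sum_le_sum fun q' _ => ?_)
          by_cases hq : q = q'
          · simp [hq]
          · simp only [ne_eq, hq, not_false_eq_true, true_and]
            exact measure_gap_le hσ hδ hv hq
      _ = _ := by
          simp only [Finset.sum_const, Finset.card_univ, Fintype.card_prod, Fintype.card_fin,
            nsmul_eq_mul]
          rw [← ENNReal.ofReal_natCast, ← ENNReal.ofReal_mul (by positivity),
            ← ENNReal.ofReal_mul (by positivity)]
          congr 1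
          push_cast
          ring
  have hb : ∀ u : Fin K → EuclideanSpace ℝ (Fin d), (∀ k, ‖u k‖ = 1) →
      μ (⋃ q, {w | L < |coords u w q|}) ≤ ENNReal.ofReal (K * J * (σ₀ ^ 2 / L ^ 2)) := fun u hu => by
    calc _ ≤ ∑ q : Fin K × Fin J, ENNReal.ofReal (σ₀ ^ 2 / L ^ 2) :=
          (measure_iUnion_fintype_le _ _).trans
            (Finset.sum_le_sum fun q _ => measure_bound_le hL hu q)
      _ = _ := by
          simp only [Finset.sum_const, Finset.card_univ, Fintype.card_prod, Fintype.card_fin,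
            nsmul_eq_mul]
          rw [← ENNReal.ofReal_natCast, ← ENNReal.ofReal_mul (by positivity)]
          push_cast
          rfl
  have hall : μ (s₁ ∪ s₂ ∪ (s₃ ∪ s₄) ∪ s₅) ≤ ENNReal.ofReal ((K * J) ^ 2 * (2 * δ) + (3 / 4) ^ J +
      2 * (K * J * (σ₀ ^ 2 / L ^ 2)) + J * d * σ₀ ^ 2 / N) := by
    rw [ENNReal.ofReal_add (by positivity) (by positivity),
      ENNReal.ofReal_add (by positivity) (by positivity),
      ENNReal.ofReal_add (by positivity) (by positivity),
      two_mul ((K : ℝ) * J * (σ₀ ^ 2 / L ^ 2)),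
      ENNReal.ofReal_add (by positivity) (by positivity)]
    refine (measure_union_le _ _).trans (add_le_add ((measure_union_le _ _).trans
      (add_le_add ((measure_union_le _ _).trans (add_le_add h1 ?_))
        ((measure_union_le _ _).trans (add_le_add (hb v hv.1) (hb c hc))))) (measure_norm_le hN))
    exact measure_small_le hσ hδ4 hv ⟨0, hK⟩
  calc _ ≤ ∑ _m : Fin M, _ := (measure_mono hsub).trans ((measure_iUnion_fintype_le _ _).trans
        (Finset.sum_le_sum fun m _ => initLaw_apply_le m hall))
    _ = _ := by
        simp only [Finset.sum_const, Finset.card_univ, Fintype.card_fin, nsmul_eq_mul]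
        rw [← ENNReal.ofReal_natCast, ← ENNReal.ofReal_mul (by positivity)]
        rfl

lemma trainingLaw_init_le {D : Measure (Sample P d)} [IsProbabilityMeasure D]
    {s : Set (Experts M J d)} {b : ENNReal} (hs : initLaw M J d σ₀ s ≤ b) :
    trainingLaw M J n D σ₀ {ω | ω.2.1 ∈ s} ≤ b := by
  have hmp : MeasurePreserving (fun ω : Outcome M J P d n => ω.2.1) (trainingLaw M J n D σ₀)
      (initLaw M J d σ₀) :=
    (measurePreserving_fst (μ := initLaw M J d σ₀)
      (ν := Measure.pi fun _ : Fin n => D)).comp (measurePreserving_init_sample D)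
  calc _ ≤ trainingLaw M J n D σ₀ ((fun ω => ω.2.1) ⁻¹' toMeasurable (initLaw M J d σ₀) s) :=
        measure_mono fun W₀ hW => subset_toMeasurable _ _ hW
    _ = initLaw M J d σ₀ (toMeasurable (initLaw M J d σ₀) s) :=
        hmp.measure_preimage (measurableSet_toMeasurable _ _).nullMeasurableSet
    _ ≤ b := by rwa [measure_toMeasurable]

lemma IsDataModel.ae_sample_label {C₁ C₂ σp : ℝ} {Dα Dβ Dγ : Measure ℝ}
    {place : Measure ((Fin 3 → Fin P) × Signal K)}
    (hD : IsDataModel C₁ C₂ v c Dα Dβ Dγ place) :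
    ∀ᵐ ω ∂trainingLaw M J n (dataLaw v c σp place) σ₀, ∀ i, |(ω.1 i).2| ≤ 1 := by
  have := hD.prob_data (σp := σp)
  have hmp : MeasurePreserving (fun ω : Outcome M J P d n => ω.1)
      (trainingLaw M J n (dataLaw v c σp place) σ₀)
      (Measure.pi fun _ : Fin n => dataLaw v c σp place) :=
    measurePreserving_fst
  rw [ae_all_iff]
  intro i
  exact ((measurePreserving_eval (fun _ : Fin n => dataLaw v c σp place) i).comp
    hmp).quasiMeasurePreserving.ae hD.ae_label

end Initialization

/-! ### Test error of a specialized expert -/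

section TestError

variable {K J P d : ℕ} {C₁ C₂ σp b x₀ : ℝ} {v c : Fin K → EuclideanSpace ℝ (Fin d)}
  {Dα Dβ Dγ : Measure ℝ} {place : Measure ((Fin 3 → Fin P) × Signal K)}

lemma continuous_expert (w : ExpertWeights J d) :
    Continuous fun x : Input P d => expert w x := by
  unfold expert
  fun_prop

lemma measurableSet_error (w : ExpertWeights J d) :
    MeasurableSet {z : Sample P d | z.2 * expert w z.1 ≤ 0} := by
  have h : Measurable fun z : Sample P d => expert w z.1 :=
    (continuous_expert w).measurable.comp measurable_fst
  exact measurableSet_le (measurable_snd.mul h) measurable_const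

lemma measurableSet_cluster {u : EuclideanSpace ℝ (Fin d)} (hu : ‖u‖ = 1) :
    MeasurableSet (cluster (P := P) u) := by
  have h : cluster (P := P) u = ⋃ p, {z : Sample P d | z.1 p = (inner ℝ u (z.1 p) : ℝ) • u} ∩
      {z | (inner ℝ u (z.1 p) : ℝ) ≠ 0} := by
    ext z
    simp only [cluster, Set.mem_iUnion, Set.mem_inter_iff, Set.mem_ofPred_eq]
    refine exists_congr fun p => ⟨?_, fun h => ⟨_, h.2, h.1⟩⟩
    rintro ⟨a, ha, hz⟩
    have : (inner ℝ u (z.1 p) : ℝ) = a := by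
      rw [hz, inner_smul_right, real_inner_self_eq_norm_sq, hu]
      ring
    rw [this]
    exact ⟨hz, ha⟩
  rw [h]
  have hm : ∀ p, Measurable fun z : Sample P d => z.1 p := fun p =>
    (measurable_pi_apply p).comp measurable_fst
  refine MeasurableSet.iUnion fun p => MeasurableSet.inter ?_ ?_
  · exact measurableSet_eq_fun (hm p) ((measurable_const.inner (hm p)).smul_const u)
  · exact (measurableSet_eq_fun (measurable_const.inner (hm p)) measurable_const).compl

lemma IsDataModel.measurePreserving_signal (hD : IsDataModel C₁ C₂ v c Dα Dβ Dγ place) :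
    MeasurePreserving (fun z : ((Fin 3 → Fin P) × Signal K) × Input P d => z.1.2)
      (latentLaw d σp place) (signalLaw K Dα Dβ Dγ) := by
  have := hD.prob_place
  have h1 : MeasurePreserving Prod.snd place (signalLaw K Dα Dβ Dγ) :=
    ⟨measurable_snd, hD.placement.law_signal⟩
  exact h1.comp measurePreserving_fst

/-- The cluster pair and the two signs are uniform and independent. -/
lemma IsDataModel.measurePreserving_discrete
    (hD : IsDataModel C₁ C₂ v c Dα Dβ Dγ place) :
    MeasurePreserving (fun z : ((Fin 3 → Fin P) × Signal K) × Input P d =>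
        (z.1.2.1, z.1.2.2.1, z.1.2.2.2.1)) (latentLaw d σp place)
      ((uniformOn (distinctPairs K)).prod ((uniformOn ({1, -1} : Set ℝ)).prod
        (uniformOn ({1, -1} : Set ℝ)))) := by
  have := isProbabilityMeasure_pairs hD.two_le
  have := hD.prob_α
  have := hD.prob_β
  have := hD.prob_γ
  have h1 := (MeasurePreserving.id (uniformOn (distinctPairs K))).prod
    ((MeasurePreserving.id (uniformOn ({1, -1} : Set ℝ))).prod
      (measurePreserving_fst (μ := uniformOn ({1, -1} : Set ℝ)) (ν := Dα.prod (Dβ.prod Dγ))))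
  exact h1.comp hD.measurePreserving_signal

lemma IsDataModel.latent_fst_real (hD : IsDataModel C₁ C₂ v c Dα Dβ Dγ place)
    (k : Fin K) :
    (latentLaw d σp place).real {z | z.1.2.1.1 = k} = (K : ℝ)⁻¹ := by
  have := isProbabilityMeasure_pairs hD.two_le
  have h1 := (measurePreserving_fst (μ := uniformOn (distinctPairs K))
    (ν := (uniformOn ({1, -1} : Set ℝ)).prod (uniformOn ({1, -1} : Set ℝ)))).comp
    (hD.measurePreserving_discrete (σp := σp))
  have h2 := h1.measureReal_preimage (s := {p | p.1 = k})
    (Set.toFinite _).measurableSet.nullMeasurableSet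
  refine h2.trans ?_
  have h3 := integral_pairs_fst hD.two_le fun i => if i = k then (1 : ℝ) else 0
  rw [Finset.sum_ite_eq' Finset.univ k, if_pos (Finset.mem_univ k), mul_one] at h3
  rw [← h3, ← integral_indicator_one (Set.toFinite _).measurableSet]
  congr 1
  funext p
  simp [Set.indicator_apply]

/-- The probability that an example comes from cluster `k'` and carries feature noise of cluster
`k` against its label: of the two signs of the noise, exactly one opposes the label. -/
lemma IsDataModel.latent_opposite_real (hD : IsDataModel C₁ C₂ v c Dα Dβ Dγ place)
    {k k' : Fin K} (hk : k' ≠ k) :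
    (latentLaw d σp place).real {z | z.1.2.1 = (k', k) ∧ z.1.2.2.1 * z.1.2.2.2.1 = -1} ≥
      ((K : ℝ) * (K - 1))⁻¹ * (1 / 2) := by
  have := isProbabilityMeasure_pairs hD.two_le
  set U := uniformOn ({1, -1} : Set ℝ) with hU
  have h1 : U.real {1} = 1 / 2 := by
    rw [hU, uniformOn_signs]
    have : (-1 : ℝ) ≠ 1 := by norm_num
    simp [Measure.real, this]
  have h2 : U.real {-1} = 1 / 2 := by
    rw [hU, uniformOn_signs]
    have : (1 : ℝ) ≠ -1 := by norm_num
    simp [Measure.real, this]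
  have h3 : (uniformOn (distinctPairs K)).real {(k', k)} = ((K : ℝ) * (K - 1))⁻¹ := by
    rw [pairs_real_singleton, if_pos hk]
  have hmp := hD.measurePreserving_discrete (σp := σp)
  have hprod : ∀ y e : ℝ, (latentLaw d σp place).real
      ((fun z => (z.1.2.1, z.1.2.2.1, z.1.2.2.2.1)) ⁻¹' ({(k', k)} ×ˢ ({y} ×ˢ {e}))) =
      ((K : ℝ) * (K - 1))⁻¹ * (U.real {y} * U.real {e}) := fun y e => by
    rw [hmp.measureReal_preimage ((measurableSet_singleton _).prod
      ((measurableSet_singleton _).prod (measurableSet_singleton _))).nullMeasurableSet,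
      measureReal_prod_prod, measureReal_prod_prod, h3]
  have := hD.prob_place
  have hsub : ((fun z : ((Fin 3 → Fin P) × Signal K) × Input P d =>
        (z.1.2.1, z.1.2.2.1, z.1.2.2.2.1)) ⁻¹' ({(k', k)} ×ˢ ({1} ×ˢ {-1}))) ∪
      ((fun z => (z.1.2.1, z.1.2.2.1, z.1.2.2.2.1)) ⁻¹' ({(k', k)} ×ˢ ({-1} ×ˢ {1}))) ⊆
      {z | z.1.2.1 = (k', k) ∧ z.1.2.2.1 * z.1.2.2.2.1 = -1} := by
    rintro z (⟨h4, h5, h6⟩ | ⟨h4, h5, h6⟩)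
    all_goals
      simp only [Set.mem_singleton_iff] at h4 h5 h6
      exact ⟨h4, by rw [h5, h6]; norm_num⟩
  have hdisj : Disjoint ((fun z : ((Fin 3 → Fin P) × Signal K) × Input P d =>
        (z.1.2.1, z.1.2.2.1, z.1.2.2.2.1)) ⁻¹' ({(k', k)} ×ˢ ({1} ×ˢ {-1})))
      ((fun z => (z.1.2.1, z.1.2.2.1, z.1.2.2.2.1)) ⁻¹' ({(k', k)} ×ˢ ({-1} ×ˢ {1}))) := by
    rw [Set.disjoint_left]
    rintro z ⟨_, h5, _⟩ ⟨_, h6, _⟩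
    simp only [Set.mem_singleton_iff] at h5 h6
    rw [h5] at h6
    norm_num at h6
  refine ge_trans (measureReal_mono hsub) (le_of_eq ?_)
  rw [measureReal_union hdisj (hmp.measurable ((measurableSet_singleton _).prod
      ((measurableSet_singleton _).prod (measurableSet_singleton _)))), hprod, hprod, h1, h2]
  ring

/-- Almost surely a Gaussian patch is not orthogonal to `v_k`, hence no multiple of `c_k`; the only
patch that can reveal the cluster is the center patch. -/
lemma IsDataModel.ae_mem_cluster_iff (hD : IsDataModel C₁ C₂ v c Dα Dβ Dγ place)
    (hσp : 0 < σp) (hd : 0 < d) (k : Fin K) :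
    ∀ᵐ z ∂latentLaw d σp place, assemble v c z ∈ cluster (c k) ↔ z.1.2.1.1 = k := by
  have := hD.prob_place
  have hs : 0 < σp / √(d : ℝ) := by positivity
  have hnoise : ∀ p, ∀ᵐ z ∂latentLaw d σp place, inner ℝ (z.2 p) (v k) ≠ 0 := fun p => by
    have hmp : MeasurePreserving (fun z : ((Fin 3 → Fin P) × Signal K) × Input P d => z.2 p)
        (latentLaw d σp place) (isoGaussian (Fin d) (σp / √(d : ℝ))) :=
      (measurePreserving_eval (fun _ : Fin P => isoGaussian (Fin d) (σp / √(d : ℝ))) p).comp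
        measurePreserving_snd
    have h : ∀ᵐ w ∂isoGaussian (Fin d) (σp / √(d : ℝ)), inner ℝ w (v k) ≠ 0 := by
      have h1 := measure_abs_inner_le hs (hD.norm_v k).ge le_rfl
      rw [ae_iff]
      refine le_antisymm (le_trans (measure_mono fun w hw => ?_) (h1.trans (by simp))) zero_le
      have : inner ℝ w (v k) = (0 : ℝ) := by simpa using hw
      simp [this]
    exact hmp.quasiMeasurePreserving.ae h
  have hcv : ∀ k', inner ℝ (c k) (v k') = (0 : ℝ) := fun k' =>
    hD.orthonormal.2 (i := Sum.inr k) (j := Sum.inl k') (by simp)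
  filter_upwards [hD.ae_latent, ae_all_iff.2 hnoise] with z hz hξ
  obtain ⟨⟨q, ⟨⟨k₁, k₂⟩, y, e, α, β, γ⟩⟩, ξ⟩ := z
  have h10 : q 1 ≠ q 0 := fun h => absurd (hz.inj h) (by decide)
  have hβ : 0 < β := hD.pos.trans_le hz.beta.1
  simp only [cluster, Set.mem_ofPred_eq, assemble]
  constructor
  · rintro ⟨p, a, ha, hp⟩
    have hcc : inner ℝ (c k) (a • c k) = a := by
      rw [inner_smul_right, real_inner_self_eq_norm_sq, hD.norm_c]
      ring
    split_ifs at hp with h0 h1 h2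
    · rw [← hp, inner_smul_right, hcv, mul_zero] at hcc
      exact absurd hcc.symm ha
    · by_contra hne
      have : inner ℝ (c k) (c k₁) = (0 : ℝ) :=
        hD.orthonormal.2 (i := Sum.inr k) (j := Sum.inr k₁) (by simpa using Ne.symm hne)
      rw [← hp, inner_smul_right, this, mul_zero] at hcc
      exact absurd hcc.symm ha
    · rw [← hp, inner_smul_right, hcv, mul_zero] at hcc
      exact absurd hcc.symm ha
    · refine absurd ?_ (hξ p)
      simp only
      rw [hp, inner_smul_left, hcv, mul_zero]
  · rintro rfl
    exact ⟨q 1, β, hβ.ne', by simp [h10]⟩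

/-- A cluster has probability `1 / K`, so conditioning on it is multiplication by `K`. -/
lemma IsDataModel.condError_eq (hD : IsDataModel C₁ C₂ v c Dα Dβ Dγ place)
    (hσp : 0 < σp) (hd : 0 < d) (w : ExpertWeights J d) (k : Fin K) :
    condError (dataLaw v c σp place) w (cluster (c k)) =
      K * (latentLaw d σp place).real {z | z.1.2.1.1 = k ∧
        (assemble v c z).2 * expert w (assemble v c z).1 ≤ 0} := by
  have hC := measurableSet_cluster (P := P) (hD.norm_c k)
  have hB := measurableSet_error (P := P) w
  have hae := hD.ae_mem_cluster_iff (σp := σp) hσp hd k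
  have h1 : (dataLaw v c σp place).real (cluster (c k)) = (K : ℝ)⁻¹ := by
    rw [← hD.latent_fst_real (σp := σp) k, dataLaw, map_measureReal_apply (measurable_assemble v c) hC]
    refine measureReal_congr ?_
    filter_upwards [hae] with z hz
    exact propext hz
  have h2 : (dataLaw v c σp place).real (cluster (c k) ∩ {z | z.2 * expert w z.1 ≤ 0}) =
      (latentLaw d σp place).real {z | z.1.2.1.1 = k ∧
        (assemble v c z).2 * expert w (assemble v c z).1 ≤ 0} := by
    rw [dataLaw, map_measureReal_apply (measurable_assemble v c) (hC.inter hB)]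
    refine measureReal_congr ?_
    filter_upwards [hae] with z hz
    exact propext (and_congr_left' hz)
  rw [condError, Measure.real, cond_apply hC, ENNReal.toReal_mul, ENNReal.toReal_inv]
  change ((dataLaw v c σp place).real _)⁻¹ * (dataLaw v c σp place).real _ = _
  rw [h1, h2, inv_inv]

/-- The expert `w` specializes in cluster `k`: its filter `j` responds to `v_k` with strength
at least `x₀`, and all other responses to signals are at most `b`. -/
structure IsSpecialized (v c : Fin K → EuclideanSpace ℝ (Fin d)) (w : ExpertWeights J d)
    (k : Fin K) (j : Fin J) (x₀ b : ℝ) : Prop where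
  lead : x₀ ≤ coords v w (k, j)
  other : ∀ q, q ≠ (k, j) → |coords v w q| ≤ b
  center : ∀ q, |coords c w q| ≤ b

/-- The output of an expert has the sign of its leading response, when the cube of that response
exceeds the sum of the cubes of all other responses. -/
lemma sign_expert_pos {w : ExpertWeights J d} {x : Input P d} {s a b' : ℝ} {j₀ : Fin J}
    {p₀ : Fin P} (hs : |s| ≤ 1) (hlead : a ≤ s * inner ℝ (filter w j₀) (x p₀) ^ 3)
    (hother : ∀ j p, (j, p) ≠ (j₀, p₀) → |inner ℝ (filter w j) (x p)| ≤ b') (hb : 0 ≤ b')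
    (hJP : J * P * b' ^ 3 < a) : 0 < s * expert w x := by
  have h1 : s * expert w x = ∑ q : Fin J × Fin P, s * inner ℝ (filter w q.1) (x q.2) ^ 3 := by
    rw [expert, Fintype.sum_prod_type]
    simp only [Finset.mul_sum]
  rw [h1, ← Finset.add_sum_erase _ _ (Finset.mem_univ (j₀, p₀))]
  have h2 : ∀ q ∈ Finset.univ.erase (j₀, p₀), -b' ^ 3 ≤ s * inner ℝ (filter w q.1) (x q.2) ^ 3 :=
    fun q hq => by
      have h3 := hother q.1 q.2 (Finset.ne_of_mem_erase hq)
      have h4 : |s * inner ℝ (filter w q.1) (x q.2) ^ 3| ≤ 1 * b' ^ 3 := by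
        rw [abs_mul, abs_pow]
        gcongr
      linarith [(abs_le.1 h4).1]
  have h5 := Finset.card_nsmul_le_sum _ _ _ h2
  have h6 : ((Finset.univ.erase (j₀, p₀) : Finset (Fin J × Fin P)).card : ℝ) ≤ J * P := by
    have : (Finset.univ.erase (j₀, p₀) : Finset (Fin J × Fin P)).card ≤ J * P :=
      (Finset.card_erase_le).trans (by simp)
    exact_mod_cast this
  rw [nsmul_eq_mul] at h5
  have h7 : 0 ≤ b' ^ 3 := by positivity
  simp only at hlead ⊢
  nlinarith

/-- All responses to the random noise patches are at most `b`. -/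
def IsQuiet (w : ExpertWeights J d) (b : ℝ) (ξ : Input P d) : Prop :=
  ∀ j p, |inner ℝ (ξ p) (filter w j)| ≤ b

/-- Chebyshev's inequality for the sum of the squared responses to the noise patches. -/
lemma latent_not_isQuiet_le [IsProbabilityMeasure place] (hb : 0 < b)
    (w : ExpertWeights J d) :
    (latentLaw d σp place).real {z | ¬ IsQuiet w b z.2} ≤ P * (σp ^ 2 / d * ‖w‖ ^ 2) / b ^ 2 := by
  have hm : ∀ j p, Measurable fun z : ((Fin 3 → Fin P) × Signal K) × Input P d =>
      inner ℝ (z.2 p) (filter w j) ^ 2 := fun j p =>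
    (((measurable_pi_apply p).comp measurable_snd).inner measurable_const).pow_const 2
  have hE : ∀ j p, ∫⁻ z, ENNReal.ofReal (inner ℝ (z.2 p) (filter w j) ^ 2) ∂latentLaw d σp place =
      ENNReal.ofReal (σp ^ 2 / d * ‖filter w j‖ ^ 2) := fun j p => by
    have hmp : MeasurePreserving (fun z : ((Fin 3 → Fin P) × Signal K) × Input P d => z.2 p)
        (latentLaw d σp place) (isoGaussian (Fin d) (σp / √(d : ℝ))) :=
      (measurePreserving_eval (fun _ : Fin P => isoGaussian (Fin d) (σp / √(d : ℝ))) p).comp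
        measurePreserving_snd
    have := hmp.lintegral_comp (f := fun u => ENNReal.ofReal (inner ℝ u (filter w j) ^ 2))
      (by fun_prop)
    rw [this, lintegral_inner_sq, mul_pow, div_pow, Real.sq_sqrt (by positivity)]
  have h := measure_lt_le_of_lintegral_le (μ := latentLaw d σp place)
    (f := fun z => ∑ j, ∑ p, inner ℝ (z.2 p) (filter w j) ^ 2)
    (E := P * (σp ^ 2 / d * ‖w‖ ^ 2)) (B := b ^ 2)
    (Finset.measurable_sum _ fun j _ => Finset.measurable_sum _ fun p _ => hm j p) (by
      have h1 : ∀ z : ((Fin 3 → Fin P) × Signal K) × Input P d,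
          ENNReal.ofReal (∑ j, ∑ p, inner ℝ (z.2 p) (filter w j) ^ 2) =
          ∑ j, ∑ p, ENNReal.ofReal (inner ℝ (z.2 p) (filter w j) ^ 2) := fun z => by
        rw [ENNReal.ofReal_sum_of_nonneg fun j _ => by positivity]
        refine Finset.sum_congr rfl fun j _ => ?_
        rw [ENNReal.ofReal_sum_of_nonneg fun p _ => by positivity]
      rw [lintegral_congr h1, lintegral_finsetSum _ fun j _ => Finset.measurable_sum _ fun p _ =>
        (hm j p).ennreal_ofReal]
      refine le_of_eq ?_
      calc _ = ∑ j, ∑ _p : Fin P, ENNReal.ofReal (σp ^ 2 / d * ‖filter w j‖ ^ 2) := by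
            refine Finset.sum_congr rfl fun j _ => ?_
            rw [lintegral_finsetSum _ fun p _ => (hm j p).ennreal_ofReal]
            exact Finset.sum_congr rfl fun p _ => hE j p
        _ = _ := by
            simp only [Finset.sum_const, Finset.card_univ, Fintype.card_fin, nsmul_eq_mul]
            rw [← Finset.mul_sum, ← ENNReal.ofReal_sum_of_nonneg fun j _ => by positivity,
              ← Finset.mul_sum, sum_norm_filter_sq, ← ENNReal.ofReal_natCast,
              ← ENNReal.ofReal_mul (by positivity)]) (by positivity)
  refine ENNReal.toReal_le_of_le_ofReal (by positivity) (le_trans (measure_mono fun z hz => ?_) h)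
  simp only [Set.mem_ofPred_eq, IsQuiet, not_forall, not_le] at hz
  obtain ⟨j, p, hjp⟩ := hz
  rw [Set.mem_ofPred_eq]
  calc b ^ 2 < |inner ℝ (z.2 p) (filter w j)| ^ 2 := by gcongr
    _ = inner ℝ (z.2 p) (filter w j) ^ 2 := sq_abs _
    _ ≤ ∑ p, inner ℝ (z.2 p) (filter w j) ^ 2 := Finset.single_le_sum
        (f := fun p => inner ℝ (z.2 p) (filter w j) ^ 2) (fun _ _ => sq_nonneg _) (Finset.mem_univ p)
    _ ≤ _ := Finset.single_le_sum
        (f := fun j => ∑ p, inner ℝ (z.2 p) (filter w j) ^ 2)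
        (fun _ _ => Finset.sum_nonneg fun _ _ => sq_nonneg _) (Finset.mem_univ j)

/-- The response of a filter to a patch of an example, up to the leading response. -/
lemma IsSpecialized.abs_inner_patch_le {w : ExpertWeights J d} {k : Fin K} {j₀ : Fin J}
    (h : IsSpecialized v c w k j₀ x₀ b) (hb : 0 ≤ b)
    {z : ((Fin 3 → Fin P) × Signal K) × Input P d} (hz : IsRegular C₁ C₂ z.1) (hC : 0 < C₁)
    (hq : IsQuiet w b z.2) (j : Fin J) (p : Fin P)
    (h0 : p = z.1.1 0 → (z.1.2.1.1, j) ≠ (k, j₀)) (h2 : p = z.1.1 2 → (z.1.2.1.2, j) ≠ (k, j₀)) :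
    |inner ℝ (filter w j) ((assemble v c z).1 p)| ≤ (C₂ + 1) * b := by
  obtain ⟨⟨q, ⟨⟨k₁, k₂⟩, y, e, α, β, γ⟩⟩, ξ⟩ := z
  have hα : 0 ≤ α := hC.le.trans hz.alpha.1
  have hβ : 0 ≤ β := hC.le.trans hz.beta.1
  have hγ : 0 ≤ γ := hC.le.trans hz.gamma.1
  have hα' : α ≤ C₂ := hz.alpha.2
  have hβ' : β ≤ C₂ := hz.beta.2
  have hγ' : γ ≤ C₂ := hz.gamma.2
  have hy : |y| = 1 := by rcases hz.sign_y with h | h <;> simp only at h <;> simp [h]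
  have he : |e| = 1 := by rcases hz.sign_e with h | h <;> simp only at h <;> simp [h]
  have key : ∀ a t : ℝ, 0 ≤ a → a ≤ C₂ → |t| ≤ b → a * |t| ≤ (C₂ + 1) * b :=
    fun a t ha haC ht => by
      have : a * |t| ≤ C₂ * b := mul_le_mul haC ht (abs_nonneg t) (ha.trans haC)
      linarith
  simp only [assemble]
  split_ifs with g0 g1 g2
  · rw [inner_smul_right, abs_mul, abs_mul, hy, one_mul, abs_of_nonneg hα]
    exact key _ _ hα hα' (h.other (k₁, j) (h0 g0))
  · rw [inner_smul_right, abs_mul, abs_of_nonneg hβ]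
    exact key _ _ hβ hβ' (h.center (k₁, j))
  · rw [inner_smul_right, abs_mul, abs_mul, he, one_mul, abs_of_nonneg hγ]
    exact key _ _ hγ hγ' (h.other (k₂, j) (h2 g2))
  · have h3 := hq j p
    rw [real_inner_comm] at h3
    have : 0 ≤ C₂ * b := mul_nonneg (hα.trans hα') hb
    simp only at h3
    linarith

/-- A specialized expert classifies the examples of its cluster correctly. -/
lemma IsSpecialized.correct {w : ExpertWeights J d} {k : Fin K} {j₀ : Fin J}
    (h : IsSpecialized v c w k j₀ x₀ b) (hb : 0 ≤ b) (hx : 0 ≤ x₀)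
    {z : ((Fin 3 → Fin P) × Signal K) × Input P d} (hz : IsRegular C₁ C₂ z.1) (hC : 0 < C₁)
    (hq : IsQuiet w b z.2) (hsmall : J * P * ((C₂ + 1) * b) ^ 3 < (C₁ * x₀) ^ 3)
    (hk : z.1.2.1.1 = k) :
    0 < (assemble v c z).2 * expert w (assemble v c z).1 := by
  have hC2 : 0 ≤ C₂ := hC.le.trans (hz.alpha.1.trans hz.alpha.2)
  have hbd := fun j p => h.abs_inner_patch_le (v := v) (c := c) hb hz hC hq j p
  have hsign : (assemble v c z).2 = z.1.2.2.1 := rfl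
  have hy : |(assemble v c z).2| ≤ 1 := by
    rw [hsign]
    rcases hz.sign_y with h | h <;> rw [h] <;> simp
  have hinj : z.1.1 2 ≠ z.1.1 0 := fun h => absurd (hz.inj h) (by decide)
  refine sign_expert_pos (j₀ := j₀) (p₀ := z.1.1 0) hy ?_ (fun j p hjp => hbd j p ?_ ?_)
    (by positivity) hsmall
  · have hpatch : (assemble v c z).1 (z.1.1 0) = (z.1.2.2.1 * z.1.2.2.2.2.1) • v z.1.2.1.1 :=
      if_pos rfl
    rw [hpatch, inner_smul_right, hsign, hk]
    have h1 : z.1.2.2.1 ^ 4 = 1 := by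
      rcases hz.sign_y with h | h <;> rw [h] <;> norm_num
    have h2 : C₁ * x₀ ≤ z.1.2.2.2.2.1 * inner ℝ (filter w j₀) (v k) :=
      mul_le_mul hz.alpha.1 h.lead hx (hC.le.trans hz.alpha.1)
    calc (C₁ * x₀) ^ 3 ≤ (z.1.2.2.2.2.1 * inner ℝ (filter w j₀) (v k)) ^ 3 := by gcongr
      _ = z.1.2.2.1 ^ 4 * (z.1.2.2.2.2.1 * inner ℝ (filter w j₀) (v k)) ^ 3 := by rw [h1, one_mul]
      _ = _ := by ring
  · intro hp hkj
    exact hjp (by rw [Prod.mk.injEq] at hkj ⊢; exact ⟨hkj.2, hp⟩)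
  · intro _ hkj
    rw [Prod.mk.injEq] at hkj
    exact hz.ne (hk.trans hkj.1.symm)

/-- A specialized expert misclassifies an example of another cluster when the feature noise of
its own cluster opposes the label. -/
lemma IsSpecialized.incorrect {w : ExpertWeights J d} {k : Fin K} {j₀ : Fin J}
    (h : IsSpecialized v c w k j₀ x₀ b) (hb : 0 ≤ b) (hx : 0 ≤ x₀)
    {z : ((Fin 3 → Fin P) × Signal K) × Input P d} (hz : IsRegular C₁ C₂ z.1) (hC : 0 < C₁)
    (hq : IsQuiet w b z.2) (hsmall : J * P * ((C₂ + 1) * b) ^ 3 < (C₁ * x₀) ^ 3)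
    (hk : z.1.2.1.2 = k) (hye : z.1.2.2.1 * z.1.2.2.2.1 = -1) :
    (assemble v c z).2 * expert w (assemble v c z).1 < 0 := by
  have hC2 : 0 ≤ C₂ := hC.le.trans (hz.alpha.1.trans hz.alpha.2)
  have hbd := fun j p => h.abs_inner_patch_le (v := v) (c := c) hb hz hC hq j p
  have hsign : (assemble v c z).2 = z.1.2.2.1 := rfl
  have hy : |-(assemble v c z).2| ≤ 1 := by
    rw [hsign]
    rcases hz.sign_y with h | h <;> rw [h] <;> simp
  have hinj0 : z.1.1 2 ≠ z.1.1 0 := fun h => absurd (hz.inj h) (by decide)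
  have hinj1 : z.1.1 2 ≠ z.1.1 1 := fun h => absurd (hz.inj h) (by decide)
  have hpos : 0 < -(assemble v c z).2 * expert w (assemble v c z).1 := by
    refine sign_expert_pos (j₀ := j₀) (p₀ := z.1.1 2) hy ?_ (fun j p hjp => hbd j p ?_ ?_)
      (by positivity) hsmall
    · have hpatch : (assemble v c z).1 (z.1.1 2) =
          (z.1.2.2.2.1 * z.1.2.2.2.2.2.2) • v z.1.2.1.2 := by
        refine (if_neg hinj0).trans ((if_neg hinj1).trans (if_pos rfl))
      rw [hpatch, inner_smul_right, hsign, hk]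
      have h1 : z.1.2.2.2.1 ^ 2 = 1 := by
        rcases hz.sign_e with h | h <;> rw [h] <;> norm_num
      have h2 : C₁ * x₀ ≤ z.1.2.2.2.2.2.2 * inner ℝ (filter w j₀) (v k) :=
        mul_le_mul hz.gamma.1 h.lead hx (hC.le.trans hz.gamma.1)
      calc (C₁ * x₀) ^ 3 ≤ (z.1.2.2.2.2.2.2 * inner ℝ (filter w j₀) (v k)) ^ 3 := by gcongr
        _ = -(z.1.2.2.1 * z.1.2.2.2.1) * z.1.2.2.2.1 ^ 2 *
            (z.1.2.2.2.2.2.2 * inner ℝ (filter w j₀) (v k)) ^ 3 := by rw [h1, hye]; ring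
        _ = _ := by ring
    · intro _ hkj
      rw [Prod.mk.injEq] at hkj
      exact hz.ne (hkj.1.trans hk.symm)
    · intro hp hkj
      exact hjp (by rw [Prod.mk.injEq] at hkj ⊢; exact ⟨hkj.2, hp⟩)
  linarith

lemma IsSpecialized.condError_le (hD : IsDataModel C₁ C₂ v c Dα Dβ Dγ place) (hσp : 0 < σp)
    (hd : 0 < d) {w : ExpertWeights J d} {k : Fin K} {j₀ : Fin J}
    (h : IsSpecialized v c w k j₀ x₀ b) (hb : 0 < b) (hx : 0 ≤ x₀)
    (hsmall : J * P * ((C₂ + 1) * b) ^ 3 < (C₁ * x₀) ^ 3) :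
    condError (dataLaw v c σp place) w (cluster (c k)) ≤
      K * (P * (σp ^ 2 / d * ‖w‖ ^ 2) / b ^ 2) := by
  have := hD.prob_place
  rw [hD.condError_eq hσp hd]
  refine mul_le_mul_of_nonneg_left (le_trans ?_ (latent_not_isQuiet_le (place := place) hb w))
    (by positivity)
  refine ENNReal.toReal_mono (measure_ne_top _ _) (measure_mono_ae ?_)
  filter_upwards [hD.ae_latent (σp := σp)] with z hz hbad
  obtain ⟨hk, hle⟩ := hbad
  intro hq
  exact absurd (h.correct hb.le hx hz hD.pos hq hsmall hk) (not_lt.2 hle)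

lemma IsSpecialized.le_condError (hD : IsDataModel C₁ C₂ v c Dα Dβ Dγ place) (hσp : 0 < σp)
    (hd : 0 < d) {w : ExpertWeights J d} {k : Fin K} {j₀ : Fin J}
    (h : IsSpecialized v c w k j₀ x₀ b) (hb : 0 < b) (hx : 0 ≤ x₀)
    (hsmall : J * P * ((C₂ + 1) * b) ^ 3 < (C₁ * x₀) ^ 3) {k' : Fin K} (hk' : k' ≠ k) :
    1 / (2 * (K : ℝ)) - K * (P * (σp ^ 2 / d * ‖w‖ ^ 2) / b ^ 2) ≤
      condError (dataLaw v c σp place) w (cluster (c k')) := by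
  have := hD.prob_place
  have hK : (2 : ℝ) ≤ K := by exact_mod_cast hD.two_le
  rw [hD.condError_eq hσp hd]
  set μ := latentLaw d σp place
  set E : Set (((Fin 3 → Fin P) × Signal K) × Input P d) := {z | z.1.2.1.1 = k' ∧
    (assemble v c z).2 * expert w (assemble v c z).1 ≤ 0}
  have h1 := latent_not_isQuiet_le (σp := σp) (place := place) hb w
  have h2 := hD.latent_opposite_real (σp := σp) hk'
  have h3 : μ.real {z | z.1.2.1 = (k', k) ∧ z.1.2.2.1 * z.1.2.2.2.1 = -1} ≤
      μ.real (E ∪ {z | ¬ IsQuiet w b z.2}) := by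
    refine ENNReal.toReal_mono (measure_ne_top _ _) (measure_mono_ae ?_)
    filter_upwards [hD.ae_latent (σp := σp)] with z hz hop
    obtain ⟨hk, hye⟩ := hop
    by_cases hq : IsQuiet w b z.2
    · refine Or.inl ⟨by rw [hk], (h.incorrect hb.le hx hz hD.pos hq hsmall (by rw [hk]) hye).le⟩
    · exact Or.inr hq
  have h4 := measureReal_union_le (μ := μ) E {z | ¬ IsQuiet w b z.2}
  have h5 : ((K : ℝ) * (K - 1))⁻¹ * (1 / 2) - P * (σp ^ 2 / d * ‖w‖ ^ 2) / b ^ 2 ≤ μ.real E := by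
    linarith
  have h6 : 1 / (2 * (K : ℝ)) ≤ K * (((K : ℝ) * (K - 1))⁻¹ * (1 / 2)) := by
    have h7 : K * (((K : ℝ) * (K - 1))⁻¹ * (1 / 2)) = 1 / (2 * (K - 1)) := by
      have : (K : ℝ) - 1 ≠ 0 := by linarith
      field_simp
    rw [h7]
    exact one_div_le_one_div_of_le (by linarith) (by linarith)
  calc _ ≤ K * (((K : ℝ) * (K - 1))⁻¹ * (1 / 2) - P * (σp ^ 2 / d * ‖w‖ ^ 2) / b ^ 2) := by
        rw [mul_sub]; linarith
    _ ≤ _ := by gcongr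

end TestError

/-! ### Orders of magnitude -/

section Scale

variable {K M J P d n : ℕ} {C₁ C₂ σp R s : ℝ}

lemma one_le_of_pow_mul_le {a b : ℕ} (hR : 1 ≤ R) (hs : 0 ≤ s) (hab : a ≤ b) (h : R ^ b * s ≤ 1) :
    R ^ a * s ≤ 1 :=
  (mul_le_mul_of_nonneg_right (pow_le_pow_right₀ hR hab) hs).trans h

lemma patchMoment_le (hR : 64 ≤ R) (hC0 : 0 ≤ C₂) (hC : C₂ ≤ R) (hσ0 : 0 ≤ σp) (hσ : σp ≤ R)
    (h6 : sixthMoment ≤ R) : patchMoment C₂ σp ≤ 2 * R ^ 7 := by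
  have h6' := sixthMoment_nonneg
  unfold patchMoment
  have h1 : C₂ ^ 6 ≤ R ^ 6 := by gcongr
  have h2 : sixthMoment * σp ^ 6 ≤ R * R ^ 6 := by gcongr
  have h3 : R ^ 6 ≤ R ^ 7 := pow_le_pow_right₀ (by linarith) (by norm_num)
  nlinarith

lemma sizeMoment_le (hR : 64 ≤ R) (hC0 : 0 ≤ C₂) (hC : C₂ ≤ R) (hσ0 : 0 ≤ σp) (hσ : σp ≤ R)
    (h6 : sixthMoment ≤ R) (hM : (M : ℝ) ≤ R) (hJ : (J : ℝ) ≤ R) (hP : (P : ℝ) ≤ R) :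
    sizeMoment M J P C₂ σp ≤ R ^ 30 := by
  have h6' := sixthMoment_nonneg
  have hp := patchMoment_le hR hC0 hC hσ0 hσ h6
  have hp0 := patchMoment_nonneg C₂ σp
  have hR1 : 1 ≤ R := by linarith
  have h1 : (P : ℝ) ^ 5 ≤ R ^ 5 := by gcongr
  have h2 : ((M * J * P : ℕ) : ℝ) ^ 5 * (M * J * sixthMoment) ≤ (R * R * R) ^ 5 * (R * R * R) := by
    push_cast
    gcongr
  have h3 : (P : ℝ) ^ 5 + ((M * J * P : ℕ) : ℝ) ^ 5 * (M * J * sixthMoment) ≤ 2 * R ^ 18 := by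
    have h4 : R ^ 5 ≤ R ^ 18 := pow_le_pow_right₀ hR1 (by norm_num)
    have h5 : (R * R * R) ^ 5 * (R * R * R) = R ^ 18 := by ring
    linarith
  have h4 : ((P : ℝ) ^ 5 + ((M * J * P : ℕ) : ℝ) ^ 5 * (M * J * sixthMoment)) *
      (P * patchMoment C₂ σp) ≤ 2 * R ^ 18 * (R * (2 * R ^ 7)) := by gcongr
  have h5 : 1 ≤ R ^ 26 := one_le_pow₀ hR1
  have h7 : (1215 : ℝ) ≤ R ^ 4 := by
    have : (64 : ℝ) ^ 4 ≤ R ^ 4 := by gcongr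
    norm_num at this
    linarith
  unfold sizeMoment
  calc _ ≤ 243 * (1 + 2 * R ^ 18 * (R * (2 * R ^ 7))) := by gcongr
    _ = 243 * (1 + 4 * R ^ 26) := by ring
    _ ≤ 1215 * R ^ 26 := by linarith
    _ ≤ R ^ 4 * R ^ 26 := by gcongr
    _ = R ^ 30 := by ring

/-- The expected gradient error is of order `σ₀^{3/2}` up to powers of `R`. The free scale `ν = s³`
balances the sampling error, as `n⁻¹ ≤ R s⁶`. -/
lemma errorMoment_le (hR : 64 ≤ R) (hs : 0 < s) (hRs : R ^ 200 * s ≤ 1) {E : ℝ} (hE0 : 0 ≤ E)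
    (hE : E ≤ R ^ 30) (hM : (M : ℝ) ≤ R) (hJ : (J : ℝ) ≤ R) (hP : (P : ℝ) ≤ R)
    (hn : (n : ℝ)⁻¹ ≤ R * s ^ 6) :
    errorMoment M J P n (R ^ 38 * s ^ 4) (2 * s) (s ^ 3) E ≤ R ^ 36 * s ^ 3 := by
  have hR1 : 1 ≤ R := by linarith
  have hR0 : 0 < R := by linarith
  have h40 : R ^ 40 * s ≤ 1 := one_le_of_pow_mul_le hR1 hs.le (by norm_num) hRs
  have hs3 : 0 < s ^ 3 := by positivity
  have h1 : (J : ℝ) * (4 * M * (R ^ 38 * s ^ 4)) ≤ 4 * s ^ 3 := by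
    calc (J : ℝ) * (4 * M * (R ^ 38 * s ^ 4)) ≤ R * (4 * R * (R ^ 38 * s ^ 4)) := by gcongr
      _ = 4 * s ^ 3 * (R ^ 40 * s) := by ring
      _ ≤ 4 * s ^ 3 := mul_le_of_le_one_right (by positivity) h40
  have h2 : (J : ℝ) * (M * (J * (2 * s) ^ 3) + 4 * (R ^ 38 * s ^ 4)) ≤
      8 * R ^ 3 * s ^ 3 + 4 * s ^ 3 := by
    calc (J : ℝ) * (M * (J * (2 * s) ^ 3) + 4 * (R ^ 38 * s ^ 4)) ≤
          R * (R * (R * (2 * s) ^ 3) + 4 * (R * (R ^ 38 * s ^ 4))) := by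
          refine mul_le_mul hJ (add_le_add (by gcongr) (mul_le_mul_of_nonneg_left
            (le_mul_of_one_le_left (by positivity) hR1) (by norm_num))) (by positivity) hR0.le
      _ = 8 * R ^ 3 * s ^ 3 + 4 * s ^ 3 * (R ^ 40 * s) := by ring
      _ ≤ _ := by
          have : 4 * s ^ 3 * (R ^ 40 * s) ≤ 4 * s ^ 3 :=
            mul_le_of_le_one_right (by positivity) h40
          linarith
  have h3 : (J : ℝ) * ((s ^ 3)⁻¹ * ((n : ℝ)⁻¹ * (P : ℝ) ^ 2)) ≤ R ^ 4 * s ^ 3 := by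
    calc (J : ℝ) * ((s ^ 3)⁻¹ * ((n : ℝ)⁻¹ * (P : ℝ) ^ 2)) ≤
          R * ((s ^ 3)⁻¹ * (R * s ^ 6 * R ^ 2)) := by gcongr
      _ = R ^ 4 * s ^ 3 := by
          field_simp
  have h4 : R ^ 3 ≤ R ^ 4 := pow_le_pow_right₀ hR1 (by norm_num)
  have h5 : 1 ≤ R ^ 4 := one_le_pow₀ hR1
  have h6 : (J : ℝ) * (4 * M * (R ^ 38 * s ^ 4)) +
      J * (M * (J * (2 * s) ^ 3) + 4 * (R ^ 38 * s ^ 4)) +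
      J * ((s ^ 3)⁻¹ * ((n : ℝ)⁻¹ * (P : ℝ) ^ 2)) ≤ 17 * R ^ 4 * s ^ 3 := by nlinarith
  have h7 : R ≤ R ^ 34 := by
    calc R = R ^ 1 := (pow_one R).symm
      _ ≤ R ^ 34 := pow_le_pow_right₀ hR1 (by norm_num)
  unfold errorMoment
  calc _ ≤ 3 * (17 * R ^ 4 * s ^ 3) * R ^ 30 + 3 * (R * s ^ 3) := by gcongr
    _ = (51 * R ^ 34 + 3 * R) * s ^ 3 := by ring
    _ ≤ (64 * R * R ^ 34) * s ^ 3 := by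
        gcongr
        have : R ^ 34 ≤ R * R ^ 34 := le_mul_of_one_le_left (by positivity) hR1
        linarith
    _ ≤ (R * R * R ^ 34) * s ^ 3 := by gcongr
    _ = _ := by ring

/-- The separation `R⁻⁸` beats the number of pairs of coordinates of all experts, and the bound `R³
σ₀` is the Chebyshev bound for all coordinates. -/
lemma initFailure_le (hR : 64 ≤ R) (hs : 0 < s) (hd : 0 < d) (hK : (K : ℝ) ≤ R)
    (hM : (M : ℝ) ≤ R) (hJ : (J : ℝ) ≤ R) :
    initFailure K M J d (s ^ 2) (R ^ 8)⁻¹ (R ^ 3 * s ^ 2) (R ^ 4 * (d * (s ^ 2) ^ 2)) ≤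
      M * (3 / 4) ^ J + 2 * (R ^ 2)⁻¹ := by
  have hR0 : 0 < R := by linarith
  have hd' : (0 : ℝ) < d := by exact_mod_cast hd
  have h1 : (M : ℝ) * ((K * J) ^ 2 * (2 * (R ^ 8)⁻¹)) ≤ 2 * (R ^ 3)⁻¹ := by
    calc (M : ℝ) * ((K * J) ^ 2 * (2 * (R ^ 8)⁻¹)) ≤ R * ((R * R) ^ 2 * (2 * (R ^ 8)⁻¹)) := by gcongr
      _ = _ := by field_simp
  have h2 : (M : ℝ) * (2 * (K * J * ((s ^ 2) ^ 2 / (R ^ 3 * s ^ 2) ^ 2))) ≤ 2 * (R ^ 3)⁻¹ := by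
    calc (M : ℝ) * (2 * (K * J * ((s ^ 2) ^ 2 / (R ^ 3 * s ^ 2) ^ 2))) ≤
          R * (2 * (R * R * ((s ^ 2) ^ 2 / (R ^ 3 * s ^ 2) ^ 2))) := by gcongr
      _ = _ := by field_simp
  have h3 : (M : ℝ) * (J * d * (s ^ 2) ^ 2 / (R ^ 4 * (d * (s ^ 2) ^ 2))) ≤ (R ^ 2)⁻¹ := by
    calc (M : ℝ) * (J * d * (s ^ 2) ^ 2 / (R ^ 4 * (d * (s ^ 2) ^ 2))) ≤
          R * (R * d * (s ^ 2) ^ 2 / (R ^ 4 * (d * (s ^ 2) ^ 2))) := by gcongr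
      _ = _ := by field_simp
  have h4 : 4 * (R ^ 3)⁻¹ ≤ (R ^ 2)⁻¹ := by
    have : (R ^ 3)⁻¹ = (R ^ 2)⁻¹ * R⁻¹ := by rw [← mul_inv]; ring
    rw [this]
    have h5 : R⁻¹ ≤ 64⁻¹ := by gcongr
    have h6 : 0 < (R ^ 2)⁻¹ := by positivity
    nlinarith
  unfold initFailure
  nlinarith

end Scale

/-! ### Typical outcomes of training -/

section Trained

variable {K M J P d n : ℕ} {C₁ C₂ σp R s η ηr : ℝ} {v c : Fin K → EuclideanSpace ℝ (Fin d)}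
  {Dα Dβ Dγ : Measure ℝ} {place : Measure ((Fin 3 → Fin P) × Signal K)}

/-- The polylogarithmic regime, with `R` a common bound for the polylogarithmic quantities and
`s` the square root of the initialization scale, so that `s` is also the total length of the
training trajectory. Every loss in the argument is a power of `R`, and `s` absorbs all of them. The
bounds on `n⁻¹` and `d` come from `n = Ω(d)` and `σ₀ ≥ d^{-1/3}`, that is `d σ₀³ ≥ 1`. -/
structure IsRegime (K M J P d n : ℕ) (C₁ C₂ σp R s η ηr : ℝ) (T : ℕ) : Prop where
  R_ge : 64 ≤ R
  s_pos : 0 < s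
  scale : R ^ 200 * s ≤ 1
  K_le : (K : ℝ) ≤ R
  M_le : (M : ℝ) ≤ R
  J_le : (J : ℝ) ≤ R
  P_le : (P : ℝ) ≤ R
  C₁_ge : R⁻¹ ≤ C₁
  C₂_le : C₂ + 1 ≤ R
  σp_pos : 0 < σp
  σp_le : σp ≤ R
  sixth_le : sixthMoment ≤ R
  d_pos : 0 < d
  n_pos : 0 < n
  n_inv_le : (n : ℝ)⁻¹ ≤ R * s ^ 6
  d_ge : 1 ≤ d * s ^ 6
  η_pos : 0 < η
  η_le : R ^ 70 * η ≤ s ^ 2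
  ηr_nonneg : 0 ≤ ηr
  ηr_le : ηr ≤ R ^ 3 * η
  horizon_le : η * T ≤ s
  le_horizon : s ≤ 2 * (η * T)

/-- A typical outcome of the randomness of training: the coordinates of each expert are separated
by `R⁻⁸ σ₀` at the initialization and bounded by `R³ σ₀`, and the accumulated gradient error is at
most `R³⁹ σ₀²`. Its parameters are the bound `R³⁸ σ₀²` for the router and the bound `2 √σ₀` for the
displacement of the experts. -/
structure IsTypical (v c : Fin K → EuclideanSpace ℝ (Fin d)) (κ R s η : ℝ) (T : ℕ)
    (ω : Outcome M J P d n) : Prop where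
  label : ∀ i, |(ω.1 i).2| ≤ 1
  init : IsGenericInit v c ((R ^ 8)⁻¹ * s ^ 2) (R ^ 3 * s ^ 2) (R ^ 4 * (d * (s ^ 2) ^ 2)) ω.2.1
  size : (n : ℝ)⁻¹ * ∑ i, size (s ^ 2) ω.2.1 (ω.1 i).1 ^ 6 ≤ R ^ 32
  error : totalError v κ (s ^ 2) (R ^ 38 * s ^ 4) (2 * s) η T ω ≤ R ^ 39 * s ^ 4

lemma IsDataModel.pow_three_le_integral (hD : IsDataModel C₁ C₂ v c Dα Dβ Dγ place) :
    C₁ ^ 3 ≤ ∫ α, α ^ 3 ∂Dα := by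
  have := hD.prob_α
  have hC := hD.pos
  have hint : Integrable (fun α : ℝ => α ^ 3) Dα := by
    refine Integrable.of_bound (by fun_prop) (C₂ ^ 3) ?_
    filter_upwards [hD.supp_α] with α hα
    have h0 : 0 ≤ α := hC.le.trans hα.1
    rw [Real.norm_of_nonneg (by positivity)]
    have := hα.2
    gcongr
  have h := integral_mono_ae (integrable_const (C₁ ^ 3)) hint (by
    filter_upwards [hD.supp_α] with α hα
    have := hα.1
    gcongr)
  simpa using h

/-- On typical outcomes, training makes every expert a specialist of its cluster. -/
lemma IsTypical.isSpecialized (hD : IsDataModel C₁ C₂ v c Dα Dβ Dγ place) {T : ℕ}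
    (hR : IsRegime K M J P d n C₁ C₂ σp R s η ηr T) {ω : Outcome M J P d n}
    (h : IsTypical v c ((∫ α, α ^ 3 ∂Dα) / K) R s η T ω) {k : Fin K} {m : Fin M}
    (hm : m ∈ expertSet v ω.2.1 k) :
    ∃ j, IsSpecialized v c ((train η ηr ω.1 ω.2.1 ω.2.2 T).2 m) k j ((R ^ 27)⁻¹ * s)
      (R ^ 15 * s ^ 2) := by
  have hR64 := hR.R_ge
  have hR1 : 1 ≤ R := by linarith
  have hR0 : 0 < R := by linarith
  have hs := hR.s_pos
  have hη := hR.η_pos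
  have hC₁ := hD.pos
  have hpow : ∀ a ≤ 200, R ^ a * s ≤ 1 := fun a ha =>
    one_le_of_pow_mul_le hR1 hs.le ha hR.scale
  have hs1 : s ≤ 1 := by simpa using hpow 0 (by norm_num)
  have hK0 : (0 : ℝ) < K := by exact_mod_cast k.pos
  have hM0 : (0 : ℝ) < M := by exact_mod_cast m.pos
  obtain ⟨j, hlead, hgap⟩ := h.init.exists_leader hm
  have hJ0 : (0 : ℝ) < J := by exact_mod_cast j.pos
  set κ := (∫ α, α ^ 3 ∂Dα) / K with hκ
  have hκR : (R ^ 4)⁻¹ ≤ κ := by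
    have h1 := hD.pow_three_le_integral
    have h2 : (R⁻¹) ^ 3 ≤ C₁ ^ 3 := by
      have := hR.C₁_ge
      gcongr
    calc (R ^ 4)⁻¹ = (R⁻¹) ^ 3 / R := by field_simp
      _ ≤ (∫ α, α ^ 3 ∂Dα) / K := by
          rw [inv_pow] at h2
          rw [inv_pow]
          exact div_le_div₀ ((by positivity : 0 ≤ (R ^ 3)⁻¹).trans (h2.trans h1)) (h2.trans h1)
            hK0 hR.K_le
  have hκ0 : 0 < κ := lt_of_lt_of_le (by positivity) hκR
  have hs2 : s ^ 2 ≤ s := by nlinarith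
  have hMR := hR.M_le
  have hJR := hR.J_le
  have hKR := hR.K_le
  have hKJ : ((K * J : ℕ) : ℝ) ≤ R ^ 2 := by
    push_cast
    calc (K : ℝ) * J ≤ R * R := by gcongr
      _ = R ^ 2 := by ring
  have hKJ0 : (0 : ℝ) < (K * J : ℕ) := by push_cast; positivity
  have h512 : (512 : ℝ) ≤ R ^ 2 := by nlinarith
  have hT : s ^ 2 + η * T ≤ 2 * s := by linarith [hR.horizon_le]
  -- the router moves by at most `R³⁸ σ₀²`, since `ηr ≤ R³ η` and `η T ≤ s`
  have hτ : T * (ηr * (M * (J * (2 * s) ^ 3) * R ^ 32)) ≤ R ^ 38 * s ^ 4 := by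
    calc T * (ηr * (M * (J * (2 * s) ^ 3) * R ^ 32)) ≤
          T * ((R ^ 3 * η) * (R * (R * (2 * s) ^ 3) * R ^ 32)) := by
          have := hR.ηr_le
          gcongr
      _ = 8 * R ^ 37 * s ^ 3 * (η * T) := by ring
      _ ≤ R * R ^ 37 * s ^ 3 * s := by
          have := hR.horizon_le
          gcongr
          linarith
      _ = _ := by ring
  -- discretization: the step size is small compared to `g⁵ / L⁴` for the gap `g` and the bound `L`
  have hηg : η * (512 * (R ^ 3 * s ^ 2) ^ 4 * (K * J : ℕ)) ≤ ((R ^ 8)⁻¹ * s ^ 2) ^ 5 := by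
    calc η * (512 * (R ^ 3 * s ^ 2) ^ 4 * (K * J : ℕ)) ≤
          η * (R ^ 2 * (R ^ 3 * s ^ 2) ^ 4 * R ^ 2) := by gcongr
      _ = (R ^ 40)⁻¹ * s ^ 8 * (R ^ 56 * η) := by field_simp
      _ ≤ (R ^ 40)⁻¹ * s ^ 8 * (R ^ 70 * η) := by
          gcongr
          norm_num
      _ ≤ (R ^ 40)⁻¹ * s ^ 8 * s ^ 2 := by
          have := hR.η_le
          gcongr
      _ = _ := by field_simp
  have hB := (sum_gradientError_le_totalError (v := v) (κ := κ) (σ₀ := s ^ 2)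
    (τ := R ^ 38 * s ^ 4) (ρ := 2 * s) (by positivity) (by positivity) (by positivity) hη.le T ω
    m).trans h.error
  have hgL : (R ^ 8)⁻¹ * s ^ 2 ≤ R ^ 3 * s ^ 2 := by
    have h1 : (R ^ 8)⁻¹ ≤ 1 := inv_le_one_of_one_le₀ (one_le_pow₀ hR1)
    have h2 : 1 ≤ R ^ 3 := one_le_pow₀ hR1
    gcongr
    linarith
  have hεg : (R ^ 26)⁻¹ * s ^ 2 ≤ (R ^ 8)⁻¹ * s ^ 2 / 2 := by
    have h1 : (R ^ 26)⁻¹ = (R ^ 8)⁻¹ * (R ^ 18)⁻¹ := by rw [← mul_inv]; ring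
    have h2 : (R ^ 18)⁻¹ ≤ 1 / 2 := by
      rw [one_div]
      apply inv_anti₀ (by norm_num)
      calc (2 : ℝ) ≤ R := by linarith
        _ = R ^ 1 := (pow_one R).symm
        _ ≤ R ^ 18 := pow_le_pow_right₀ hR1 (by norm_num)
    rw [h1]
    calc (R ^ 8)⁻¹ * (R ^ 18)⁻¹ * s ^ 2 ≤ (R ^ 8)⁻¹ * (1 / 2) * s ^ 2 := by gcongr
      _ = _ := by ring
  -- the growth rate `g² / (16 L² K J)` of the leading coordinate is at least `R⁻²⁶`
  have hεr : (R ^ 26)⁻¹ ≤ ((R ^ 8)⁻¹ * s ^ 2) ^ 2 / (16 * (R ^ 3 * s ^ 2) ^ 2 * (K * J : ℕ)) := by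
    calc (R ^ 26)⁻¹ = ((R ^ 8)⁻¹ * s ^ 2) ^ 2 / (R ^ 2 * (R ^ 3 * s ^ 2) ^ 2 * R ^ 2) := by
          field_simp
      _ ≤ _ := by
          gcongr
          linarith
  -- the accumulated perturbation, `R⁹⁷ σ₀²` up to a constant, is far below the gap `R⁻⁸ σ₀`
  have hbudget : 4 * (M : ℝ) ^ 2 / (3 * κ) * (R ^ 39 * s ^ 4) / ((R ^ 26)⁻¹) ^ 2 ≤
      (R ^ 8)⁻¹ * s ^ 2 / 16 := by
    calc 4 * (M : ℝ) ^ 2 / (3 * κ) * (R ^ 39 * s ^ 4) / ((R ^ 26)⁻¹) ^ 2 ≤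
          4 * R ^ 2 / (3 * (R ^ 4)⁻¹) * (R ^ 39 * s ^ 4) / ((R ^ 26)⁻¹) ^ 2 := by gcongr
      _ = 4 / 3 * 16 * (R ^ 105 * s) * s * ((R ^ 8)⁻¹ * s ^ 2 / 16) := by
          field_simp
      _ ≤ 64 * 1 * s * ((R ^ 8)⁻¹ * s ^ 2 / 16) := by
          have := hpow 105 (by norm_num)
          gcongr
          norm_num
      _ ≤ 1 * ((R ^ 8)⁻¹ * s ^ 2 / 16) := by
          have h1 := hpow 1 (by norm_num)
          rw [pow_one] at h1
          gcongr
          nlinarith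
      _ = _ := one_mul _
  obtain ⟨h1, h2, h3⟩ := trained_expert (ηr := ηr) hD.orthonormal (by positivity : 0 < s ^ 2) hη
    hR.ηr_nonneg hκ0 h.label h.size ω.2.2 hT hτ (by positivity : 0 < (R ^ 8)⁻¹ * s ^ 2) hgL hlead
    hgap (h.init.bound_v m) (h.init.bound_c m) hηg hB (by positivity : 0 < (R ^ 26)⁻¹) hεg hεr
    hbudget
  have hb : 4 * (R ^ 3 * s ^ 2) ^ 2 / ((R ^ 8)⁻¹ * s ^ 2) ≤ R ^ 15 * s ^ 2 := by
    calc 4 * (R ^ 3 * s ^ 2) ^ 2 / ((R ^ 8)⁻¹ * s ^ 2) = 4 * (R ^ 14 * s ^ 2) := by field_simp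
      _ ≤ R * (R ^ 14 * s ^ 2) := by gcongr; linarith
      _ = _ := by ring
  refine ⟨j, ⟨le_trans ?_ h1, fun q hq => (h2 q hq).trans hb, fun q => (h3 q).trans hb⟩⟩
  calc (R ^ 27)⁻¹ * s ≤ (R ^ 27)⁻¹ * (2 * (η * T)) := by
        have := hR.le_horizon
        gcongr
    _ ≤ (R ^ 27)⁻¹ * (R * (η * T)) := by
        gcongr
        linarith
    _ = _ := by field_simp

/-- On typical outcomes the trained experts have the claimed test errors. -/
lemma IsTypical.condError (hD : IsDataModel C₁ C₂ v c Dα Dβ Dγ place) {T : ℕ}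
    (hR : IsRegime K M J P d n C₁ C₂ σp R s η ηr T) {ω : Outcome M J P d n}
    (h : IsTypical v c ((∫ α, α ^ 3 ∂Dα) / K) R s η T ω) {k : Fin K} {m : Fin M}
    (hm : m ∈ expertSet v ω.2.1 k) :
    condError (dataLaw v c σp place) ((train η ηr ω.1 ω.2.1 ω.2.2 T).2 m) (cluster (c k)) ≤ R⁻¹ ∧
    ∀ k' : Fin K, k' ≠ k → 1 / 4 / (K : ℝ) ≤
      condError (dataLaw v c σp place) ((train η ηr ω.1 ω.2.1 ω.2.2 T).2 m) (cluster (c k')) := by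
  have hR64 := hR.R_ge
  have hR1 : 1 ≤ R := by linarith
  have hR0 : 0 < R := by linarith
  have hs := hR.s_pos
  have hη := hR.η_pos
  have hσp := hR.σp_pos
  have hd : (0 : ℝ) < d := by exact_mod_cast hR.d_pos
  have hK0 : (0 : ℝ) < K := by exact_mod_cast k.pos
  have hpow : ∀ a ≤ 200, R ^ a * s ≤ 1 := fun a ha =>
    one_le_of_pow_mul_le hR1 hs.le ha hR.scale
  have hs1 : s ≤ 1 := by simpa using hpow 0 (by norm_num)
  obtain ⟨j, hj⟩ := h.isSpecialized hD hR hm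
  set w := (train η ηr ω.1 ω.2.1 ω.2.2 T).2 m with hw
  have hC₂ : 0 ≤ C₂ := by
    have := hD.prob_α
    obtain ⟨α, hα⟩ := hD.supp_α.exists
    exact hD.pos.le.trans (hα.1.trans hα.2)
  -- leading response `R⁻²⁷ √σ₀` against other responses `R¹⁵ σ₀`: the additional `√σ₀` wins
  have hsmall : J * P * ((C₂ + 1) * (R ^ 15 * s ^ 2)) ^ 3 < (C₁ * ((R ^ 27)⁻¹ * s)) ^ 3 := by
    calc J * P * ((C₂ + 1) * (R ^ 15 * s ^ 2)) ^ 3 ≤ R * R * (R * (R ^ 15 * s ^ 2)) ^ 3 := by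
          have h1 := hR.J_le
          have h2 := hR.P_le
          have h3 := hR.C₂_le
          gcongr
      _ = R ^ 134 * s * (R⁻¹ * ((R ^ 27)⁻¹ * s)) ^ 3 * s ^ 2 := by field_simp
      _ < 1 * (R⁻¹ * ((R ^ 27)⁻¹ * s)) ^ 3 * 1 := by
          have h1 := hpow 134 (by norm_num)
          have h2 : s ^ 2 < 1 := by
            have h3 := hpow 1 (by norm_num)
            rw [pow_one] at h3
            have : s < 1 := by nlinarith
            nlinarith
          have h4 : 0 < (R⁻¹ * ((R ^ 27)⁻¹ * s)) ^ 3 := by positivity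
          calc _ ≤ 1 * (R⁻¹ * ((R ^ 27)⁻¹ * s)) ^ 3 * s ^ 2 := by gcongr
            _ < _ := by gcongr
      _ ≤ (C₁ * ((R ^ 27)⁻¹ * s)) ^ 3 := by
          have := hR.C₁_ge
          rw [one_mul, mul_one]
          gcongr
  have hnorm : ‖w‖ ^ 2 ≤ 2 * (R ^ 4 * (d * (s ^ 2) ^ 2)) + 2 * s ^ 2 := by
    have h1 := norm_train_sub_le (ηr := ηr) hη.le ω.1 ω.2.1 ω.2.2 T m
    have h2 : ‖w‖ ≤ ‖ω.2.1 m‖ + s := by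
      have h3 := norm_add_le (ω.2.1 m) (w - ω.2.1 m)
      rw [add_sub_cancel] at h3
      linarith [hR.horizon_le]
    have h4 := h.init.norm m
    have h5 : ‖w‖ ^ 2 ≤ (‖ω.2.1 m‖ + s) ^ 2 := by gcongr
    nlinarith [sq_nonneg (‖ω.2.1 m‖ - s)]
  -- the noise patches have variance `σp² / d` per direction, and `‖w‖²` is at most `R⁵ d σ₀²`
  have hquiet : K * (P * (σp ^ 2 / d * ‖w‖ ^ 2) / (R ^ 15 * s ^ 2) ^ 2) ≤ (R ^ 3)⁻¹ := by
    have h1 : ‖w‖ ^ 2 ≤ 4 * (R ^ 4 * (d * s ^ 4)) := by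
      have h2 : s ^ 2 ≤ R ^ 4 * (d * s ^ 4) := by
        have h3 : 1 ≤ d * s ^ 2 := by
          have h4 : s ^ 6 ≤ s ^ 2 := pow_le_pow_of_le_one hs.le hs1 (by norm_num)
          exact hR.d_ge.trans (by gcongr)
        have h5 : 1 ≤ R ^ 4 := one_le_pow₀ hR1
        calc s ^ 2 ≤ s ^ 2 * (R ^ 4 * (d * s ^ 2)) :=
              le_mul_of_one_le_right (by positivity) (one_le_mul_of_one_le_of_one_le h5 h3)
          _ = _ := by ring
      have h6 : R ^ 4 * (d * (s ^ 2) ^ 2) = R ^ 4 * (d * s ^ 4) := by ring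
      rw [h6] at hnorm
      linarith
    calc K * (P * (σp ^ 2 / d * ‖w‖ ^ 2) / (R ^ 15 * s ^ 2) ^ 2) ≤
          R * (R * (R ^ 2 / d * (R * (R ^ 4 * (d * s ^ 4)))) / (R ^ 15 * s ^ 2) ^ 2) := by
          have h2 := hR.K_le
          have h3 := hR.P_le
          have h4 := hR.σp_le
          have h5 : ‖w‖ ^ 2 ≤ R * (R ^ 4 * (d * s ^ 4)) :=
            h1.trans (mul_le_mul_of_nonneg_right (by linarith) (by positivity))
          gcongr
      _ = (R ^ 21)⁻¹ := by field_simp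
      _ ≤ (R ^ 3)⁻¹ := by
          gcongr
          norm_num
  have hb : 0 < R ^ 15 * s ^ 2 := by positivity
  have hx : 0 ≤ (R ^ 27)⁻¹ * s := by positivity
  constructor
  · refine (hj.condError_le hD hσp hR.d_pos hb hx hsmall).trans (hquiet.trans ?_)
    apply inv_anti₀ hR0
    calc R = R ^ 1 := (pow_one R).symm
      _ ≤ R ^ 3 := pow_le_pow_right₀ hR1 (by norm_num)
  · intro k' hk'
    refine le_trans ?_ (hj.le_condError hD hσp hR.d_pos hb hx hsmall hk')
    have h1 : (R ^ 3)⁻¹ ≤ 1 / 4 / (K : ℝ) := by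
      rw [div_div, one_div]
      apply inv_anti₀ (by positivity)
      calc 4 * (K : ℝ) ≤ R * R := by
            have := hR.K_le
            gcongr
            linarith
        _ = R ^ 2 := by ring
        _ ≤ R ^ 3 := pow_le_pow_right₀ hR1 (by norm_num)
    have h2 : 1 / (2 * (K : ℝ)) = 1 / 4 / K + 1 / 4 / K := by field_simp; norm_num
    linarith

/-- Union bound over the four requirements; the accumulated gradient error is handled by Markov's
inequality, with a factor of `R²` to spare. -/
lemma IsRegime.measure_not_isTypical_le (hD : IsDataModel C₁ C₂ v c Dα Dβ Dγ place) {T : ℕ}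
    (hR : IsRegime K M J P d n C₁ C₂ σp R s η ηr T) :
    (trainingLaw M J n (dataLaw v c σp place) (s ^ 2)).real
      {ω | ¬ IsTypical v c ((∫ α, α ^ 3 ∂Dα) / K) R s η T ω} ≤
      M * (3 / 4) ^ J + 4 * (R ^ 2)⁻¹ := by
  have := hD.prob_data (σp := σp)
  have hR64 := hR.R_ge
  have hR1 : 1 ≤ R := by linarith
  have hR0 : 0 < R := by linarith
  have hs := hR.s_pos
  have hη := hR.η_pos
  have hd : (0 : ℝ) < d := by exact_mod_cast hR.d_pos
  have hC₂ : 0 ≤ C₂ := by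
    have := hD.prob_α
    obtain ⟨α, hα⟩ := hD.supp_α.exists
    exact hD.pos.le.trans (hα.1.trans hα.2)
  have hE := sizeMoment_le (M := M) (J := J) (P := P) hR64 hC₂ (by linarith [hR.C₂_le])
    hR.σp_pos.le hR.σp_le hR.sixth_le hR.M_le hR.J_le hR.P_le
  have hE0 : 0 ≤ sizeMoment M J P C₂ σp := by
    have := sixthMoment_nonneg
    have := patchMoment_nonneg C₂ σp
    unfold sizeMoment
    positivity
  set μ := trainingLaw M J n (dataLaw v c σp place) (s ^ 2)
  set A₁ : Set (Outcome M J P d n) := {ω | ¬ ∀ i, |(ω.1 i).2| ≤ 1}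
  set A₂ : Set (Outcome M J P d n) := {ω | ω.2.1 ∈ {W₀ | ¬ IsGenericInit v c ((R ^ 8)⁻¹ * s ^ 2)
    (R ^ 3 * s ^ 2) (R ^ 4 * (d * (s ^ 2) ^ 2)) W₀}}
  set A₃ : Set (Outcome M J P d n) :=
    {ω | R ^ 32 < (n : ℝ)⁻¹ * ∑ i, size (s ^ 2) ω.2.1 (ω.1 i).1 ^ 6}
  set A₄ : Set (Outcome M J P d n) := {ω | R ^ 39 * s ^ 4 <
    totalError v ((∫ α, α ^ 3 ∂Dα) / K) (s ^ 2) (R ^ 38 * s ^ 4) (2 * s) η T ω}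
  have h1 : μ A₁ = 0 := hD.ae_sample_label
  have h2 : μ A₂ ≤ ENNReal.ofReal (M * (3 / 4) ^ J + 2 * (R ^ 2)⁻¹) := by
    refine trainingLaw_init_le ((measure_not_isGenericInit_le (by linarith [hD.two_le])
      (by positivity) (by positivity) ?_ (by positivity) (by positivity)
      (hD.orthonormal.comp Sum.inl Sum.inl_injective) hD.norm_c).trans
      (ENNReal.ofReal_le_ofReal (initFailure_le hR64 hs hR.d_pos hR.K_le hR.M_le hR.J_le)))
    rw [one_div]
    apply inv_anti₀ (by norm_num)
    calc (4 : ℝ) ≤ R := by linarith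
      _ = R ^ 1 := (pow_one R).symm
      _ ≤ R ^ 8 := pow_le_pow_right₀ hR1 (by norm_num)
  have h3 : μ A₃ ≤ ENNReal.ofReal ((R ^ 2)⁻¹) := by
    refine (hD.measure_mean_size_le hR.n_pos (by positivity) (by positivity)).trans
      (ENNReal.ofReal_le_ofReal ?_)
    calc sizeMoment M J P C₂ σp / R ^ 32 ≤ R ^ 30 / R ^ 32 := by gcongr
      _ = _ := by field_simp
  have h4 : μ A₄ ≤ ENNReal.ofReal ((R ^ 2)⁻¹) := by
    refine (hD.measure_totalError_le (ν := s ^ 3) hR.n_pos (by positivity) (by positivity)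
      (by positivity) (by positivity) hη.le T (by positivity)).trans (ENNReal.ofReal_le_ofReal ?_)
    have h5 := errorMoment_le (n := n) hR64 hs hR.scale hE0 hE hR.M_le hR.J_le hR.P_le hR.n_inv_le
    calc T * (M * (η * errorMoment M J P n (R ^ 38 * s ^ 4) (2 * s) (s ^ 3)
          (sizeMoment M J P C₂ σp))) / (R ^ 39 * s ^ 4) ≤
          T * (R * (η * (R ^ 36 * s ^ 3))) / (R ^ 39 * s ^ 4) := by
          have h6 : 0 ≤ errorMoment M J P n (R ^ 38 * s ^ 4) (2 * s) (s ^ 3)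
              (sizeMoment M J P C₂ σp) := by
            unfold errorMoment
            positivity
          have h7 := mul_nonneg hη.le h6
          have := hR.M_le
          gcongr
      _ = (η * T) * (R ^ 37 * s ^ 3) / (R ^ 39 * s ^ 4) := by ring
      _ ≤ s * (R ^ 37 * s ^ 3) / (R ^ 39 * s ^ 4) := by
          have := hR.horizon_le
          gcongr
      _ = _ := by field_simp
  have hsub : {ω : Outcome M J P d n | ¬ IsTypical v c ((∫ α, α ^ 3 ∂Dα) / K) R s η T ω} ⊆
      A₁ ∪ A₂ ∪ A₃ ∪ A₄ := by
    intro ω hω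
    by_contra hno
    simp only [Set.mem_union, not_or, A₁, A₂, A₃, A₄, Set.mem_ofPred_eq, not_not, not_lt] at hno
    exact hω ⟨hno.1.1.1, hno.1.1.2, hno.1.2, hno.2⟩
  refine ENNReal.toReal_le_of_le_ofReal (by positivity) ((measure_mono hsub).trans ?_)
  have e : (M : ℝ) * (3 / 4) ^ J + 4 * (R ^ 2)⁻¹ =
      (M * (3 / 4) ^ J + 2 * (R ^ 2)⁻¹) + (R ^ 2)⁻¹ + (R ^ 2)⁻¹ := by ring
  rw [e, ENNReal.ofReal_add (by positivity) (by positivity),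
    ENNReal.ofReal_add (by positivity) (by positivity)]
  refine (measure_union_le _ _).trans (add_le_add ((measure_union_le _ _).trans (add_le_add
    ((measure_union_le _ _).trans ?_) h3)) h4)
  rw [h1, zero_add]
  exact h2

end Trained

/-! ### The asymptotic regime -/

section Asymptotics

/-- The dimension is large compared to a constant `X`, and a power of its logarithm is small
compared to a small power of the dimension. -/
structure IsLarge (X : ℝ) (q d : ℕ) : Prop where
  log_ge : X ≤ Real.log d
  loglog_ge : X ≤ Real.log (Real.log d)
  pow_le : Real.log d ^ q ≤ (d : ℝ) ^ (0.005 : ℝ)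

lemma eventually_isLarge (X : ℝ) (q : ℕ) : ∀ᶠ d : ℕ in Filter.atTop, IsLarge X q d := by
  have h1 : Filter.Tendsto (fun d : ℕ => Real.log d) Filter.atTop Filter.atTop :=
    Real.tendsto_log_atTop.comp tendsto_natCast_atTop_atTop
  have h2 : Filter.Tendsto (fun d : ℕ => Real.log (Real.log d)) Filter.atTop Filter.atTop :=
    Real.tendsto_log_atTop.comp h1
  have h3 := (isLittleO_log_rpow_rpow_atTop (q : ℝ) (by norm_num : (0 : ℝ) < 0.005)).bound
    one_pos
  filter_upwards [h1.eventually_ge_atTop X, h1.eventually_ge_atTop 0, h2.eventually_ge_atTop X,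
    tendsto_natCast_atTop_atTop.eventually h3] with d hd1 hd0 hd2 hd3
  refine ⟨hd1, hd2, ?_⟩
  rw [one_mul, Real.norm_of_nonneg (by positivity), Real.norm_of_nonneg (by positivity),
    Real.rpow_natCast] at hd3
  exact hd3

/-- With `J` of larger order than `log M`, a union bound over `M` events of probability
`(3 / 4) ^ J` succeeds. -/
lemma mul_pow_le {M J : ℕ} {y ε : ℝ} (hy : 1 ≤ y) (hyε : 2 / ε ≤ y) (hε : 0 < ε)
    (hM : y ≤ M) (hJ : 8 * Real.log M ≤ J) : M * (3 / 4 : ℝ) ^ J ≤ ε / 2 := by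
  have hM0 : (0 : ℝ) < M := by linarith
  have h1 : (3 / 4 : ℝ) ≤ Real.exp (-(1 / 4)) := by
    have := Real.add_one_le_exp (-(1 / 4) : ℝ)
    linarith
  have h2 : (3 / 4 : ℝ) ^ J ≤ ((M : ℝ) ^ 2)⁻¹ := by
    calc (3 / 4 : ℝ) ^ J ≤ Real.exp (-(1 / 4)) ^ J := by gcongr
      _ = Real.exp (-(J / 4)) := by
          rw [← Real.exp_nat_mul]
          congr 1
          ring
      _ ≤ Real.exp (-(2 * Real.log M)) := by
          apply Real.exp_le_exp.2
          linarith
      _ = ((M : ℝ) ^ 2)⁻¹ := by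
          rw [Real.exp_neg, two_mul, Real.exp_add, Real.exp_log hM0, sq]
  calc M * (3 / 4 : ℝ) ^ J ≤ M * ((M : ℝ) ^ 2)⁻¹ := by gcongr
    _ = (M : ℝ)⁻¹ := by field_simp
    _ ≤ (2 / ε)⁻¹ := by
        apply inv_anti₀ (by positivity)
        linarith
    _ = ε / 2 := by rw [inv_div]

variable {K M J P d n a : ℕ} {C₁ C₂ σp cn cM CM cJ CJ cr Cr X s η ηr : ℝ}

/-- A constant that dominates all constants of the data model and of the asymptotic orders. -/
def constantBound (C₁ C₂ σp cn cM CM cJ CJ Cr ε : ℝ) : ℝ :=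
  64 + (|C₂| + 1) + C₁⁻¹ + σp + cn⁻¹ + cM⁻¹ + |CM| + |CJ| * |CM| + 8 * cJ⁻¹ + |Cr| +
    sixthMoment + 8 * ε⁻¹ + 2 * ε⁻¹ * cM⁻¹

lemma le_of_constantBound_le {ε l : ℝ} (hC₁ : 0 < C₁) (hσp : 0 < σp) (hcn : 0 < cn) (hcM : 0 < cM)
    (hcJ : 0 < cJ) (hε : 0 < ε) (h : constantBound C₁ C₂ σp cn cM CM cJ CJ Cr ε ≤ l) :
    (64 ≤ l ∧ |C₂| + 1 ≤ l ∧ C₁⁻¹ ≤ l ∧ σp ≤ l ∧ cn⁻¹ ≤ l ∧ |CM| ≤ l ∧ |CJ| * |CM| ≤ l) ∧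
    |Cr| ≤ l ∧ sixthMoment ≤ l ∧ cM⁻¹ ≤ l ∧ 8 * cJ⁻¹ ≤ l ∧ 8 * ε⁻¹ ≤ l ∧ 2 * ε⁻¹ * cM⁻¹ ≤ l := by
  have h6 := sixthMoment_nonneg
  have i1 : 0 < C₁⁻¹ := by positivity
  have i2 : 0 < cn⁻¹ := by positivity
  have i3 : 0 < cM⁻¹ := by positivity
  have i4 : 0 < cJ⁻¹ := by positivity
  have i5 : 0 < ε⁻¹ := by positivity
  have i6 : 0 < 2 * ε⁻¹ * cM⁻¹ := by positivity
  have i7 := abs_nonneg C₂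
  have i8 := abs_nonneg CM
  have i9 : 0 ≤ |CJ| * |CM| := by positivity
  have i10 := abs_nonneg Cr
  unfold constantBound at h
  refine ⟨⟨?_, ?_, ?_, ?_, ?_, ?_, ?_⟩, ?_, ?_, ?_, ?_, ?_, ?_⟩ <;> linarith

/-- All parameters fit into the regime with `R = (log d)^(2 a + 3)`. The crude bound `log x ≤ x`
gives at most a constant times `(log d)^(2 a + 1)` for `M` and `(log d)^(2 a + 2)` for `J`, the
last factor `log d` absorbs the constants, and `s ≤ d^{-0.005}` beats every power of `R` that is
needed. -/
lemma IsLarge.isRegime {ε : ℝ} (hC₁ : 0 < C₁) (hσp : 0 < σp) (hcn : 0 < cn) (hcM : 0 < cM)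
    (hcJ : 0 < cJ) (hcr : 0 < cr) (hε : 0 < ε)
    (hX : IsLarge (constantBound C₁ C₂ σp cn cM CM cJ CJ Cr ε) (200 * (2 * a + 3)) d)
    (hK : (K : ℝ) ≤ Real.log d ^ a) (hP : (P : ℝ) ≤ Real.log d ^ a) (hn : cn * d ≤ n)
    (hM : (M : ℝ) ≤ CM * (K * Real.log K * Real.log (Real.log d)))
    (hJ : (J : ℝ) ≤ CJ * (Real.log M * Real.log (Real.log d)))
    (hs : 0 < s) (hs1 : (d : ℝ) ^ (-(1 / 3) : ℝ) ≤ s ^ 2) (hs2 : s ^ 2 ≤ (d : ℝ) ^ (-0.01 : ℝ))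
    (hη : 0 < η) (hη1 : η ≤ s ^ 2 / Real.log d ^ (70 * (2 * a + 3)))
    (hηr1 : cr * (M : ℝ) ^ 2 * η ≤ ηr) (hηr2 : ηr ≤ Cr * (M : ℝ) ^ 2 * η) :
    IsRegime K M J P d n C₁ C₂ σp (Real.log d ^ (2 * a + 3)) s η ηr ⌊η⁻¹ * s⌋₊ := by
  set l := Real.log d with hldef
  obtain ⟨⟨hl64, hlC₂, hlC₁, hlσ, hln, hlM, hlJ⟩, hlr, hl6, -⟩ :=
    le_of_constantBound_le hC₁ hσp hcn hcM hcJ hε hX.log_ge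
  have hl1 : 1 ≤ l := by linarith only [hl64]
  have hl0 : 0 < l := by linarith only [hl64]
  have hll1 : 0 ≤ Real.log l := Real.log_nonneg hl1
  have hll2 : Real.log l ≤ l := Real.log_le_self hl0.le
  have hpow : ∀ p q : ℕ, p ≤ q → l ^ p ≤ l ^ q := fun p q h => pow_le_pow_right₀ hl1 h
  have hlR : l ≤ l ^ (2 * a + 3) := by
    calc l = l ^ 1 := (pow_one l).symm
      _ ≤ _ := hpow _ _ (by omega)
  have hd : 0 < d := by
    rcases Nat.eq_zero_or_pos d with h | h
    · rw [hldef, h] at hl1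
      norm_num at hl1
    · exact h
  have hd' : (0 : ℝ) < d := by exact_mod_cast hd
  have hMl : (M : ℝ) ≤ |CM| * l ^ (2 * a + 1) := by
    have h1 : Real.log K ≤ K := Real.log_le_self (by positivity)
    have h2 : 0 ≤ Real.log K := Real.log_natCast_nonneg K
    calc (M : ℝ) ≤ CM * (K * Real.log K * Real.log l) := hM
      _ ≤ |CM| * (K * Real.log K * Real.log l) := by
          have := le_abs_self CM
          gcongr
      _ ≤ |CM| * (l ^ a * l ^ a * l) := by
          have := h1.trans hK
          gcongr
      _ = _ := by ring
  have hMR : (M : ℝ) ≤ l ^ (2 * a + 3) := by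
    calc (M : ℝ) ≤ l * l ^ (2 * a + 1) := hMl.trans (by gcongr)
      _ = l ^ (2 * a + 2) := by ring
      _ ≤ _ := hpow _ _ (by omega)
  have hJR : (J : ℝ) ≤ l ^ (2 * a + 3) := by
    have h1 : Real.log M ≤ M := Real.log_le_self (by positivity)
    have h2 : 0 ≤ Real.log M := Real.log_natCast_nonneg M
    calc (J : ℝ) ≤ CJ * (Real.log M * Real.log l) := hJ
      _ ≤ |CJ| * (Real.log M * Real.log l) := by
          have := le_abs_self CJ
          gcongr
      _ ≤ |CJ| * ((|CM| * l ^ (2 * a + 1)) * l) := by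
          have := h1.trans hMl
          gcongr
      _ = (|CJ| * |CM|) * l ^ (2 * a + 2) := by ring
      _ ≤ l * l ^ (2 * a + 2) := by gcongr
      _ = _ := by ring
  have hscale : (l ^ (2 * a + 3)) ^ 200 * s ≤ 1 := by
    have h1 : s ≤ (d : ℝ) ^ (-0.005 : ℝ) := by
      refine le_of_sq_le_sq ?_ (by positivity)
      rw [← Real.rpow_natCast ((d : ℝ) ^ (-0.005 : ℝ)), ← Real.rpow_mul hd'.le]
      norm_num at hs2 ⊢
      exact hs2
    rw [← pow_mul, mul_comm (2 * a + 3)]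
    calc l ^ (200 * (2 * a + 3)) * s ≤ (d : ℝ) ^ (0.005 : ℝ) * (d : ℝ) ^ (-0.005 : ℝ) := by
          have := hX.pow_le
          gcongr
      _ = 1 := by
          rw [← Real.rpow_add hd']
          norm_num
  have hd_ge : 1 ≤ d * s ^ 6 := by
    have h1 : ((d : ℝ) ^ (-(1 / 3) : ℝ)) ^ 3 ≤ (s ^ 2) ^ 3 := by gcongr
    rw [← Real.rpow_natCast ((d : ℝ) ^ (-(1 / 3) : ℝ)), ← Real.rpow_mul hd'.le] at h1
    norm_num at h1
    rw [Real.rpow_neg_one] at h1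
    calc (1 : ℝ) = d * (d : ℝ)⁻¹ := by field_simp
      _ ≤ d * (s ^ 2) ^ 3 := by gcongr
      _ = _ := by ring
  have hn0 : (0 : ℝ) < n := lt_of_lt_of_le (by positivity) hn
  have hη70 : (l ^ (2 * a + 3)) ^ 70 * η ≤ s ^ 2 := by
    rw [← pow_mul, mul_comm (2 * a + 3)]
    rw [le_div_iff₀ (by positivity)] at hη1
    linarith only [hη1]
  have hfloor : (⌊η⁻¹ * s⌋₊ : ℝ) ≤ η⁻¹ * s := Nat.floor_le (by positivity)
  have hfloor2 : η⁻¹ * s < ⌊η⁻¹ * s⌋₊ + 1 := Nat.lt_floor_add_one _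
  have hRge : 64 ≤ l ^ (2 * a + 3) := hl64.trans hlR
  exact
    { R_ge := hRge
      s_pos := hs
      scale := hscale
      K_le := hK.trans (hpow _ _ (by omega))
      M_le := hMR
      J_le := hJR
      P_le := hP.trans (hpow _ _ (by omega))
      C₁_ge := by
        rw [inv_le_comm₀ (by positivity) hC₁]
        exact hlC₁.trans hlR
      C₂_le := by linarith only [le_abs_self C₂, hlC₂, hlR]
      σp_pos := hσp
      σp_le := hlσ.trans hlR
      sixth_le := hl6.trans hlR
      d_pos := hd
      n_pos := by exact_mod_cast hn0
      n_inv_le := by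
        calc (n : ℝ)⁻¹ ≤ (cn * d)⁻¹ := inv_anti₀ (by positivity) hn
          _ = cn⁻¹ * ((d : ℝ)⁻¹ * 1) := by rw [mul_inv, mul_one]
          _ ≤ l ^ (2 * a + 3) * ((d : ℝ)⁻¹ * (d * s ^ 6)) := by
              have : cn⁻¹ ≤ l ^ (2 * a + 3) := hln.trans hlR
              gcongr
          _ = _ := by field_simp
      d_ge := hd_ge
      η_pos := hη
      η_le := hη70
      ηr_nonneg := le_trans (by positivity) hηr1
      ηr_le := by
        calc ηr ≤ Cr * (M : ℝ) ^ 2 * η := hηr2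
          _ ≤ l ^ (2 * a + 3) * (l ^ (2 * a + 3)) ^ 2 * η := by
              have : Cr ≤ l ^ (2 * a + 3) := (le_abs_self Cr).trans (hlr.trans hlR)
              gcongr
          _ = _ := by ring
      horizon_le := by
        calc η * ⌊η⁻¹ * s⌋₊ ≤ η * (η⁻¹ * s) := by gcongr
          _ = s := by field_simp
      le_horizon := by
        have h1 : s = η * (η⁻¹ * s) := by field_simp
        have h2 : η * (η⁻¹ * s) ≤ η * (⌊η⁻¹ * s⌋₊ + 1) := by gcongr
        have h3 : η * 2 ≤ s := by
          have h4 : l ^ (2 * a + 3) ≤ (l ^ (2 * a + 3)) ^ 70 :=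
            le_self_pow₀ (by linarith only [hRge]) (by norm_num)
          have h5 : s ≤ 1 := by
            refine le_trans ?_ hscale
            exact le_mul_of_one_le_left hs.le (one_le_pow₀ (by linarith only [hRge]))
          have h6 : 64 * η ≤ s ^ 2 :=
            le_trans (mul_le_mul_of_nonneg_right (hRge.trans h4) hη.le) hη70
          nlinarith only [h5, h6, hη, hs]
        linarith only [h1, h2, h3] }

/-- The failure probability and the error level of the regime are at most `ε`. -/
lemma IsLarge.failure_le {ε : ℝ} (hC₁ : 0 < C₁) (hσp : 0 < σp) (hcn : 0 < cn) (hcM : 0 < cM)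
    (hcJ : 0 < cJ) (hε : 0 < ε)
    (hX : IsLarge (constantBound C₁ C₂ σp cn cM CM cJ CJ Cr ε) (200 * (2 * a + 3)) d)
    (hK : 2 ≤ K) (hM : cM * (K * Real.log K * Real.log (Real.log d)) ≤ M)
    (hJ : cJ * (Real.log M * Real.log (Real.log d)) ≤ J) :
    M * (3 / 4 : ℝ) ^ J + 4 * ((Real.log d ^ (2 * a + 3)) ^ 2)⁻¹ ≤ ε ∧
      (Real.log d ^ (2 * a + 3))⁻¹ ≤ ε := by
  set l := Real.log d with hldef
  obtain ⟨⟨hl64, -⟩, -, -, -, -, hlε, -⟩ :=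
    le_of_constantBound_le hC₁ hσp hcn hcM hcJ hε hX.log_ge
  obtain ⟨⟨hx64, -⟩, -, -, hxM, hxJ, -, hxε⟩ :=
    le_of_constantBound_le hC₁ hσp hcn hcM hcJ hε hX.loglog_ge
  set x := Real.log l
  have hl1 : 1 ≤ l := by linarith only [hl64]
  have hlR : l ≤ l ^ (2 * a + 3) := le_self_pow₀ hl1 (by omega)
  have hx0 : 0 < x := by linarith only [hx64]
  have hK' : (2 : ℝ) ≤ K := by exact_mod_cast hK
  have hKlog : 1 ≤ K * Real.log K := by
    have h1 : Real.log 2 ≤ Real.log K := Real.log_le_log (by norm_num) hK'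
    have h2 := Real.log_two_gt_d9
    nlinarith only [h1, h2, hK']
  have hMx : cM * x ≤ M := by
    refine le_trans ?_ hM
    have : x ≤ K * Real.log K * x := le_mul_of_one_le_left hx0.le hKlog
    gcongr
  have hx1 : 1 ≤ cM * x := by
    calc (1 : ℝ) = cM * cM⁻¹ := by field_simp
      _ ≤ cM * x := by gcongr
  have hx2 : 2 / ε ≤ cM * x := by
    calc 2 / ε = cM * (2 * ε⁻¹ * cM⁻¹) := by field_simp
      _ ≤ cM * x := by gcongr
  have hx3 : 8 * Real.log M ≤ J := by
    refine le_trans ?_ hJ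
    have h1 : 0 ≤ Real.log M := Real.log_natCast_nonneg M
    calc 8 * Real.log M = cJ * (Real.log M * (8 * cJ⁻¹)) := by field_simp
      _ ≤ cJ * (Real.log M * x) := by gcongr
  have h1 := mul_pow_le hx1 hx2 hε hMx hx3
  have hR0 : 0 < l ^ (2 * a + 3) := by positivity
  have hRε : (l ^ (2 * a + 3))⁻¹ ≤ ε / 8 := by
    calc (l ^ (2 * a + 3))⁻¹ ≤ (8 * ε⁻¹)⁻¹ := inv_anti₀ (by positivity) (hlε.trans hlR)
      _ = ε / 8 := by rw [mul_inv, inv_inv]; ring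
  have hR2 : ((l ^ (2 * a + 3)) ^ 2)⁻¹ ≤ (l ^ (2 * a + 3))⁻¹ :=
    inv_anti₀ hR0 (le_self_pow₀ (hl1.trans hlR) (by norm_num))
  constructor
  · linarith only [h1, hRε, hR2, hε]
  · linarith only [hRε, hε]

end Asymptotics

end MoE

end

theorem lemma5p2 :
    -- the absolute constant in the lower bound `Ω(1/K)`
    ∃ c₀ : ℝ, 0 < c₀ ∧
    -- `K, P ≤ (log d)^a`, and the logarithmic factor in the bound on `η`
    ∀ a : ℕ, ∃ A : ℕ,
    -- the absolute constants of the data model and of the orders of `n, M, J, ηr`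
    ∀ C₁ C₂ σp cn cM CM cJ CJ cr Cr : ℝ,
      0 < C₁ → 0 < σp → 0 < cn → 0 < cM → 0 < cJ → 0 < cr →
    ∀ ε : ℝ, 0 < ε → ∃ d₀ : ℕ, ∀ d : ℕ, d₀ ≤ d →
    ∀ (K P n M J : ℕ) (σ₀ η ηr : ℝ)
      (v c : Fin K → EuclideanSpace ℝ (Fin d))
      (Dα Dβ Dγ : MeasureTheory.Measure ℝ)
      (place : MeasureTheory.Measure ((Fin 3 → Fin P) × MoE.Signal K)),
      2 ≤ K → (K : ℝ) ≤ Real.log d ^ a →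
      3 ≤ P → (P : ℝ) ≤ Real.log d ^ a →
      Orthonormal ℝ (Sum.elim v c) →
      MeasureTheory.IsProbabilityMeasure Dα →
      MeasureTheory.IsProbabilityMeasure Dβ →
      MeasureTheory.IsProbabilityMeasure Dγ →
      (∀ᵐ s ∂Dα, C₁ ≤ s ∧ s ≤ C₂) →
      (∀ᵐ s ∂Dβ, C₁ ≤ s ∧ s ≤ C₂) →
      (∀ᵐ s ∂Dγ, C₁ ≤ s ∧ s ≤ C₂) →
      MoE.IsPlacement Dα Dβ Dγ place →
      -- `n = Ω(d)`
      cn * d ≤ n →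
      -- `M = Θ(K log K log log d)`
      cM * (K * Real.log K * Real.log (Real.log d)) ≤ M →
      (M : ℝ) ≤ CM * (K * Real.log K * Real.log (Real.log d)) →
      -- `J = Θ(log M log log d)`
      cJ * (Real.log M * Real.log (Real.log d)) ≤ J →
      (J : ℝ) ≤ CJ * (Real.log M * Real.log (Real.log d)) →
      -- `σ₀ ∈ [d^{-1/3}, d^{-0.01}]`
      (d : ℝ) ^ (-(1 / 3) : ℝ) ≤ σ₀ → σ₀ ≤ (d : ℝ) ^ (-0.01 : ℝ) →
      -- the expert learning rate is at most `σ₀` over a logarithmic factor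
      0 < η → η ≤ σ₀ / Real.log d ^ A →
      -- `ηr = Θ(M²) η`
      cr * (M : ℝ) ^ 2 * η ≤ ηr → ηr ≤ Cr * (M : ℝ) ^ 2 * η →
      -- with probability at least `1 - ε`, the claim holds at time `T₁ = ⌊η⁻¹ σ₀^{0.5}⌋`
      (MoE.trainingLaw M J n (MoE.dataLaw v c σp place) σ₀).real
        {ω | ¬ ∀ k : Fin K, ∀ m ∈ MoE.expertSet v ω.2.1 k,
          MoE.condError (MoE.dataLaw v c σp place)
              ((MoE.train η ηr ω.1 ω.2.1 ω.2.2 ⌊η⁻¹ * σ₀ ^ (0.5 : ℝ)⌋₊).2 m)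
              (MoE.cluster (c k)) ≤ ε ∧
          ∀ k' : Fin K, k' ≠ k →
            c₀ / K ≤ MoE.condError (MoE.dataLaw v c σp place)
              ((MoE.train η ηr ω.1 ω.2.1 ω.2.2 ⌊η⁻¹ * σ₀ ^ (0.5 : ℝ)⌋₊).2 m)
              (MoE.cluster (c k'))} ≤ ε := by
  refine ⟨1 / 4, by norm_num, fun a => ⟨70 * (2 * a + 3), ?_⟩⟩
  intro C₁ C₂ σp cn cM CM cJ CJ cr Cr hC₁ hσp hcn hcM hcJ hcr ε hε
  obtain ⟨d₀, hd₀⟩ := Filter.eventually_atTop.1 (MoE.eventually_isLarge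
    (MoE.constantBound C₁ C₂ σp cn cM CM cJ CJ Cr ε) (200 * (2 * a + 3)))
  refine ⟨d₀ + 1, fun d hd => ?_⟩
  intro K P n M J σ₀ η ηr v c Dα Dβ Dγ place hK hKa hP hPa hvc hα hβ hγ hsα hsβ hsγ hplace hn hM1
    hM2 hJ1 hJ2 hσ1 hσ2 hη hη1 hηr1 hηr2
  have hlarge := hd₀ d (by omega)
  have hd0 : (0 : ℝ) < d := by exact_mod_cast (by omega : 0 < d)
  have hσ0 : 0 < σ₀ := lt_of_lt_of_le (Real.rpow_pos_of_pos hd0 _) hσ1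
  obtain ⟨s, hs, rfl⟩ : ∃ s : ℝ, 0 < s ∧ σ₀ = s ^ 2 :=
    ⟨√σ₀, Real.sqrt_pos.2 hσ0, (Real.sq_sqrt hσ0.le).symm⟩
  have hroot : (s ^ 2) ^ (0.5 : ℝ) = s := by
    rw [← Real.rpow_natCast s 2, ← Real.rpow_mul hs.le]
    norm_num
  rw [hroot]
  have hD : MoE.IsDataModel C₁ C₂ v c Dα Dβ Dγ place :=
    ⟨hK, hC₁, hvc, hα, hβ, hγ, hsα, hsβ, hsγ, hplace⟩
  have hR := hlarge.isRegime hC₁ hσp hcn hcM hcJ hcr hε hKa hPa hn hM2 hJ2 hs hσ1 hσ2 hη hη1 hηr1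
    hηr2
  obtain ⟨hfail, hRε⟩ := hlarge.failure_le hC₁ hσp hcn hcM hcJ hε hK hM1 hJ1
  have := hD.prob_data (σp := σp)
  have : MeasureTheory.IsProbabilityMeasure
      (MoE.trainingLaw M J n (MoE.dataLaw v c σp place) (s ^ 2)) := by
    unfold MoE.trainingLaw
    infer_instance
  refine le_trans (MeasureTheory.measureReal_mono fun ω hω => ?_)
    ((hR.measure_not_isTypical_le hD).trans hfail)
  intro htyp
  refine hω fun k m hm => ?_
  have herr := htyp.condError hD hR hm
  exact ⟨herr.1.trans hRε, herr.2⟩
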